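/- Work in the word RAM model, in which words have at least $K\log_2 n$ bits for a constant $K$ of the (deterministic) program and each arithmetic operation, comparison and memory access takes one time step. For a graph $G$, a set $D$ of vertices is dominating if every vertex is in $D$ or adjacent to a vertex of $D$; let $\mathrm{OPT}(G)$ be the minimum size of a dominating set of $G$. There are a dynamic algorithm and a constant $\alpha$ such that for every $c>0$ there is a constant $C$ for which the following holds. Let $n\ge 2$, let $M\ge cn$, and let $G_0,G_1,\dots,G_M$ be graphs on the same $n$ vertices such that each $G_{t+1}$ is obtained from $G_t$ by inserting or deleting a single edge. Let $\Delta$ be the maximum vertex degree over all of $G_0,\dots,G_M$. The algorithm is given $G_0$ (as a list of edges) and then the updates one at a time, without knowledge of $M$, of $\Delta$ or of later updates. For every $t\in\{0,\dots,M\}$, after it has processed the $t$-th update (and, for $t=0$, the initial graph) it explicitly stores a dominating set $D_t$ of $G_t$ with $$|D_t|\le \alpha\,\log n\cdot \mathrm{OPT}(G_t),$$ and its total running time, on the initial graph and on all $M$ updates together, is at most $C\,M\,\Delta\log n$. In other words, an $O(\log n)$-approximation of Minimum Dominating Set is maintained over every sequence of $\Omega(n)$ edge insertions and deletions in $O(\Delta\log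 n)$ amortized time per update. -/

import Mathlib

/-! Dominating sets, dynamic graphs, and a word RAM with a step count on which dynamic graph
algorithms are run. -/

namespace DynDS

/-! ### Dominating sets -/

/-- Every vertex is in `D` or has a neighbour in `D`. -/
def IsDominating {V : Type*} (G : SimpleGraph V) (D : Finset V) : Prop :=
  ∀ v, v ∈ D ∨ ∃ u ∈ D, G.Adj u v

/-- The optimum of Minimum Dominating Set: the least size of a dominating set. -/
noncomputable def domNumber {V : Type*} (G : SimpleGraph V) : ℕ :=
  sInf {k | ∃ D : Finset V, IsDominating G D ∧ D.card = k}

/-! ### Dynamic graphs on the vertex set `{0, …, n - 1}` -/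

/-- A request to insert (`ins = true`) or delete (`ins = false`) the edge between `u` and `v`. -/
structure EdgeUpdate (n : ℕ) where
  ins : Bool
  u : Fin n
  v : Fin n

/-- The update is legal for `G` and turns `G` into `H`: a non-loop that is not an edge of `G` is
inserted, or an edge of `G` is deleted. -/
def EdgeUpdate.Transforms {n : ℕ} (e : EdgeUpdate n) (G H : SimpleGraph (Fin n)) : Prop :=
  if e.ins = true then
    e.u ≠ e.v ∧ ¬ G.Adj e.u e.v ∧ H = G ⊔ SimpleGraph.edge e.u e.v
  else
    G.Adj e.u e.v ∧ H = G.deleteEdges {s(e.u, e.v)}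

/-- `G 0, …, G M` is the dynamic graph produced from `G 0` by the updates `e 0, …, e (M - 1)`. -/
def IsDynamicGraph {n : ℕ} (M : ℕ) (G : ℕ → SimpleGraph (Fin n)) (e : ℕ → EdgeUpdate n) : Prop :=
  ∀ i < M, (e i).Transforms (G i) (G (i + 1))

open Classical in
/-- The maximum vertex degree over all of `G 0, …, G M`. -/
noncomputable def maxDegreeOver {n : ℕ} (M : ℕ) (G : ℕ → SimpleGraph (Fin n)) : ℕ :=
  (Finset.range (M + 1)).sup fun t => (G t).maxDegree

/-- `L` lists every edge of `G` exactly once, in any order and with its ends in any order. -/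
def IsEdgeList {n : ℕ} (G : SimpleGraph (Fin n)) (L : List (Fin n × Fin n)) : Prop :=
  (L.map fun p => s(p.1, p.2)).Nodup ∧
    ∀ z : Sym2 (Fin n), z ∈ L.map (fun p => s(p.1, p.2)) ↔ z ∈ G.edgeSet

/-! ### The word RAM

A program refers to finitely many registers and finitely many random-access arrays by fixed names.
Every computed value is a `w`-bit word, i.e. is reduced modulo `2 ^ w`; array indices are words.
Every node of an evaluated expression (constant, register, array access, arithmetic or comparison
operation) and every executed command or loop test costs one step. -/

/-- The contents of the registers and of the arrays. -/
structure State where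
  reg : ℕ → ℕ
  arr : ℕ → ℕ → ℕ

/-- Word operations. Subtraction is truncated at `0`, division and remainder are those of `ℕ`, and
the comparisons return `1` for true and `0` for false. -/
inductive BinOp where
  | add | sub | mul | div | mod | lt | eq

def BinOp.eval : BinOp → ℕ → ℕ → ℕ
  | .add, a, b => a + b
  | .sub, a, b => a - b
  | .mul, a, b => a * b
  | .div, a, b => a / b
  | .mod, a, b => a % b
  | .lt, a, b => if a < b then 1 else 0
  | .eq, a, b => if a = b then 1 else 0

inductive Expr where
  | const (k : ℕ)
  | reg (x : ℕ)
  | get (a : ℕ) (i : Expr)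
  | op (o : BinOp) (e₁ e₂ : Expr)

/-- The value of an expression on a machine with `w`-bit words. -/
def Expr.eval (w : ℕ) (s : State) : Expr → ℕ
  | .const k => k % 2 ^ w
  | .reg x => s.reg x
  | .get a i => s.arr a (i.eval w s)
  | .op o e₁ e₂ => o.eval (e₁.eval w s) (e₂.eval w s) % 2 ^ w

/-- The number of steps taken to evaluate an expression. -/
def Expr.cost : Expr → ℕ
  | .const _ => 1
  | .reg _ => 1
  | .get _ i => i.cost + 1
  | .op _ e₁ e₂ => e₁.cost + e₂.cost + 1

/-- Programs. In `ite` and `loop` a nonzero word counts as true. -/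
inductive Cmd where
  | skip
  | assign (x : ℕ) (e : Expr)
  | store (a : ℕ) (i e : Expr)
  | seq (c₁ c₂ : Cmd)
  | ite (b : Expr) (c₁ c₂ : Cmd)
  | loop (b : Expr) (c : Cmd)

def State.setReg (s : State) (x val : ℕ) : State :=
  { s with reg := Function.update s.reg x val }

def State.setArr (s : State) (a i val : ℕ) : State :=
  { s with arr := Function.update s.arr a (Function.update (s.arr a) i val) }

/-- `Exec w c s t s'`: on a machine with `w`-bit words, the program `c` started in the state `s`
halts after exactly `t` steps in the state `s'`. -/
inductive Exec (w : ℕ) : Cmd → State → ℕ → State → Prop where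
  | skip (s : State) : Exec w .skip s 1 s
  | assign (s : State) (x : ℕ) (e : Expr) :
      Exec w (.assign x e) s (e.cost + 1) (s.setReg x (e.eval w s))
  | store (s : State) (a : ℕ) (i e : Expr) :
      Exec w (.store a i e) s (i.cost + e.cost + 1) (s.setArr a (i.eval w s) (e.eval w s))
  | seq {c₁ c₂ : Cmd} {s s₁ s₂ : State} {t₁ t₂ : ℕ} :
      Exec w c₁ s t₁ s₁ → Exec w c₂ s₁ t₂ s₂ → Exec w (.seq c₁ c₂) s (t₁ + t₂) s₂
  | iteTrue {b : Expr} {c₁ c₂ : Cmd} {s s₁ : State} {t : ℕ} :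
      b.eval w s ≠ 0 → Exec w c₁ s t s₁ → Exec w (.ite b c₁ c₂) s (b.cost + 1 + t) s₁
  | iteFalse {b : Expr} {c₁ c₂ : Cmd} {s s₁ : State} {t : ℕ} :
      b.eval w s = 0 → Exec w c₂ s t s₁ → Exec w (.ite b c₁ c₂) s (b.cost + 1 + t) s₁
  | loopTrue {b : Expr} {c : Cmd} {s s₁ s₂ : State} {t₁ t₂ : ℕ} :
      b.eval w s ≠ 0 → Exec w c s t₁ s₁ → Exec w (.loop b c) s₁ t₂ s₂ →
        Exec w (.loop b c) s (b.cost + 1 + t₁ + t₂) s₂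
  | loopFalse {b : Expr} {c : Cmd} {s : State} :
      b.eval w s = 0 → Exec w (.loop b c) s (b.cost + 1) s

/-- The machine is deterministic, so that a run from a given state is unique. -/
theorem Exec.deterministic {w : ℕ} {c : Cmd} {s s₁ : State} {t₁ : ℕ} (h₁ : Exec w c s t₁ s₁) :
    ∀ {t₂ : ℕ} {s₂ : State}, Exec w c s t₂ s₂ → t₁ = t₂ ∧ s₁ = s₂ := by
  induction h₁ with
  | skip | assign | store => intro _ _ h; cases h; exact ⟨rfl, rfl⟩
  | seq _ _ ih₁ ih₂ =>
    intro _ _ h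
    cases h with
    | seq a b => obtain ⟨rfl, rfl⟩ := ih₁ a; obtain ⟨rfl, rfl⟩ := ih₂ b; exact ⟨rfl, rfl⟩
  | iteTrue hb _ ih =>
    intro _ _ h
    cases h with
    | iteTrue _ a => obtain ⟨rfl, rfl⟩ := ih a; exact ⟨rfl, rfl⟩
    | iteFalse hb' _ => exact absurd hb' hb
  | iteFalse hb _ ih =>
    intro _ _ h
    cases h with
    | iteTrue hb' _ => exact absurd hb hb'
    | iteFalse _ a => obtain ⟨rfl, rfl⟩ := ih a; exact ⟨rfl, rfl⟩
  | loopTrue hb _ _ ih₁ ih₂ =>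
    intro _ _ h
    cases h with
    | loopTrue _ a b => obtain ⟨rfl, rfl⟩ := ih₁ a; obtain ⟨rfl, rfl⟩ := ih₂ b; exact ⟨rfl, rfl⟩
    | loopFalse hb' => exact absurd hb' hb
  | loopFalse hb =>
    intro _ _ h
    cases h with
    | loopTrue hb' _ _ => exact absurd hb hb'
    | loopFalse _ => exact ⟨rfl, rfl⟩

/-! ### Dynamic graph algorithms -/

/-- A dynamic (online) algorithm: a program run once on the initial graph and a program run at
every update, on the contents of the registers and arrays left by the previous run. -/
structure DynAlg where
  init : Cmd
  update : Cmd

/-- The initial contents for the graph on `Fin n` with edge list `L`: register `0` holds `n`,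
register `1` the number of edges, arrays `0` and `1` the ends of the edges; all else is `0`. -/
def initialState (n : ℕ) (L : List (Fin n × Fin n)) : State where
  reg := fun x => if x = 0 then n else if x = 1 then L.length else 0
  arr := fun a i =>
    if h : i < L.length then
      if a = 0 then ((L[i]).1 : ℕ) else if a = 1 then ((L[i]).2 : ℕ) else 0
    else 0

/-- An update is passed to the algorithm in registers `0` (`1` for insertion and `0` for
deletion), `1` and `2` (the ends of the edge). -/
def State.receive {n : ℕ} (s : State) (e : EdgeUpdate n) : State :=
  ((s.setReg 0 (if e.ins = true then 1 else 0)).setReg 1 (e.u : ℕ)).setReg 2 (e.v : ℕ)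

/-- The vertex set maintained by the algorithm, which is stored as an indicator in array `2`:
`v` belongs to it if and only if entry `v` is nonzero. -/
def State.output (n : ℕ) (s : State) : Finset (Fin n) :=
  Finset.univ.filter fun v => s.arr 2 (v : ℕ) ≠ 0

/-- The run of `A` on the initial edge list `L` and the updates `e 0, …, e (M - 1)`: `σ t` is the
state after `t` updates, `τ 0` the time for the initial graph, and `τ (t + 1)` the time for the
update `e t`. -/
def DynAlg.IsRun (A : DynAlg) (w : ℕ) {n : ℕ} (L : List (Fin n × Fin n)) (M : ℕ)
    (e : ℕ → EdgeUpdate n) (σ : ℕ → State) (τ : ℕ → ℕ) : Prop :=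
  Exec w A.init (initialState n L) (τ 0) (σ 0) ∧
    ∀ i < M, Exec w A.update ((σ i).receive (e i)) (τ (i + 1)) (σ (i + 1))

end DynDS

namespace DynDS

/-! ### Weakest-precondition rules for the word RAM -/

/-! Dominating set is treated as covering the vertices by closed neighbourhoods. Every vertex has a
centre in its closed neighbourhood, the vertices sharing a centre form its cluster, and the output
consists of the centres with nonempty clusters. Centres carry levels below `L = Nat.log 2 n + 1`,
and a vertex inherits the level of its centre. Two conditions are kept between updates: (a) a centre
of level `l > 0` has at least `2 ^ l` vertices in its cluster; (b) every closed neighbourhood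
contains fewer than `8 * 2 ^ k` vertices of level at most `k`.

Ratio (`card_centres_le`): the output centres of level `l` own disjoint clusters of at least `2 ^ l`
vertices, all of level `l`. An optimal dominating set covers these vertices by OPT closed
neighbourhoods, each containing fewer than `8 * 2 ^ l` of them. Hence there are at most `8 * OPT`
output centres per level, and `8 * L * OPT` altogether.

Repair: a centre that loses a vertex and thereby violates (a) is lowered by one level (`move_run`).
If (b) fails at a neighbourhood `u` and a level `j`, then `u` is raised to level at least `j + 2`
and takes over all its neighbours of level at most `j` (`settle_run`). Counters for (b) are stored
explicitly, and those that reach their bound wait on a stack (`drain_run`).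

Time: with closed degrees at most `d = Δ + 1`, changing the level of one vertex by one touches at
most `d` counters; 120 * `d` steps are one unit. The potential is 10 times the total distance of the
vertices from level `L`, plus 11 times the total slack `2 * 2 ^ lev u - sz u` of the centres
(truncated at 0). Raising vertices releases the first part. A lowered centre has fewer than `2 ^ lev
u` members, so the slack it loses outweighs what its members gain (`potential_drop`). Thus repairs
pay for themselves. An insertion leaves the potential alone before repairs and costs `O(L)`; a
deletion charges `O(L)` units. The initial potential is `O(n * L)` units, absorbed by `M ≥ c * n`.
The program uses neither `d` nor `M`; they occur only in the analysis.

The specifications of the repair procedures bound steps plus 40 per stack entry plus 120 * `d` times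
the potential. The hypotheses `hsp` keep a corresponding budget within the word range, so that the
stack height never overflows. -/

@[simp] theorem State.setReg_reg (s : State) (x v y : ℕ) :
    (s.setReg x v).reg y = if y = x then v else s.reg y := by
  simp [State.setReg, Function.update_apply]

@[simp] theorem State.setReg_arr (s : State) (x v : ℕ) : (s.setReg x v).arr = s.arr := rfl

@[simp] theorem State.setArr_reg (s : State) (a i v : ℕ) : (s.setArr a i v).reg = s.reg := rfl

@[simp] theorem State.setArr_arr (s : State) (a i v b : ℕ) :
    (s.setArr a i v).arr b = if b = a then Function.update (s.arr a) i v else s.arr b := by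
  simp only [State.setArr, Function.update_apply]

/-- The value of an expression over the natural numbers, without reduction to words. -/
@[simp] def Expr.val (s : State) : Expr → ℕ
  | .const k => k
  | .reg x => s.reg x
  | .get a i => s.arr a (i.val s)
  | .op o e₁ e₂ => o.eval (e₁.val s) (e₂.val s)

/-- The operation does not leave the range below `W` (when `1 < W`). -/
@[simp] def BinOp.Ok (W : ℕ) : BinOp → ℕ → ℕ → Prop
  | .add, a, b => a + b < W
  | .sub, a, _ => a < W
  | .mul, a, b => a * b < W
  | .div, a, _ => a < W
  | .mod, a, _ => a < W
  | .lt, _, _ => True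
  | .eq, _, _ => True

/-- No operation in the expression overflows. -/
@[simp] def Expr.Ok (W : ℕ) (s : State) : Expr → Prop
  | .const k => k < W
  | .reg _ => True
  | .get _ i => i.Ok W s
  | .op o e₁ e₂ => e₁.Ok W s ∧ e₂.Ok W s ∧ o.Ok W (e₁.val s) (e₂.val s)

attribute [simp] Expr.cost BinOp.eval

/-- Truncated differences, quotients and remainders are bounded by their first operand, which is why
`BinOp.Ok` constrains only that one. The comparisons need `1 < 2 ^ w` for the value 1. -/
theorem Expr.eval_eq_val {w : ℕ} (hw : 1 < 2 ^ w) {s : State} {e : Expr} (h : e.Ok (2 ^ w) s) :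
    e.eval w s = e.val s := by
  induction e with
  | const k => exact Nat.mod_eq_of_lt h
  | reg x => rfl
  | get a i ih => simp only [Expr.eval, Expr.val, ih h]
  | op o e₁ e₂ ih₁ ih₂ =>
    obtain ⟨h₁, h₂, h₃⟩ := h
    simp only [Expr.eval, Expr.val, ih₁ h₁, ih₂ h₂]
    apply Nat.mod_eq_of_lt
    cases o <;> simp only [BinOp.Ok, BinOp.eval] at h₃ ⊢
    · exact h₃
    · omega
    · exact h₃
    · exact (Nat.div_le_self _ _).trans_lt h₃
    · exact (Nat.mod_le _ _).trans_lt h₃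
    · split <;> omega
    · split <;> omega

/-- From `s`, the program `c` halts with a number of steps and a final state satisfying `Q`. -/
def Run (w : ℕ) (c : Cmd) (s : State) (Q : ℕ → State → Prop) : Prop :=
  1 < 2 ^ w → ∃ t s', Exec w c s t s' ∧ Q t s'

variable {w : ℕ} {s : State} {Q Q' : ℕ → State → Prop}

theorem Run.mono {c : Cmd} (h : Run w c s Q) (hQ : ∀ t s', Q t s' → Q' t s') : Run w c s Q' := by
  intro hw
  obtain ⟨t, s', he, hq⟩ := h hw
  exact ⟨t, s', he, hQ _ _ hq⟩

theorem Run.skip (h : Q 1 s) : Run w .skip s Q := fun _ => ⟨_, _, .skip s, h⟩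

theorem Run.assign {x : ℕ} {e : Expr} (ho : e.Ok (2 ^ w) s)
    (h : Q (e.cost + 1) (s.setReg x (e.val s))) : Run w (.assign x e) s Q := by
  intro hw
  refine ⟨_, _, .assign s x e, ?_⟩
  rwa [Expr.eval_eq_val hw ho]

theorem Run.store {a : ℕ} {i e : Expr} (hi : i.Ok (2 ^ w) s) (he : e.Ok (2 ^ w) s)
    (h : Q (i.cost + e.cost + 1) (s.setArr a (i.val s) (e.val s))) :
    Run w (.store a i e) s Q := by
  intro hw
  refine ⟨_, _, .store s a i e, ?_⟩
  rwa [Expr.eval_eq_val hw hi, Expr.eval_eq_val hw he]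

theorem Run.seq {c₁ c₂ : Cmd}
    (h : Run w c₁ s fun t₁ s₁ => Run w c₂ s₁ fun t₂ s₂ => Q (t₁ + t₂) s₂) :
    Run w (.seq c₁ c₂) s Q := by
  intro hw
  obtain ⟨t₁, s₁, e₁, h₁⟩ := h hw
  obtain ⟨t₂, s₂, e₂, h₂⟩ := h₁ hw
  exact ⟨_, _, .seq e₁ e₂, h₂⟩

theorem Run.ite {b : Expr} {c₁ c₂ : Cmd} (ho : b.Ok (2 ^ w) s)
    (h₁ : b.val s ≠ 0 → Run w c₁ s fun t s' => Q (b.cost + 1 + t) s')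
    (h₂ : b.val s = 0 → Run w c₂ s fun t s' => Q (b.cost + 1 + t) s') :
    Run w (.ite b c₁ c₂) s Q := by
  intro hw
  have hv := Expr.eval_eq_val hw ho
  by_cases hb : b.val s = 0
  · obtain ⟨t, s', e, h⟩ := h₂ hb hw
    exact ⟨_, _, .iteFalse (hv.trans hb) e, h⟩
  · obtain ⟨t, s', e, h⟩ := h₁ hb hw
    exact ⟨_, _, .iteTrue (by rwa [hv]) e, h⟩

/-- This unrolls a single round; termination comes from an induction at each use. -/
theorem Run.loopTrue {b : Expr} {c : Cmd} (ho : b.Ok (2 ^ w) s) (hb : b.val s ≠ 0)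
    (h : Run w c s fun t₁ s₁ => Run w (.loop b c) s₁ fun t₂ s₂ => Q (b.cost + 1 + t₁ + t₂) s₂) :
    Run w (.loop b c) s Q := by
  intro hw
  obtain ⟨t₁, s₁, e₁, h₁⟩ := h hw
  obtain ⟨t₂, s₂, e₂, h₂⟩ := h₁ hw
  exact ⟨_, _, .loopTrue (by rwa [Expr.eval_eq_val hw ho]) e₁ e₂, h₂⟩

theorem Run.loopFalse {b : Expr} {c : Cmd} (ho : b.Ok (2 ^ w) s) (hb : b.val s = 0)
    (h : Q (b.cost + 1) s) : Run w (.loop b c) s Q :=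
  fun hw => ⟨_, _, .loopFalse ((Expr.eval_eq_val hw ho).trans hb), h⟩

/-- `while r < b do (body; r := r + 1)`. -/
def forTo (r : ℕ) (b : Expr) (body : Cmd) : Cmd :=
  .loop (.op .lt (.reg r) b) (.seq body (.assign r (.op .add (.reg r) (.const 1))))

/-- In `I k T s`, `k` is the value of the counter and `T` the number of steps so far. -/
theorem Run.forTo {r : ℕ} {b : Expr} {body : Cmd} (k₀ m : ℕ) (I : ℕ → ℕ → State → Prop)
    (hk : k₀ ≤ m) (hr : s.reg r = k₀) (h0 : I k₀ 0 s) (hm : m < 2 ^ w)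
    (hb : ∀ k T s, k₀ ≤ k → k ≤ m → s.reg r = k → I k T s → b.Ok (2 ^ w) s ∧ b.val s = m)
    (step : ∀ k T s, k₀ ≤ k → k < m → s.reg r = k → I k T s →
      Run w body s fun t s' => s'.reg r = k ∧ I (k + 1) (T + t + b.cost + 7) (s'.setReg r (k + 1)))
    (fin : ∀ T s', I m T s' → s'.reg r = m → Q (T + b.cost + 3) s') :
    Run w (forTo r b body) s Q := by
  -- The step count is tracked exactly. A round pays `b.cost + 3` for the guard and 4 for the
  -- increment; the last, failing test accounts for the final `b.cost + 3`.
  suffices H : ∀ j k T s, j + k = m → k₀ ≤ k → s.reg r = k → I k T s →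
      Run w (DynDS.forTo r b body) s fun t s' => ∃ T', I m T' s' ∧ s'.reg r = m ∧
        T + t = T' + b.cost + 3 by
    refine (H (m - k₀) k₀ 0 s (by omega) le_rfl hr h0).mono ?_
    rintro t s' ⟨T', h1, h2, h3⟩
    have := fin T' s' h1 h2
    rwa [← h3, zero_add] at this
  intro j
  induction j with
  | zero =>
    intro k T s hj hk hr hI
    obtain ⟨h1, h2⟩ := hb k T s hk (by omega) hr hI
    refine Run.loopFalse (by simp [h1]) (by simp [h2, hr]; omega) ⟨T, ?_, by omega, by simp; omega⟩
    rwa [show m = k by omega]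
  | succ j ih =>
    intro k T s hj hk hr hI hw
    obtain ⟨h1, h2⟩ := hb k T s hk (by omega) hr hI
    refine Run.loopTrue (by simp [h1]) (by simp [h2, hr]; omega) ?_ hw
    apply Run.seq
    refine (step k T s hk (by omega) hr hI).mono ?_
    rintro t s1 ⟨hr1, hI1⟩
    refine Run.assign ⟨trivial, hw, show s1.reg r + 1 < 2 ^ w by omega⟩ ?_
    refine (ih (k + 1) _ _ (by omega) (by omega) (by simp [hr1]) (by simpa [hr1] using hI1)).mono ?_
    rintro t2 s2 ⟨T', a1, a2, a3⟩
    refine ⟨T', a1, a2, ?_⟩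
    simp
    omega

/-- For all `y` in the adjacency row of the vertex in register `rv`: put `y` into register `ry` and
run `body`. -/
def forNbr (rv ri ry : ℕ) (body : Cmd) : Cmd :=
  .seq (.assign ri (.const 0))
    (forTo ri (.get 4 (.reg rv))
      (.seq (.assign ry (.get 3 (.op .add (.op .mul (.reg rv) (.reg 3)) (.reg ri)))) body))

theorem idx_lt {n v i : ℕ} (hv : v < n) (hi : i < n) : v * n + i < n * n := by nlinarith

/-- In `I P T s`, `P` is the set of neighbours treated so far, `T` the number of steps so far. -/
theorem Run.forNbr {n v rv ri ry : ℕ} {body : Cmd} {N : Finset ℕ} (I : Finset ℕ → ℕ → State → Prop)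
    (h2 : ri < ry) (hv : v < n) (hW : n * n < 2 ^ w)
    (hN : N ⊆ Finset.range n) (hdeg : s.arr 4 v = N.card)
    (hadj : (Finset.range N.card).image (fun i => s.arr 3 (v * n + i)) = N)
    (hI : ∀ P T s', I P T s' → s'.reg rv = v ∧ s'.reg 3 = n ∧ s'.arr 3 = s.arr 3 ∧
      s'.arr 4 = s.arr 4)
    (hst : ∀ P T s' r x, r = ri ∨ r = ry → I P T s' → I P T (s'.setReg r x))
    (h0 : I ∅ 2 s)
    (step : ∀ P T s₁ y, P ⊆ N → y ∈ N → y ∉ P → I P T s₁ → s₁.reg ry = y →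
      Run w body s₁ fun t s₂ => s₂.reg ri = s₁.reg ri ∧ I (insert y P) (T + t + 16) s₂)
    (fin : ∀ T s', I N T s' → Q (T + 5) s') :
    Run w (forNbr rv ri ry body) s Q := by
  have hc : N.card ≤ n := by simpa using Finset.card_le_card hN
  have hnW : n < 2 ^ w := by nlinarith
  -- The first `N.card` entries of the row have an image of that same size, so no neighbour is
  -- listed twice. This gives `y ∉ P` below.
  have hinj : Set.InjOn (fun i => s.arr 3 (v * n + i)) (Finset.range N.card) := by
    apply Finset.card_image_iff.mp
    rw [hadj, Finset.card_range]
  apply Run.seq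
  refine Run.assign (by simp) ?_
  refine Run.forTo 0 N.card
    (fun k T s' => I ((Finset.range k).image (fun i => s.arr 3 (v * n + i))) (T + 2) s')
    (Nat.zero_le _) (by simp) (by simpa using hst _ _ _ ri _ (Or.inl rfl) h0) (by omega) ?_ ?_ ?_
  · intro k T s' _ _ hr hI'
    obtain ⟨a, b, c, d⟩ := hI _ _ _ hI'
    simp [a, d, hdeg]
  · intro k T s' _ hk hr hI'
    obtain ⟨a, b, c, d⟩ := hI _ _ _ hI'
    have hlt := idx_lt hv (show k < n by omega)
    apply Run.seq
    refine Run.assign (by simp [a, b, hr]; constructor <;> omega) ?_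
    set y := s.arr 3 (v * n + k) with hy
    have hyN : y ∈ N := by
      rw [← hadj]; exact Finset.mem_image.mpr ⟨k, by simpa using hk, rfl⟩
    have := step ((Finset.range k).image (fun i => s.arr 3 (v * n + i))) (T + 2)
      (s'.setReg ry y) y ?_ hyN ?_ (hst _ _ _ ry _ (Or.inr rfl) hI') (by simp)
    · simp only [Expr.val, BinOp.eval, a, b, c, hr, ← hy]
      refine this.mono ?_
      rintro t s2 ⟨e1, e2⟩
      rw [Finset.range_add_one, Finset.image_insert]
      refine ⟨?_, ?_⟩
      · rw [e1]; simp [hr, h2.ne]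
      · have := hst _ _ _ ri (k + 1) (Or.inl rfl) e2
        convert this using 1
        simp; omega
    · conv_rhs => rw [← hadj]
      exact Finset.image_subset_image (by simpa using hk.le)
    · intro hm
      obtain ⟨i, hi, he⟩ := Finset.mem_image.mp hm
      have hi' : i < k := by simpa using hi
      have := hinj (by simp; omega) (by simpa using hk) (show _ = _ from he)
      omega
  · intro T s' hI' _
    simp only [hadj] at hI'
    have := fin _ _ hI'
    convert this using 1
    simp; omega

/-- The registers below `R` and the arrays outside `l` are unchanged. -/
def Keeps (R : ℕ) (l : List ℕ) (s s' : State) : Prop :=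
  (∀ r < R, s'.reg r = s.reg r) ∧ ∀ a ∉ l, s'.arr a = s.arr a

theorem Keeps.refl {R : ℕ} {l : List ℕ} : Keeps R l s s := ⟨fun _ _ => rfl, fun _ _ => rfl⟩

/-- Registers are allotted by call depth: `settle` works from 10 on, `move` from 15, `relevel` from
20, `adjust` from 30, the single level steps from 40, `bump` from 50. A callee thus preserves a
longer initial segment than its caller promises, and the side conditions are numerical. -/
theorem Keeps.trans {R R' : ℕ} {l l' : List ℕ} {s₁ s₂ s₃ : State} (h : Keeps R l s₁ s₂)
    (h' : Keeps R' l' s₂ s₃) (hR : R ≤ R' := by decide) (hl : l' ⊆ l := by decide) :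
    Keeps R l s₁ s₃ :=
  ⟨fun r hr => (h'.1 r (by omega)).trans (h.1 r hr),
    fun a ha => (h'.2 a fun q => ha (hl q)).trans (h.2 a ha)⟩

theorem Keeps.setReg {R : ℕ} {l : List ℕ} {s₁ s₂ : State} (h : Keeps R l s₁ s₂) {x v : ℕ}
    (hx : R ≤ x := by decide) : Keeps R l s₁ (s₂.setReg x v) :=
  ⟨fun r hr => by simp [show r ≠ x by omega, h.1 r hr], h.2⟩

theorem Keeps.setReg_left {R : ℕ} {l : List ℕ} {s₁ s₂ : State} {x v : ℕ}
    (h : Keeps R l (s₁.setReg x v) s₂) (hx : R ≤ x := by decide) : Keeps R l s₁ s₂ :=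
  ⟨fun r hr => by rw [h.1 r hr]; simp [show r ≠ x by omega], h.2⟩

theorem Keeps.mono {R R' : ℕ} {l l' : List ℕ} {s₁ s₂ : State} (h : Keeps R' l' s₁ s₂)
    (hR : R ≤ R' := by decide) (hl : l' ⊆ l := by decide) : Keeps R l s₁ s₂ :=
  Keeps.refl.trans h hR hl

theorem Keeps.setArr {R : ℕ} {l : List ℕ} {s₁ s₂ : State} (h : Keeps R l s₁ s₂) {a i v : ℕ}
    (ha : a ∈ l := by decide) : Keeps R l s₁ (s₂.setArr a i v) :=
  ⟨h.1, fun b hb => by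
    rw [State.setArr_arr, if_neg (by rintro rfl; exact hb ha), h.2 b hb]⟩


/-! ### The program

Register `3` holds `n`, register `4` the number `L` of levels. Array `2`: cluster sizes, `3`: closed
neighbourhoods (row `v` starts at `v * n`), `4`: their sizes, `5`: centre of the cluster of a vertex,
`6`: level of a centre, `7`: at `z * n + k` the number of vertices of level at most `k` in the
closed neighbourhood of `z`, `8`: a stack of indices into array `7`, `9`: powers of two, `10`: at `0`
the height of the stack. -/

local notation "%" x => Expr.reg x
local notation "#" x => Expr.const x

/-- Increment entry `r50` of array `7`, of level `r51`, and push it if it reached its bound. -/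
def bump : Cmd :=
  .seq (.store 7 (%50) (.op .add (.get 7 (%50)) (#1)))
    (.ite (.op .lt (.get 7 (%50)) (.op .mul (#8) (.get 9 (%51)))) .skip
      (.seq (.store 8 (.get 10 (#0)) (%50)) (.store 10 (#0) (.op .add (.get 10 (#0)) (#1)))))

/-- Lower the level of the vertex `r40` from `r41 + 1` to `r41`. -/
def lowerOne : Cmd :=
  forNbr 40 42 43 (.seq (.assign 50 (.op .add (.op .mul (%43) (%3)) (%41)))
    (.seq (.assign 51 (%41)) bump))

/-- Raise the level of the vertex `r40` from `r41` to `r41 + 1`. -/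
def raiseOne : Cmd :=
  forNbr 40 42 43 (.store 7 (.op .add (.op .mul (%43) (%3)) (%41))
    (.op .sub (.get 7 (.op .add (.op .mul (%43) (%3)) (%41))) (#1)))

/-- Change the level of the vertex `r30` from `r31` to `r32`. -/
def adjust : Cmd :=
  .seq (forTo 31 (%32) (.seq (.assign 40 (%30)) (.seq (.assign 41 (%31)) raiseOne)))
    (.loop (.op .lt (%32) (%31)) (.seq (.assign 31 (.op .sub (%31) (#1)))
      (.seq (.assign 40 (%30)) (.seq (.assign 41 (%31)) lowerOne))))

/-! ### Counters -/

/-- Relations between the number of vertices, of levels, and of words. -/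
structure Params (n L w : ℕ) : Prop where
  pos : 0 < L
  le : L ≤ n
  lt_pow : n < 2 ^ L
  pow_le : 2 ^ (L - 1) ≤ n
  word : 100 * (n * n) + 100 ≤ 2 ^ w

theorem Params.pow_le' {n L k : ℕ} (hp : Params n L w) (hk : k < L) : 2 ^ k ≤ n :=
  (Nat.pow_le_pow_right (by norm_num) (by omega)).trans hp.pow_le

theorem Params.lt_word {n L : ℕ} (hp : Params n L w) : 100 * n + 100 ≤ 2 ^ w := by
  have := hp.word
  nlinarith [Nat.le_mul_self n]

theorem Params.ne_zero {n L : ℕ} (hp : Params n L w) : w ≠ 0 := by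
  rintro rfl
  have := hp.lt_word
  omega

/-- The closed neighbourhoods of a graph on `{0, …, n - 1}` with closed degrees at most `d`. -/
structure Nbhds (n d : ℕ) (N : ℕ → Finset ℕ) : Prop where
  sub : ∀ v, N v ⊆ Finset.range n
  self : ∀ v < n, v ∈ N v
  symm : ∀ u v, u ∈ N v → v ∈ N u
  card : ∀ v, (N v).card ≤ d

/-- The tables which do not depend on the clusters; entries of array `7` that are too large have been
pushed, except for those in `X`. -/
structure Base (n L : ℕ) (N : ℕ → Finset ℕ) (X : Finset ℕ) (s : State) : Prop where
  n_eq : s.reg 3 = n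
  L_eq : s.reg 4 = L
  pow : ∀ k < L, s.arr 9 k = 2 ^ k
  deg : ∀ v < n, s.arr 4 v = (N v).card
  adj : ∀ v < n, (Finset.range (N v).card).image (fun i => s.arr 3 (v * n + i)) = N v
  queue : ∀ z < n, ∀ k < L, 8 * 2 ^ k ≤ s.arr 7 (z * n + k) → z * n + k ∉ X →
    ∃ p < s.arr 10 0, s.arr 8 p = z * n + k
  stack : ∀ p < s.arr 10 0, ∃ z < n, ∃ k < L, s.arr 8 p = z * n + k

/-! ### Stability of the tables under unrelated writes -/

theorem Base.congr {n L : ℕ} {N : ℕ → Finset ℕ} {X : Finset ℕ} {s s' : State}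
    (h : Base n L N X s) (h3 : s'.reg 3 = s.reg 3) (h4 : s'.reg 4 = s.reg 4)
    (ha : ∀ a ∈ [3, 4, 7, 8, 9, 10], s'.arr a = s.arr a) : Base n L N X s' := by
  have e3 := ha 3 (by decide)
  have e4 := ha 4 (by decide)
  have e7 := ha 7 (by decide)
  have e8 := ha 8 (by decide)
  have e9 := ha 9 (by decide)
  have e10 := ha 10 (by decide)
  constructor
  · rw [h3]; exact h.n_eq
  · rw [h4]; exact h.L_eq
  · rw [e9]; exact h.pow
  · rw [e4]; exact h.deg
  · rw [e3]; exact h.adj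
  · rw [e7, e8, e10]; exact h.queue
  · rw [e8, e10]; exact h.stack

theorem Base.setReg {n L : ℕ} {N : ℕ → Finset ℕ} {X : Finset ℕ} {x v : ℕ}
    (h : Base n L N X s) (hx : 5 ≤ x := by decide) : Base n L N X (s.setReg x v) :=
  h.congr (by simp; omega) (by simp; omega) (by simp)

theorem Base.setArr {n L : ℕ} {N : ℕ → Finset ℕ} {X : Finset ℕ} {a i v : ℕ}
    (h : Base n L N X s) (hx : a ∉ [3, 4, 7, 8, 9, 10] := by decide) :
    Base n L N X (s.setArr a i v) :=
  h.congr (by simp) (by simp) (by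
    intro b hb
    rw [State.setArr_arr, if_neg]
    rintro rfl
    exact hx hb)

/-- Array `7` counts, for each `z` and `k`, the `v ∈ N z` with `lv v ≤ k`. -/
structure Core (n L : ℕ) (N : ℕ → Finset ℕ) (lv : ℕ → ℕ) (X : Finset ℕ) (s : State) : Prop
    extends Base n L N X s where
  cnt : ∀ z < n, ∀ k < L, s.arr 7 (z * n + k) = ((N z).filter fun v => lv v ≤ k).card

theorem Core.congr_lv {n L : ℕ} {N : ℕ → Finset ℕ} {X : Finset ℕ} {lv lv' : ℕ → ℕ}
    (h : Core n L N lv X s) (hN : ∀ v, N v ⊆ Finset.range n) (hlv : ∀ v < n, lv' v = lv v) :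
    Core n L N lv' X s := by
  refine ⟨h.toBase, fun z hz k hk => ?_⟩
  rw [h.cnt z hz k hk]
  congr 1
  apply Finset.filter_congr
  intro v hv
  rw [hlv v (by simpa using hN z hv)]

theorem Core.congr {n L : ℕ} {N : ℕ → Finset ℕ} {X : Finset ℕ} {lv : ℕ → ℕ} {s s' : State}
    (h : Core n L N lv X s) (h3 : s'.reg 3 = s.reg 3) (h4 : s'.reg 4 = s.reg 4)
    (ha : ∀ a ∈ [3, 4, 7, 8, 9, 10], s'.arr a = s.arr a) : Core n L N lv X s' :=
  ⟨h.toBase.congr h3 h4 ha, by rw [ha 7 (by decide)]; exact h.cnt⟩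

theorem Core.setReg {n L : ℕ} {N : ℕ → Finset ℕ} {X : Finset ℕ} {lv : ℕ → ℕ} {x v : ℕ}
    (h : Core n L N lv X s) (hx : 5 ≤ x := by decide) : Core n L N lv X (s.setReg x v) :=
  ⟨h.toBase.setReg hx, h.cnt⟩

theorem Core.setArr {n L : ℕ} {N : ℕ → Finset ℕ} {X : Finset ℕ} {lv : ℕ → ℕ} {a i v : ℕ}
    (h : Core n L N lv X s) (hx : a ∉ [3, 4, 7, 8, 9, 10] := by decide) :
    Core n L N lv X (s.setArr a i v) :=
  ⟨h.toBase.setArr hx, by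
    rw [State.setArr_arr, if_neg (by rintro rfl; simp at hx)]
    exact h.cnt⟩

/-! ### Changing the level of one vertex -/

/-- Rows of array `7` have stride `n`, and level indices are below `L ≤ n`, so distinct counters
occupy distinct cells. -/
theorem idx_inj {n z z' k k' : ℕ} (hk : k < n) (hk' : k' < n) (h : z * n + k = z' * n + k') :
    z = z' ∧ k = k' := by
  have h1 : (z * n + k) / n = z := by
    rw [mul_comm, Nat.mul_add_div (by omega), Nat.div_eq_of_lt hk, add_zero]
  have h2 : (z' * n + k') / n = z' := by
    rw [mul_comm, Nat.mul_add_div (by omega), Nat.div_eq_of_lt hk', add_zero]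
  have : z = z' := by rw [← h1, h, h2]
  subst this
  omega

/-- The branch that pushes takes 24 steps and deposits 40 for the later pop, whence 64. The same
counter may be pushed repeatedly: the invariant asks only that some copy is on the stack. -/
theorem bump_run {n L z k : ℕ} {N : ℕ → Finset ℕ} {X : Finset ℕ} (hp : Params n L w)
    (hB : Base n L N X s) (hz : z < n) (hk : k < L) (h50 : s.reg 50 = z * n + k)
    (h51 : s.reg 51 = k) (hsp : s.arr 10 0 + 1 < 2 ^ w) (hc : s.arr 7 (z * n + k) ≤ n) :
    Run w bump s fun t s' => Base n L N X s' ∧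
      s'.arr 7 = Function.update (s.arr 7) (z * n + k) (s.arr 7 (z * n + k) + 1) ∧
      Keeps 50 [7, 8, 10] s s' ∧ t + 40 * s'.arr 10 0 ≤ 40 * s.arr 10 0 + 64 := by
  have hW := hp.lt_word
  have hpk := hp.pow_le' hk
  have hpow := hB.pow k hk
  have hLn := hp.le
  apply Run.seq
  refine Run.store trivial ⟨trivial, show 1 < 2 ^ w by omega, ?_⟩ ?_
  · show s.arr 7 (s.reg 50) + 1 < 2 ^ w
    rw [h50]; omega
  refine Run.ite (by simp [h51, hpow]; omega) ?_ ?_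
  · intro hb
    simp [h50, h51, hpow] at hb
    refine Run.skip ⟨?_, by simp [h50], Keeps.refl.setArr, by simp; omega⟩
    refine ⟨hB.n_eq, hB.L_eq, ?_, ?_, ?_, ?_, ?_⟩
    · simpa using hB.pow
    · simpa using hB.deg
    · simpa using hB.adj
    · intro z' hz' k' hk' h hX
      simp [h50] at h ⊢
      by_cases e : z' * n + k' = z * n + k
      · obtain ⟨rfl, rfl⟩ := idx_inj (by omega) (by omega) e
        simp at h
        omega
      · rw [Function.update_of_ne e] at h
        exact hB.queue z' hz' k' hk' h hX
    · simpa using hB.stack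
  · intro hb
    apply Run.seq
    refine Run.store (by simp) (by simp) ?_
    refine Run.store (by simp) (by simp [hp.ne_zero]; omega) ?_
    refine ⟨?_, by simp [h50], Keeps.refl.setArr.setArr.setArr, by simp; omega⟩
    refine ⟨hB.n_eq, hB.L_eq, ?_, ?_, ?_, ?_, ?_⟩
    · simpa using hB.pow
    · simpa using hB.deg
    · simpa using hB.adj
    · intro z' hz' k' hk' h hX
      simp [h50] at h ⊢
      by_cases e : z' * n + k' = z * n + k
      · exact ⟨s.arr 10 0, by omega, by simp [e]⟩
      · rw [Function.update_of_ne e] at h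
        obtain ⟨p, h1, h2⟩ := hB.queue z' hz' k' hk' h hX
        exact ⟨p, by omega, by rw [Function.update_of_ne h1.ne, h2]⟩
    · intro p hp'
      simp [h50] at hp' ⊢
      rcases Nat.lt_or_eq_of_le hp' with h | h
      · rw [Function.update_of_ne h.ne]
        exact hB.stack p h
      · exact ⟨z, hz, k, hk, by simp [h]⟩

/-- A vertex falling from level `k + 1` to `k` newly satisfies `lv v ≤ k'` for `k' = k` alone. By
symmetry of `N`, exactly the counters `(z, k)` with `z ∈ N v` gain one. -/
theorem lowerOne_run {n L d v k : ℕ} {N : ℕ → Finset ℕ} {lv : ℕ → ℕ} {X : Finset ℕ}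
    (hp : Params n L w) (hN : Nbhds n d N) (hC : Core n L N lv X s) (hv : v < n) (hk : k < L)
    (hlv : lv v = k + 1) (h40 : s.reg 40 = v) (h41 : s.reg 41 = k)
    (hsp : 40 * s.arr 10 0 + 100 * d ≤ 2 ^ w) :
    Run w lowerOne s fun t s' => Core n L N (Function.update lv v k) X s' ∧
      Keeps 40 [7, 8, 10] s s' ∧ t + 40 * s'.arr 10 0 ≤ 40 * s.arr 10 0 + 100 * d := by
  have hW := hp.lt_word
  have hWn := hp.word
  have hLn := hp.le
  have hd1 : 1 ≤ (N v).card := Finset.card_pos.mpr ⟨v, hN.self v hv⟩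
  have hd2 := hN.card v
  have hcn : ∀ z, (N z).card ≤ n := fun z => by simpa using Finset.card_le_card (hN.sub z)
  refine Run.forNbr (n := n) (v := v) (N := N v)
    (fun P T s' => Base n L N X s' ∧ Keeps 40 [7, 8, 10] s s' ∧ s'.reg 40 = v ∧ s'.reg 41 = k ∧
      (∀ z < n, ∀ k' < L, s'.arr 7 (z * n + k') =
        s.arr 7 (z * n + k') + if z ∈ P ∧ k' = k then 1 else 0) ∧
      T + 40 * s'.arr 10 0 ≤ 40 * s.arr 10 0 + 2 + 88 * P.card)
    (by norm_num) hv (by omega) (hN.sub v) (hC.deg v hv) (hC.adj v hv) ?_ ?_ ?_ ?_ ?_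
  · rintro P T s' ⟨h1, h2, h3, -⟩
    exact ⟨h3, h1.n_eq, h2.2 3 (by decide), h2.2 4 (by decide)⟩
  · rintro P T s' r x hr ⟨h1, h2, h3, h4, h5, h6⟩
    have hr' : 42 ≤ r := by omega
    exact ⟨h1.setReg (by omega), h2.setReg (by omega), by simp [h3]; omega, by simp [h4]; omega,
      h5, h6⟩
  · exact ⟨hC.toBase, Keeps.refl, h40, h41, by simp, by simp; omega⟩
  · rintro P T s' y hP hy hyP ⟨h1, h2, h3, h4, h5, h6⟩ hr
    have hyn : y < n := by simpa using hN.sub v hy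
    have hPc := Finset.card_lt_card (Finset.ssubset_iff_subset_ne.mpr
      ⟨hP, fun e => hyP (e ▸ hy)⟩)
    have hix := idx_lt hyn (show k < n by omega)
    have hcnt : s'.arr 7 (y * n + k) ≤ n := by
      rw [h5 y hyn k hk, hC.cnt y hyn k hk]
      simpa [hyP] using (Finset.card_filter_le _ _).trans (hcn y)
    apply Run.seq
    refine Run.assign (by simp [hr, h1.n_eq, h4]; constructor <;> omega) ?_
    apply Run.seq
    refine Run.assign (by simp) ?_
    refine (bump_run hp (h1.setReg.setReg) hyn hk (by simp [hr, h1.n_eq, h4]) (by simp [h4])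
      (by simp; omega) (by simpa using hcnt)).mono ?_
    rintro t s2 ⟨b1, b2, b3, b4⟩
    simp only [State.setReg_arr] at b2 b4
    refine ⟨by rw [b3.1 42 (by norm_num)]; simp, b1,
      h2.trans (b3.setReg_left.setReg_left), ?_, ?_, ?_, ?_⟩
    · rw [b3.1 40 (by norm_num)]; simp [h3]
    · rw [b3.1 41 (by norm_num)]; simp [h4]
    · intro z hz k' hk'
      rw [b2]
      by_cases e : z * n + k' = y * n + k
      · obtain ⟨rfl, rfl⟩ := idx_inj (by omega) (by omega) e
        simp [h5 z hz k' hk', hyP]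
      · rw [Function.update_of_ne e, h5 z hz k' hk']
        have : ¬ (z = y ∧ k' = k) := by rintro ⟨rfl, rfl⟩; exact e rfl
        by_cases e1 : k' = k <;> simp_all
    · rw [Finset.card_insert_of_notMem hyP]
      simp [Expr.cost]
      omega
  · rintro T s' ⟨h1, h2, h3, h4, h5, h6⟩
    refine ⟨⟨h1, ?_⟩, h2, by omega⟩
    intro z hz k' hk'
    rw [h5 z hz k' hk', hC.cnt z hz k' hk']
    by_cases e : z ∈ N v ∧ k' = k
    · obtain ⟨e1, rfl⟩ := e
      have hvz := hN.symm _ _ e1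
      rw [if_pos ⟨e1, rfl⟩]
      have : (N z).filter (fun u => Function.update lv v k' u ≤ k') =
          insert v ((N z).filter fun u => lv u ≤ k') := by
        ext u
        by_cases hu : u = v
        · subst hu; simp [hvz]
        · simp [hu]
      rw [this, Finset.card_insert_of_notMem (by simp [hlv])]
    · rw [if_neg e, add_zero]
      congr 1
      apply Finset.filter_congr
      intro u hu
      by_cases huv : u = v
      · subst huv
        have : k' ≠ k := fun h => e ⟨hN.symm _ _ hu, h⟩
        simp [hlv]
        omega
      · simp [huv]

/-- Counters only decrease here, so no counter newly reaches its bound and the stack stays as it is.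
-/
theorem raiseOne_run {n L d v k : ℕ} {N : ℕ → Finset ℕ} {lv : ℕ → ℕ} {X : Finset ℕ}
    (hp : Params n L w) (hN : Nbhds n d N) (hC : Core n L N lv X s) (hv : v < n) (hk : k < L)
    (hlv : lv v = k) (h40 : s.reg 40 = v) (h41 : s.reg 41 = k) :
    Run w raiseOne s fun t s' => Core n L N (Function.update lv v (k + 1)) X s' ∧
      Keeps 40 [7, 8, 10] s s' ∧ t + 40 * s'.arr 10 0 ≤ 40 * s.arr 10 0 + 100 * d := by
  have hW := hp.lt_word
  have hWn := hp.word
  have hLn := hp.le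
  have hd1 : 1 ≤ (N v).card := Finset.card_pos.mpr ⟨v, hN.self v hv⟩
  have hd2 := hN.card v
  have hcn : ∀ z, (N z).card ≤ n := fun z => by simpa using Finset.card_le_card (hN.sub z)
  refine Run.forNbr (n := n) (v := v) (N := N v)
    (fun P T s' => Base n L N X s' ∧ Keeps 40 [7] s s' ∧ s'.reg 40 = v ∧ s'.reg 41 = k ∧
      (∀ z < n, ∀ k' < L, s'.arr 7 (z * n + k') =
        s.arr 7 (z * n + k') - if z ∈ P ∧ k' = k then 1 else 0) ∧
      T ≤ 2 + 30 * P.card)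
    (by norm_num) hv (by omega) (hN.sub v) (hC.deg v hv) (hC.adj v hv) ?_ ?_ ?_ ?_ ?_
  · rintro P T s' ⟨h1, h2, h3, -⟩
    exact ⟨h3, h1.n_eq, h2.2 3 (by decide), h2.2 4 (by decide)⟩
  · rintro P T s' r x hr ⟨h1, h2, h3, h4, h5, h6⟩
    have hr' : 42 ≤ r := by omega
    exact ⟨h1.setReg (by omega), h2.setReg (by omega), by simp [h3]; omega, by simp [h4]; omega,
      h5, h6⟩
  · exact ⟨hC.toBase, Keeps.refl, h40, h41, by simp, by simp⟩
  · rintro P T s' y hP hy hyP ⟨h1, h2, h3, h4, h5, h6⟩ hr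
    have hyn : y < n := by simpa using hN.sub v hy
    have hix := idx_lt hyn (show k < n by omega)
    have hcnt : s'.arr 7 (y * n + k) ≤ n := by
      rw [h5 y hyn k hk, hC.cnt y hyn k hk]
      simpa [hyP] using (Finset.card_filter_le _ _).trans (hcn y)
    refine Run.store (by simp [hr, h1.n_eq, h4]; constructor <;> omega)
      (by simp [hr, h1.n_eq, h4, hp.ne_zero]; refine ⟨⟨?_, ?_⟩, ?_⟩ <;> omega) ?_
    have e7 : ∀ z < n, ∀ k' < L, Function.update (s'.arr 7) (y * n + k) (s'.arr 7 (y * n + k) - 1)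
        (z * n + k') = s.arr 7 (z * n + k') - if z ∈ insert y P ∧ k' = k then 1 else 0 := by
      intro z hz k' hk'
      by_cases e : z * n + k' = y * n + k
      · obtain ⟨rfl, rfl⟩ := idx_inj (by omega) (by omega) e
        simp [h5 z hz k' hk', hyP]
      · rw [Function.update_of_ne e, h5 z hz k' hk']
        have : ¬ (z = y ∧ k' = k) := by rintro ⟨rfl, rfl⟩; exact e rfl
        by_cases e1 : k' = k <;> simp_all
    refine ⟨by simp, ?_, h2.setArr, h3, h4, by simpa [hr, h1.n_eq, h4] using e7, ?_⟩
    · refine ⟨h1.n_eq, h1.L_eq, ?_, ?_, ?_, ?_, ?_⟩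
      · simpa using h1.pow
      · simpa using h1.deg
      · simpa using h1.adj
      · intro z hz k' hk' h hX
        simp [hr, h1.n_eq, h4] at h ⊢
        refine h1.queue z hz k' hk' (h.trans ?_) hX
        simp only [Function.update_apply]
        split
        · simp [*]
        · exact le_rfl
      · simpa using h1.stack
    · rw [Finset.card_insert_of_notMem hyP]
      simp
      omega
  · rintro T s' ⟨h1, h2, h3, h4, h5, h6⟩
    have e10 := h2.2 10 (by decide)
    refine ⟨⟨h1, ?_⟩, h2.mono, by rw [e10]; omega⟩
    intro z hz k' hk'
    rw [h5 z hz k' hk', hC.cnt z hz k' hk']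
    by_cases e : z ∈ N v ∧ k' = k
    · obtain ⟨e1, rfl⟩ := e
      have hvz := hN.symm _ _ e1
      rw [if_pos ⟨e1, rfl⟩]
      have : ((N z).filter fun u => lv u ≤ k') =
          insert v ((N z).filter (fun u => Function.update lv v (k' + 1) u ≤ k')) := by
        ext u
        by_cases hu : u = v
        · subst hu; simp [hvz, hlv]
        · simp [hu]
      rw [this, Finset.card_insert_of_notMem (by simp)]
      rfl
    · rw [if_neg e, Nat.sub_zero]
      congr 1
      apply Finset.filter_congr
      intro u hu
      by_cases huv : u = v
      · subst huv
        have : k' ≠ k := fun h => e ⟨hN.symm _ _ hu, h⟩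
        simp [hlv]
        omega
      · simp [huv]

/-- The price is one unit of `120 * d` per level crossed: at most `100 * d` for the single step and
the rest for loop overhead. This is the currency of the potential. -/
theorem adjust_run {n L d v a b : ℕ} {N : ℕ → Finset ℕ} {lv : ℕ → ℕ} {X : Finset ℕ}
    (hp : Params n L w) (hN : Nbhds n d N) (hC : Core n L N lv X s) (hv : v < n) (ha : a < L)
    (hb : b < L) (hlv : lv v = a) (h30 : s.reg 30 = v) (h31 : s.reg 31 = a) (h32 : s.reg 32 = b)
    (hsp : 40 * s.arr 10 0 + 120 * d * ((a - b) + (b - a)) + 8 ≤ 2 ^ w) :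
    Run w adjust s fun t s' => Core n L N (Function.update lv v b) X s' ∧
      Keeps 30 [7, 8, 10] s s' ∧
      t + 40 * s'.arr 10 0 ≤ 40 * s.arr 10 0 + 120 * d * ((a - b) + (b - a)) + 8 := by
  have hW := hp.lt_word
  have hLn := hp.le
  have hd1 : 1 ≤ d := (Finset.card_pos.mpr ⟨v, hN.self v hv⟩).trans_le (hN.card v)
  set D := 120 * d with hD
  rcases le_or_gt a b with hab | hab
  · rw [Nat.sub_eq_zero_of_le hab, zero_add] at hsp ⊢
    apply Run.seq
    refine Run.forTo a b (fun k T s' => Core n L N (Function.update lv v k) X s' ∧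
        Keeps 30 [7, 8, 10] s s' ∧ s'.reg 30 = v ∧ s'.reg 32 = b ∧
        T + 40 * s'.arr 10 0 ≤ 40 * s.arr 10 0 + D * (k - a)) hab h31 ?_ (by omega) ?_ ?_ ?_
    · refine ⟨?_, Keeps.refl, h30, h32, by simp⟩
      rw [← hlv, Function.update_eq_self]; exact hC
    · rintro k T s' - - - ⟨-, -, -, h, -⟩
      simp [h]
    · rintro k T s' hk1 hk2 hr ⟨h1, h2, h3, h4, h5⟩
      apply Run.seq
      refine Run.assign (by simp) ?_
      apply Run.seq
      refine Run.assign (by simp) ?_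
      refine (raiseOne_run (v := v) (k := k) hp hN h1.setReg.setReg hv (by omega) (by simp)
        (by simp [h3]) (by simp [hr])).mono ?_
      rintro t s2 ⟨b1, b2, b3⟩
      have b2' := b2.setReg_left.setReg_left
      simp only [State.setReg_arr] at b3
      refine ⟨by rw [b2'.1 31 (by norm_num), hr], ?_, ?_, ?_, ?_, ?_⟩
      · simpa using b1.setReg
      · exact (h2.trans b2').setReg
      · simp [b2'.1 30 (by norm_num), h3]
      · simp [b2'.1 32 (by norm_num), h4]
      · rw [show k + 1 - a = (k - a) + 1 by omega, mul_add]
        simp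
        omega
    · rintro T s' ⟨h1, h2, h3, h4, h5⟩ hr
      refine Run.loopFalse (by simp) (by simp [hr, h4]) ⟨h1, h2, ?_⟩
      simp
      omega
  · rw [Nat.sub_eq_zero_of_le hab.le, add_zero] at hsp ⊢
    apply Run.seq
    -- As `b < a`, the raising loop stops at once; `Run.forTo` does not apply, since it needs a
    -- start not beyond the end.
    refine Run.loopFalse (by simp) (by simp [h31, h32]; omega) ?_
    suffices H : ∀ j ≤ a - b, ∀ s, Core n L N (Function.update lv v (b + j)) X s → s.reg 30 = v →
        s.reg 31 = b + j → s.reg 32 = b → 40 * s.arr 10 0 + D * j ≤ 2 ^ w →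
        Run w (.loop (.op .lt (.reg 32) (.reg 31)) (.seq (.assign 31 (.op .sub (.reg 31) (.const 1)))
          (.seq (.assign 40 (.reg 30)) (.seq (.assign 41 (.reg 31)) lowerOne)))) s
          fun t s' => Core n L N (Function.update lv v b) X s' ∧ Keeps 30 [7, 8, 10] s s' ∧
            t + 40 * s'.arr 10 0 ≤ 40 * s.arr 10 0 + D * j + 4 by
      refine (H (a - b) le_rfl s ?_ h30 (by omega) h32 (by omega)).mono ?_
      · rw [show b + (a - b) = lv v by omega, Function.update_eq_self]; exact hC
      · rintro t s' ⟨h1, h2, h3⟩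
        refine ⟨h1, h2, ?_⟩
        simp
        omega
    intro j
    induction j with
    | zero =>
      intro _ s hC h30 h31 h32 hsp
      refine Run.loopFalse (by simp) (by simp [h31, h32]) ⟨hC, Keeps.refl, by simp; omega⟩
    | succ j ih =>
      intro hj s hC h30 h31 h32 hsp
      rw [mul_add, mul_one] at hsp
      refine Run.loopTrue (by simp) (by simp [h31, h32]) ?_
      apply Run.seq
      refine Run.assign (by simp [hp.ne_zero, h31]; omega) ?_
      apply Run.seq
      refine Run.assign (by simp) ?_
      apply Run.seq
      refine Run.assign (by simp) ?_
      refine (lowerOne_run (v := v) (k := b + j) (d := d) hp hN hC.setReg.setReg.setReg hv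
        (by omega) (by simp; omega) (by simp [h30]) (by simp [h31]) (by simp; omega)).mono ?_
      rintro t s2 ⟨b1, b2, b3⟩
      have b2' := b2.setReg_left.setReg_left
      have b2'' := b2'.mono (R := 30) (l := [7, 8, 10])
      simp only [State.setReg_arr] at b3
      rw [Function.update_idem] at b1
      refine (ih (by omega) s2 b1 ?_ ?_ ?_ (by omega)).mono ?_
      · simp [b2'.1 30 (by norm_num), h30]
      · simp [b2'.1 31 (by norm_num), h31]
      · simp [b2'.1 32 (by norm_num), h32]
      · rintro t3 s3 ⟨c1, c2, c3⟩
        refine ⟨c1, b2''.setReg_left.trans c2, ?_⟩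
        rw [mul_add]
        simp
        omega


/-! ### Clusters -/

/-- Change the level of the centre `r20` to `r21`. -/
def relevel : Cmd :=
  .seq (forNbr 20 22 23 (.ite (.op .eq (.get 5 (%23)) (%20))
      (.seq (.assign 30 (%23)) (.seq (.assign 31 (.get 6 (%20))) (.seq (.assign 32 (%21)) adjust)))
      .skip))
    (.store 6 (%20) (%21))

/-- Move the vertex `r15` to the cluster with centre `r16`. -/
def move : Cmd :=
  .seq (.assign 17 (.get 5 (%15))) <| .seq (.assign 30 (%15)) <|
  .seq (.assign 31 (.get 6 (%17))) <| .seq (.assign 32 (.get 6 (%16))) <| .seq adjust <|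
  .seq (.store 5 (%15) (%16)) <| .seq (.store 2 (%16) (.op .add (.get 2 (%16)) (#1))) <|
  .seq (.store 2 (%17) (.op .sub (.get 2 (%17)) (#1))) <|
  .ite (.op .lt (.get 2 (%17)) (.get 9 (.get 6 (%17))))
    (.ite (.get 6 (%17))
      (.seq (.assign 20 (%17)) (.seq (.assign 21 (.op .sub (.get 6 (%17)) (#1))) relevel)) .skip)
    .skip

/-- All members of the cluster of `x` lie in `N x`, so one scan of that row finds them; it costs one
unit per member and level, and `50 * d` for the scan. The stored level of `x` is overwritten only
after the scan, because each `adjust` reads the old level from it. -/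
theorem relevel_run {n L d x a b m : ℕ} {N : ℕ → Finset ℕ} {lv : ℕ → ℕ} {X : Finset ℕ}
    (hp : Params n L w) (hN : Nbhds n d N) (hC : Core n L N lv X s) (hx : x < n) (ha : a < L)
    (hb : b < L) (hlv : ∀ v < n, s.arr 5 v = x → lv v = a) (hxN : ∀ v < n, s.arr 5 v = x → v ∈ N x)
    (h6 : s.arr 6 x = a) (h20 : s.reg 20 = x) (h21 : s.reg 21 = b)
    (hm : ((Finset.range n).filter fun v => s.arr 5 v = x).card = m)
    (hsp : 40 * s.arr 10 0 + 120 * d * ((a - b) + (b - a)) * m + 50 * d ≤ 2 ^ w) :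
    Run w relevel s fun t s' => Core n L N (fun v => if s.arr 5 v = x then b else lv v) X s' ∧
      s'.arr 6 = Function.update (s.arr 6) x b ∧ Keeps 20 [6, 7, 8, 10] s s' ∧
      t + 40 * s'.arr 10 0 ≤ 40 * s.arr 10 0 + 120 * d * ((a - b) + (b - a)) * m + 50 * d := by
  have hW := hp.lt_word
  have hWn := hp.word
  have hd1 : 1 ≤ (N x).card := Finset.card_pos.mpr ⟨x, hN.self x hx⟩
  have hd2 := hN.card x
  have hF : (Finset.range n).filter (fun v => s.arr 5 v = x) =
      (N x).filter fun v => s.arr 5 v = x := by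
    ext v
    simp only [Finset.mem_filter, Finset.mem_range]
    exact ⟨fun h => ⟨hxN v h.1 h.2, h.2⟩, fun h => ⟨by simpa using hN.sub x h.1, h.2⟩⟩
  rw [hF] at hm
  subst hm
  obtain ⟨D, hD⟩ : ∃ D, D = 120 * d * ((a - b) + (b - a)) := ⟨_, rfl⟩
  rw [← hD] at hsp ⊢
  apply Run.seq
  refine Run.forNbr (n := n) (v := x) (N := N x)
    (fun P T s' => Core n L N (fun v => if v ∈ P ∧ s.arr 5 v = x then b else lv v) X s' ∧
      Keeps 20 [7, 8, 10] s s' ∧ s'.reg 20 = x ∧ s'.reg 21 = b ∧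
      T + 40 * s'.arr 10 0 ≤ 40 * s.arr 10 0 + 2 + 36 * P.card +
        D * (P.filter fun v => s.arr 5 v = x).card)
    (by norm_num) hx (by omega) (hN.sub x) (hC.deg x hx) (hC.adj x hx) ?_ ?_ ?_ ?_ ?_
  · rintro P T s' ⟨h1, h2, h3, -⟩
    exact ⟨h3, h1.n_eq, h2.2 3 (by decide), h2.2 4 (by decide)⟩
  · rintro P T s' r y hr ⟨h1, h2, h3, h4, h5⟩
    have hr' : 22 ≤ r := by omega
    exact ⟨h1.setReg (by omega), h2.setReg (by omega), by simp [h3]; omega, by simp [h4]; omega, h5⟩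
  · exact ⟨by simpa using hC, Keeps.refl, h20, h21, by simp; omega⟩
  · rintro P T s' y hP hy hyP ⟨h1, h2, h3, h4, h5⟩ hr
    have hyn : y < n := by simpa using hN.sub x hy
    have hPc := Finset.card_lt_card (Finset.ssubset_iff_subset_ne.mpr
      ⟨hP, fun e => hyP (e ▸ hy)⟩)
    have e5 := h2.2 5 (by decide)
    have e6 := h2.2 6 (by decide)
    refine Run.ite (by simp) ?_ ?_
    · intro hc
      simp [hr, h3, e5] at hc
      have hlt : (P.filter fun v => s.arr 5 v = x).card + 1 ≤
          ((N x).filter fun v => s.arr 5 v = x).card := by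
        rw [← Finset.card_insert_of_notMem (a := y) (by simp [hyP])]
        apply Finset.card_le_card
        intro z hz
        rcases Finset.mem_insert.mp hz with rfl | hz
        · simp [hy, hc]
        · have := Finset.mem_filter.mp hz
          simp [hP this.1, this.2]
      have hmul := Nat.mul_le_mul_left D hlt
      rw [mul_add, mul_one] at hmul
      apply Run.seq
      refine Run.assign (by simp) ?_
      apply Run.seq
      refine Run.assign (by simp) ?_
      apply Run.seq
      refine Run.assign (by simp) ?_
      refine (adjust_run (v := y) (a := a) (b := b) (d := d) hp hN h1.setReg.setReg.setReg hyn ha hb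
        (by simp [hyP, hlv y hyn hc]) (by simp [hr]) (by simp [h3, e6, h6]) (by simp [h4]) ?_).mono ?_
      · rw [← hD]
        simp only [State.setReg_arr]
        omega
      · rintro t s2 ⟨b1, b2, b3⟩
        have b2' := b2.setReg_left.setReg_left.setReg_left
        rw [← hD] at b3
        simp only [State.setReg_arr] at b3
        refine ⟨b2'.1 22 (by norm_num), ?_, h2.trans b2', ?_, ?_, ?_⟩
        · convert b1 using 1
          funext v
          by_cases hvy : v = y
          · subst hvy; simp [hc]
          · simp [hvy]
        · rw [b2'.1 20 (by norm_num), h3]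
        · rw [b2'.1 21 (by norm_num), h4]
        · rw [Finset.card_insert_of_notMem hyP, Finset.filter_insert, if_pos hc,
            Finset.card_insert_of_notMem (by simp [hyP]), mul_add D, mul_one]
          simp
          omega
    · intro hc
      simp [hr, h3, e5] at hc
      refine Run.skip ⟨rfl, ?_, h2, h3, h4, ?_⟩
      · convert h1 using 1
        funext v
        by_cases hvy : v = y
        · subst hvy; simp [hc]
        · simp [hvy]
      · rw [Finset.card_insert_of_notMem hyP, Finset.filter_insert, if_neg hc]
        simp
        omega
  · rintro T s' ⟨h1, h2, h3, h4, h5⟩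
    refine Run.store (by simp) (by simp) ⟨?_, ?_, h2.mono.setArr, ?_⟩
    · refine (h1.setArr).congr_lv hN.sub ?_
      intro v hv
      by_cases hc : s.arr 5 v = x
      · simp [hc, hxN v hv hc]
      · simp [hc]
    · simp [h3, h4, h2.2 6 (by decide)]
    · simp
      omega

/-- The clusters: array `5` assigns to each vertex a centre in its closed neighbourhood, the level of
a centre not in `E` is `0` or at most the binary logarithm of the size of its cluster. -/
structure Clusters (n L : ℕ) (N : ℕ → Finset ℕ) (E : Finset ℕ) (s : State) : Prop where
  mem : ∀ v < n, s.arr 5 v ∈ N v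
  size : ∀ u < n, s.arr 2 u = ((Finset.range n).filter fun v => s.arr 5 v = u).card
  lev : ∀ u < n, s.arr 6 u < L
  big : ∀ u < n, u ∉ E → s.arr 6 u = 0 ∨ 2 ^ s.arr 6 u ≤ s.arr 2 u

/-- The invariant of the data structure. -/
structure Inv (n L : ℕ) (N : ℕ → Finset ℕ) (X E : Finset ℕ) (s : State) : Prop where
  core : Core n L N (fun v => s.arr 6 (s.arr 5 v)) X s
  clusters : Clusters n L N E s

theorem Inv.setReg {n L x v : ℕ} {N : ℕ → Finset ℕ} {X E : Finset ℕ} (h : Inv n L N X E s)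
    (hx : 5 ≤ x := by decide) : Inv n L N X E (s.setReg x v) :=
  ⟨h.core.setReg hx, h.clusters.1, h.clusters.2, h.clusters.3, h.clusters.4⟩

/-- The potential of an assignment `φ` to centres with levels `lev` and cluster sizes `sz`. -/
def potential (n L : ℕ) (E : Finset ℕ) (φ lev sz : ℕ → ℕ) : ℕ :=
  10 * ∑ v ∈ Finset.range n, (L - lev (φ v)) +
    11 * ∑ u ∈ Finset.range n \ E, (2 * 2 ^ lev u - sz u)

abbrev State.pot (s : State) (n L : ℕ) (E : Finset ℕ) : ℕ :=
  potential n L E (s.arr 5) (s.arr 6) (s.arr 2)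

/-! ### Changes of the potential -/

theorem sum_relevel {n L x a b : ℕ} {φ lev : ℕ → ℕ} (ha : lev x = a) (haL : a ≤ L) (hbL : b ≤ L) :
    ∑ v ∈ Finset.range n, (L - Function.update lev x b (φ v)) +
        ((Finset.range n).filter fun v => φ v = x).card * b =
      ∑ v ∈ Finset.range n, (L - lev (φ v)) +
        ((Finset.range n).filter fun v => φ v = x).card * a := by
  rw [Finset.card_filter, Finset.sum_mul, Finset.sum_mul, ← Finset.sum_add_distrib,
    ← Finset.sum_add_distrib]
  apply Finset.sum_congr rfl
  intro v _
  by_cases h : φ v = x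
  · simp [h, ha]; omega
  · simp [h]

theorem sum_add_eq {n v : ℕ} {f g : ℕ → ℕ} (hv : v < n) (h : ∀ y ≠ v, f y = g y) :
    ∑ y ∈ Finset.range n, f y + g v = ∑ y ∈ Finset.range n, g y + f v := by
  rw [← Finset.add_sum_erase _ f (Finset.mem_range.mpr hv),
    ← Finset.add_sum_erase _ g (Finset.mem_range.mpr hv),
    Finset.sum_congr rfl fun y hy => h y (Finset.ne_of_mem_erase hy)]
  ring

/-- Lowering `x` costs 10 per member, while its slack falls by `2 ^ lev x`, which is at least `sz x
+ 1`, at 11 each. Of the surplus, one unit per member pays for the level changes and one more for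
the scan of the row. -/
theorem potential_drop {n L x : ℕ} {E : Finset ℕ} {φ lev sz : ℕ → ℕ} (hx : x < n) (hxE : x ∉ E)
    (hsz : sz x = ((Finset.range n).filter fun v => φ v = x).card) (hlev : lev x < L)
    (hpos : lev x ≠ 0) (hlt : sz x < 2 ^ lev x) :
    potential n L E φ (Function.update lev x (lev x - 1)) sz + sz x + 1 ≤
      potential n L E φ lev sz := by
  have h1 := sum_relevel (n := n) (L := L) (x := x) (φ := φ) (lev := lev) (b := lev x - 1) rfl
    hlev.le (by omega)
  have hm : x ∈ Finset.range n \ E := by simp [hx, hxE]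
  have h2 : ∑ u ∈ Finset.range n \ E, (2 * 2 ^ Function.update lev x (lev x - 1) u - sz u) +
      2 ^ lev x ≤ ∑ u ∈ Finset.range n \ E, (2 * 2 ^ lev u - sz u) := by
    rw [← Finset.add_sum_erase _ _ hm, ← Finset.add_sum_erase _ (fun u => 2 * 2 ^ lev u - sz u) hm,
      Finset.sum_congr rfl (g := fun u => 2 * 2 ^ lev u - sz u) fun y hy => by
        rw [Function.update_of_ne (Finset.ne_of_mem_erase hy)]]
    -- Since `sz x < 2 ^ lev x`, neither slack is truncated: it goes from `2 * 2 ^ lev x - sz x` to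
    -- `2 ^ lev x - sz x`.
    obtain ⟨l, hl⟩ := Nat.exists_eq_succ_of_ne_zero hpos
    simp only [Function.update_self]
    rw [hl] at hlt ⊢
    simp only [Nat.succ_eq_add_one, Nat.add_sub_cancel, pow_succ] at hlt ⊢
    omega
  rw [← hsz] at h1
  obtain ⟨l, hl⟩ := Nat.exists_eq_succ_of_ne_zero hpos
  unfold potential
  have h3 : sz x * lev x = sz x * (lev x - 1) + sz x := by
    rw [hl]; simp [Nat.mul_add]
  omega

/-- The old centre loses a member, so its slack grows by at most one, which is the 11; the slack of
the new centre cannot grow. The terms in `lev` are the changed distance of `v` from level `L`, kept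
on both sides to avoid subtraction. -/
theorem potential_move {n L v u : ℕ} {E : Finset ℕ} {φ lev sz : ℕ → ℕ} (hv : v < n)
    (hu : lev u ≤ L) (hφ : lev (φ v) ≤ L) (hne : φ v ≠ u) (hpos : 0 < sz (φ v)) :
    potential n L E (Function.update φ v u) lev
        (Function.update (Function.update sz u (sz u + 1)) (φ v) (sz (φ v) - 1)) + 10 * lev u ≤
      potential n L E φ lev sz + 10 * lev (φ v) + 11 := by
  have h1 := sum_add_eq (n := n) (v := v) (f := fun y => L - lev (Function.update φ v u y))
    (g := fun y => L - lev (φ y)) hv (fun y hy => by simp [hy])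
  simp only [Function.update_self] at h1
  have h2 : ∑ y ∈ Finset.range n \ E, (2 * 2 ^ lev y -
      Function.update (Function.update sz u (sz u + 1)) (φ v) (sz (φ v) - 1) y) ≤
      ∑ y ∈ Finset.range n \ E, (2 * 2 ^ lev y - sz y) + 1 := by
    calc _ ≤ ∑ y ∈ Finset.range n \ E, ((2 * 2 ^ lev y - sz y) + if y = φ v then 1 else 0) := by
          apply Finset.sum_le_sum
          intro y _
          by_cases h : y = φ v
          · subst h; simp; omega
          · by_cases h' : y = u
            · subst h'; simp [h]; omega
            · simp [h, h']
      _ ≤ _ := by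
          rw [Finset.sum_add_distrib, Finset.sum_ite_eq']
          split <;> omega
  unfold potential
  omega

/-- The 12 units are the 11 of `potential_move` and one for the constant work; the level difference
pays for `adjust`. A demotion of the old centre is free by `potential_drop`. This is why the old
centre must lie outside `E`: an exempt centre has neither slack in the potential nor a guaranteed
cluster size. -/
theorem move_run {n L d v u : ℕ} {N : ℕ → Finset ℕ} {X E : Finset ℕ} (hp : Params n L w)
    (hN : Nbhds n d N) (hI : Inv n L N X E s) (hv : v < n) (hu : u ∈ N v) (hne : s.arr 5 v ≠ u)
    (hE : s.arr 5 v ∉ E) (h15 : s.reg 15 = v) (h16 : s.reg 16 = u)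
    (hsp : 40 * s.arr 10 0 + 120 * d * (s.pot n L E + 10 * s.arr 6 (s.arr 5 v) + 12 +
      ((s.arr 6 (s.arr 5 v) - s.arr 6 u) + (s.arr 6 u - s.arr 6 (s.arr 5 v)))) ≤ 2 ^ w) :
    Run w move s fun t s' => Inv n L N X E s' ∧ s'.arr 5 = Function.update (s.arr 5) v u ∧
      s'.arr 2 u = s.arr 2 u + 1 ∧ (∀ y ≠ s.arr 5 v, s'.arr 6 y = s.arr 6 y) ∧
      (∀ y, s'.arr 6 y ≤ s.arr 6 y) ∧ Keeps 15 [2, 5, 6, 7, 8, 10] s s' ∧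
      t + 40 * s'.arr 10 0 + 120 * d * (s'.pot n L E + 10 * s.arr 6 u) ≤
        40 * s.arr 10 0 + 120 * d * (s.pot n L E + 10 * s.arr 6 (s.arr 5 v) + 12 +
          ((s.arr 6 (s.arr 5 v) - s.arr 6 u) + (s.arr 6 u - s.arr 6 (s.arr 5 v)))) := by
  obtain ⟨hC, hK⟩ := hI
  have hW := hp.lt_word
  have hpn : ∀ y < n, s.arr 5 y < n := fun y hy => by simpa using hN.sub y (hK.mem y hy)
  have hun : u < n := by simpa using hN.sub v hu
  have hd1 : 1 ≤ d := (Finset.card_pos.mpr ⟨v, hN.self v hv⟩).trans_le (hN.card v)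
  obtain ⟨x, hx⟩ : ∃ x, s.arr 5 v = x := ⟨_, rfl⟩
  rw [hx] at hne hE hsp ⊢
  have hxn : x < n := hx ▸ hpn v hv
  obtain ⟨a, ha⟩ : ∃ a, s.arr 6 x = a := ⟨_, rfl⟩
  obtain ⟨b, hb⟩ : ∃ b, s.arr 6 u = b := ⟨_, rfl⟩
  have haL : a < L := ha ▸ hK.lev x hxn
  have hbL : b < L := hb ▸ hK.lev u hun
  have hsn : ∀ y < n, s.arr 2 y ≤ n := fun y hy => by
    rw [hK.size y hy]; simpa using Finset.card_filter_le (Finset.range n) _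
  have hsx : 0 < s.arr 2 x := by
    rw [hK.size x hxn]
    exact Finset.card_pos.mpr ⟨v, by simp [hv, hx]⟩
  have hpm := potential_move (n := n) (L := L) (v := v) (u := u) (E := E) (φ := s.arr 5)
    (lev := s.arr 6) (sz := s.arr 2) hv (by omega) (by rw [hx, ha]; omega) (by rwa [hx])
    (by rwa [hx])
  rw [hx, ha, hb] at hpm
  change _ ≤ s.pot n L E + 10 * a + 11 at hpm
  rw [ha, hb] at hsp ⊢
  obtain ⟨δ, hδ⟩ : ∃ δ, δ = (a - b) + (b - a) := ⟨_, rfl⟩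
  rw [← hδ] at hsp ⊢
  have hpm' := Nat.mul_le_mul_left (120 * d) hpm
  simp only [mul_add] at hsp hpm' ⊢
  apply Run.seq
  refine Run.assign (by simp) ?_
  apply Run.seq
  refine Run.assign (by simp) ?_
  apply Run.seq
  refine Run.assign (by simp) ?_
  apply Run.seq
  refine Run.assign (by simp) ?_
  apply Run.seq
  refine (adjust_run (v := v) (a := a) (b := b) (d := d) hp hN hC.setReg.setReg.setReg.setReg hv
    haL hbL (by simp [hx, ha]) (by simp [h15]) (by simp [h15, hx, ha]) (by simp [h16, hb]) ?_).mono ?_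
  · rw [← hδ]
    simp only [State.setReg_arr]
    omega
  rintro t1 s1 ⟨b1, b2, b3⟩
  rw [← hδ] at b3
  simp only [State.setReg_arr] at b3
  have e15 : s1.reg 15 = v := by rw [b2.1 15 (by norm_num)]; simp [h15]
  have e16 : s1.reg 16 = u := by rw [b2.1 16 (by norm_num)]; simp [h16]
  have e17 : s1.reg 17 = x := by rw [b2.1 17 (by norm_num)]; simp [h15, hx]
  have b2' := b2.mono (R := 15) (l := [7, 8, 10])
  have b2'' := b2'.setReg_left.setReg_left.setReg_left.setReg_left
  have f5 := b2''.2 5 (by decide)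
  have f6 := b2''.2 6 (by decide)
  have f2 := b2''.2 2 (by decide)
  apply Run.seq
  refine Run.store (by simp) (by simp) ?_
  apply Run.seq
  refine Run.store (by simp) (by simp [e16, f2, hp.ne_zero]; have := hsn u hun; omega) ?_
  apply Run.seq
  refine Run.store (by simp) (by simp [e16, e17, f2, hp.ne_zero, hne]; have := hsn x hxn; omega) ?_
  simp only [Expr.val, BinOp.eval, State.setArr_reg, e15, e16, e17]
  obtain ⟨s2, hs2⟩ : ∃ s2, s2 = ((s1.setArr 5 v u).setArr 2 u
    (((s1.setArr 5 v u).arr 2 u) + 1)).setArr 2 x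
      ((((s1.setArr 5 v u).setArr 2 u (((s1.setArr 5 v u).arr 2 u) + 1)).arr 2 x) - 1) := ⟨_, rfl⟩
  rw [← hs2]
  have g5 : s2.arr 5 = Function.update (s.arr 5) v u := by simp [hs2, f5]
  have g6 : s2.arr 6 = s.arr 6 := by simp [hs2, f6]
  have g2 : s2.arr 2 = Function.update (Function.update (s.arr 2) u (s.arr 2 u + 1)) x
      (s.arr 2 x - 1) := by simp [hs2, f2, hne]
  have g10 : s2.arr 10 = s1.arr 10 := by simp [hs2]
  have gK : Keeps 15 [2, 5, 6, 7, 8, 10] s s2 := by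
    rw [hs2]
    exact b2''.mono.setArr.setArr.setArr
  have gC : Core n L N (fun y => s2.arr 6 (s2.arr 5 y)) X s2 := by
    have : Core n L N (Function.update (fun v => s.arr 6 (s.arr 5 v)) v b) X s2 := by
      rw [hs2]
      exact b1.setArr.setArr.setArr
    convert this using 1
    funext y
    by_cases h : y = v
    · subst h; simp [g5, g6, hb]
    · simp [g5, g6, h]
  have gsz : ∀ y < n, s2.arr 2 y = ((Finset.range n).filter fun z => s2.arr 5 z = y).card := by
    intro y hy
    have hold := hK.size y hy
    rw [Finset.card_filter] at hold ⊢
    have hsum := sum_add_eq (n := n) (v := v) (f := fun z => if s2.arr 5 z = y then 1 else 0)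
      (g := fun z => if s.arr 5 z = y then 1 else 0) hv (fun z hz => by simp [g5, hz])
    simp only [← hold, hx, g5, Function.update_self] at hsum
    rw [g5]
    simp only [g2]
    by_cases h1 : y = x
    · subst h1
      simp [hne.symm] at hsum ⊢
      omega
    · by_cases h2 : y = u
      · subst h2
        simp [hne, h1] at hsum ⊢
        omega
      · simp [h1, h2, Ne.symm h1, Ne.symm h2] at hsum ⊢
        omega
  have gbig : ∀ y < n, y ∉ E → y ≠ x → s2.arr 6 y = 0 ∨ 2 ^ s2.arr 6 y ≤ s2.arr 2 y := by
    intro y hy hyE hyx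
    rw [g6, g2, Function.update_of_ne hyx]
    rcases hK.big y hy hyE with h | h
    · exact Or.inl h
    · right
      refine h.trans ?_
      by_cases h2 : y = u
      · subst h2; simp
      · simp [h2]
  have gmem : ∀ y < n, s2.arr 5 y ∈ N y := by
    intro y hy
    rw [g5]
    by_cases h : y = v
    · subst h; simpa using hu
    · simpa [h] using hK.mem y hy
  have gpow := gC.pow a haL
  have gpot : s2.pot n L E = potential n L E (Function.update (s.arr 5) v u) (s.arr 6)
      (Function.update (Function.update (s.arr 2) u (s.arr 2 u + 1)) x (s.arr 2 x - 1)) := by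
    rw [State.pot, g5, g6, g2]
  rw [← gpot] at hpm'
  have gu : s2.arr 2 u = s.arr 2 u + 1 := by simp [g2, hne.symm]
  have g17 : s2.reg 17 = x := by rw [hs2]; exact e17
  have stay : (s2.arr 6 x = 0 ∨ 2 ^ s2.arr 6 x ≤ s2.arr 2 x) → Inv n L N X E s2 := by
    intro h
    refine ⟨gC, gmem, gsz, by rw [g6]; exact hK.lev, fun y hy hyE => ?_⟩
    by_cases hyx : y = x
    · subst hyx; exact h
    · exact gbig y hy hyE hyx
  refine Run.ite (by simp) ?_ ?_
  · intro hlt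
    simp [g17, g6, ha, gpow] at hlt
    refine Run.ite (by simp) ?_ ?_
    · intro hpos
      simp [g17, g6, ha] at hpos
      apply Run.seq
      refine Run.assign (by simp) ?_
      apply Run.seq
      refine Run.assign (by simp [g17, g6, ha, hp.ne_zero]; have := hp.le; omega) ?_
      have hdrop := potential_drop (n := n) (L := L) (x := x) (E := E) (φ := s2.arr 5)
        (lev := s2.arr 6) (sz := s2.arr 2) hxn hE (gsz x hxn) (by rw [g6, ha]; exact haL)
        (by rw [g6, ha]; exact hpos) (by rw [g6, ha]; exact hlt)
      rw [show s2.arr 6 x = a by rw [g6, ha]] at hdrop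
      change _ ≤ s2.pot n L E at hdrop
      have hdrop' := Nat.mul_le_mul_left (120 * d) hdrop
      have hone : (a - (a - 1)) + (a - 1 - a) = 1 := by omega
      simp only [mul_add, mul_one] at hdrop'
      refine (relevel_run (x := x) (a := a) (b := a - 1) (d := d) hp hN gC.setReg.setReg hxn haL
        (by omega) ?_ ?_ (by simp [g6, ha]) (by simp [g17]) (by simp [g17, g6, ha])
        (gsz x hxn).symm ?_).mono ?_
      · intro y hy h
        simp only [State.setReg_arr] at h
        rw [h, g6, ha]
      · intro y hy h
        simp only [State.setReg_arr] at h
        exact hN.symm _ _ (h ▸ gmem y hy)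
      · simp only [State.setReg_arr, hone, mul_one, g10]
        omega
      rintro t3 s3 ⟨c1, c2, c3, c4⟩
      simp only [State.setReg_arr] at c1 c2 c4
      rw [hone, mul_one, g10] at c4
      have c3' := c3.setReg_left.setReg_left
      have k5 := c3'.2 5 (by decide)
      have k2 := c3'.2 2 (by decide)
      have k6 : ∀ y, s3.arr 6 y = if y = x then a - 1 else s.arr 6 y := by
        intro y; rw [c2, g6, Function.update_apply]
      refine ⟨⟨?_, ?_, ?_, ?_, ?_⟩, by rw [k5, g5], by rw [k2, gu], ?_, ?_, ?_, ?_⟩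
      · convert c1 using 1
        funext y
        rw [k5, k6, g6]
        rfl
      · rw [k5]; exact gmem
      · rw [k5, k2]; exact gsz
      · intro y hy
        rw [k6]
        split
        · omega
        · exact hK.lev y hy
      · intro y hy hyE
        rw [k2]
        by_cases hyx : y = x
        · subst hyx
          rw [k6, if_pos rfl]
          right
          -- Before the move the cluster had at least `2 ^ a` members, so `2 ^ a - 1 ≥ 2 ^ (a - 1)`
          -- are left and one demotion suffices.
          have hb' := hK.big y hy hyE
          rw [ha] at hb'
          have : s2.arr 2 y = s.arr 2 y - 1 := by simp [g2]
          obtain ⟨l, rfl⟩ := Nat.exists_eq_succ_of_ne_zero hpos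
          have hl : 1 ≤ 2 ^ l := Nat.one_le_two_pow
          simp only [Nat.succ_eq_add_one, pow_succ, Nat.add_sub_cancel] at hb' ⊢
          omega
        · have := gbig y hy hyE hyx
          rw [g6] at this
          rwa [k6, if_neg hyx]
      · intro y hy; rw [k6, if_neg hy]
      · intro y; rw [k6]; split
        · subst_vars; omega
        · exact le_rfl
      · exact gK.trans c3'
      · have hp3 : s3.pot n L E = potential n L E (s2.arr 5)
            (Function.update (s2.arr 6) x (a - 1)) (s2.arr 2) := by rw [State.pot, k5, k2, c2]
        rw [hp3]
        simp
        omega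
    · intro hz
      simp [g17] at hz
      refine Run.skip ⟨stay (Or.inl hz), g5, gu, fun y _ => by rw [g6],
        fun y => by rw [g6], gK, ?_⟩
      rw [g10]
      simp
      omega
  · intro hge
    simp [g17, g6, ha, gpow] at hge
    refine Run.skip ⟨stay (Or.inr (by rw [g6, ha]; exact hge)), g5, gu, fun y _ => by rw [g6],
      fun y => by rw [g6], gK, ?_⟩
    rw [g10]
    simp
    omega


/-! ### Repairing large counters -/

/-- Raise the level of the centre `r10` to at least `r11 + 2`, then move to its cluster all its
neighbours of level at most `r11`. -/
def settle : Cmd :=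
  .seq (.ite (.op .lt (.get 6 (%10)) (.op .add (%11) (#2)))
      (.seq (.assign 20 (%10)) (.seq (.assign 21 (.op .add (%11) (#2))) relevel)) .skip)
    (forNbr 10 12 13 (.ite (.op .eq (.get 5 (%13)) (%10)) .skip
      (.ite (.op .lt (.get 6 (.get 5 (%13))) (.op .add (%11) (#1)))
        (.seq (.assign 15 (%13)) (.seq (.assign 16 (%10)) move)) .skip)))

/-- Process the stack until it is empty. -/
def drain : Cmd :=
  .loop (.get 10 (#0)) <|
    .seq (.store 10 (#0) (.op .sub (.get 10 (#0)) (#1))) <|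
    .seq (.assign 8 (.get 8 (.get 10 (#0)))) <|
    .ite (.op .lt (.get 7 (%8)) (.op .mul (#8) (.get 9 (.op .mod (%8) (%3))))) .skip <|
    .seq (.assign 10 (.op .div (%8) (%3))) <| .seq (.assign 11 (.op .mod (%8) (%3))) settle

/-- Raising `u` can create a large slack before its new members arrive. The slack of `u` is
therefore set aside during `settle` and put back at the end. -/
theorem potential_singleton {n L u : ℕ} {φ lev sz : ℕ → ℕ} (hu : u < n) :
    potential n L ∅ φ lev sz = potential n L {u} φ lev sz + 11 * (2 * 2 ^ lev u - sz u) := by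
  have := Finset.sum_sdiff (f := fun u => 2 * 2 ^ lev u - sz u) (show {u} ⊆ Finset.range n by simpa)
  simp only [Finset.sum_singleton] at this
  unfold potential
  rw [Finset.sdiff_empty, ← this]
  ring

/-- With the slack of `u` set aside, the raise only releases 10 per member and level. -/
theorem potential_raise {n L u b : ℕ} {φ lev sz : ℕ → ℕ}
    (hsz : sz u = ((Finset.range n).filter fun v => φ v = u).card) (hb : b ≤ L)
    (hlt : lev u ≤ b) :
    potential n L {u} φ (Function.update lev u b) sz + 10 * (sz u * (b - lev u)) =
      potential n L {u} φ lev sz := by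
  have h1 := sum_relevel (n := n) (L := L) (x := u) (φ := φ) (lev := lev) (b := b) rfl
    (hlt.trans hb) hb
  rw [← hsz] at h1
  have h2 : ∑ y ∈ Finset.range n \ {u}, (2 * 2 ^ Function.update lev u b y - sz y) =
      ∑ y ∈ Finset.range n \ {u}, (2 * 2 ^ lev y - sz y) := by
    apply Finset.sum_congr rfl
    intro y hy
    rw [Function.update_of_ne]
    rintro rfl
    simp at hy
  have h3 : sz u * b = sz u * (b - lev u) + sz u * lev u := by
    rw [← mul_add, Nat.sub_add_cancel hlt]
  unfold potential
  rw [h2]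
  omega

/-- The first phase of `settle`. -/
theorem settle_raise_run {n L d u j : ℕ} {N : ℕ → Finset ℕ} {X : Finset ℕ} {E : Finset ℕ}
    (hp : Params n L w) (hN : Nbhds n d N) (hI : Inv n L N X E s) (hu : u < n) (hj : j + 2 < L)
    (h10 : s.reg 10 = u) (h11 : s.reg 11 = j)
    (hsp : 40 * s.arr 10 0 + 120 * d * (s.pot n L {u} + 1) ≤ 2 ^ w) :
    Run w (.ite (.op .lt (.get 6 (%10)) (.op .add (%11) (#2)))
      (.seq (.assign 20 (%10)) (.seq (.assign 21 (.op .add (%11) (#2))) relevel)) .skip) s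
      fun t s' => Inv n L N X (insert u E) s' ∧ s'.arr 5 = s.arr 5 ∧ s'.arr 2 = s.arr 2 ∧
        s'.arr 6 = Function.update (s.arr 6) u (max (s.arr 6 u) (j + 2)) ∧
        Keeps 15 [6, 7, 8, 10] s s' ∧
        t + 40 * s'.arr 10 0 + 120 * d * s'.pot n L {u} +
          120 * d * (9 * if s.arr 6 u < j + 2 then s.arr 2 u else 0) ≤
          40 * s.arr 10 0 + 120 * d * s.pot n L {u} + 50 * d + 20 := by
  obtain ⟨hC, hK⟩ := hI
  have hW := hp.lt_word
  have hLn := hp.le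
  refine Run.ite (by simp [h11]; omega) ?_ ?_
  · intro hlt
    simp [h10, h11] at hlt
    have hr := potential_raise (n := n) (L := L) (u := u) (b := j + 2) (φ := s.arr 5)
      (lev := s.arr 6) (sz := s.arr 2) (hK.size u hu) (by omega) hlt.le
    change _ = s.pot n L {u} at hr
    have hr' := congrArg (120 * d * ·) hr
    simp only [mul_add] at hr' hsp
    -- Of the 10 units per member and level, one pays for `relevel`. At least one level is climbed,
    -- so 9 units per member are left over.
    have h9 : 120 * d * (9 * s.arr 2 u) ≤ 120 * d * (9 * (s.arr 2 u * (j + 2 - s.arr 6 u))) := by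
      apply Nat.mul_le_mul_left
      apply Nat.mul_le_mul_left
      exact Nat.le_mul_of_pos_right _ (by omega)
    have h10' : 120 * d * (10 * (s.arr 2 u * (j + 2 - s.arr 6 u))) =
        120 * d * (9 * (s.arr 2 u * (j + 2 - s.arr 6 u))) +
          120 * d * (j + 2 - s.arr 6 u) * s.arr 2 u := by ring
    have hδ : (s.arr 6 u - (j + 2)) + (j + 2 - s.arr 6 u) = j + 2 - s.arr 6 u := by omega
    apply Run.seq
    refine Run.assign (by simp) ?_
    apply Run.seq
    refine Run.assign (by simp [h11]; omega) ?_
    refine (relevel_run (x := u) (a := s.arr 6 u) (b := j + 2) (d := d) (m := s.arr 2 u) hp hN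
      hC.setReg.setReg hu (hK.lev u hu) (by omega) ?_ ?_ (by simp) (by simp [h10]) (by simp [h11])
      (hK.size u hu).symm ?_).mono ?_
    · intro y hy h
      simp only [State.setReg_arr] at h
      rw [h]
    · intro y hy h
      simp only [State.setReg_arr] at h
      exact hN.symm _ _ (h ▸ hK.mem y hy)
    · simp only [State.setReg_arr, hδ]
      omega
    rintro t1 s1 ⟨b1, b2, b3, b4⟩
    simp only [State.setReg_arr, hδ] at b1 b2 b4
    have b3' := b3.setReg_left.setReg_left
    have k5 := b3'.2 5 (by decide)
    have k2 := b3'.2 2 (by decide)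
    have hmax : max (s.arr 6 u) (j + 2) = j + 2 := max_eq_right hlt.le
    refine ⟨⟨?_, ?_, ?_, ?_, ?_⟩, k5, k2, by rw [b2, hmax], b3'.mono, ?_⟩
    · convert b1 using 1
      funext y
      rw [k5, b2, Function.update_apply]
      rfl
    · rw [k5]; exact hK.mem
    · rw [k5, k2]; exact hK.size
    · intro y hy
      rw [b2, Function.update_apply]
      split
      · omega
      · exact hK.lev y hy
    · intro y hy hyE
      simp only [Finset.mem_insert, not_or] at hyE
      rw [b2, Function.update_of_ne hyE.1, k2]
      exact hK.big y hy hyE.2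
    · have : s1.pot n L {u} = potential n L {u} (s.arr 5) (Function.update (s.arr 6) u (j + 2))
          (s.arr 2) := by rw [State.pot, k5, b2, k2]
      rw [if_pos hlt, this]
      simp
      omega
  · intro hge
    simp [h10, h11] at hge
    refine Run.skip ⟨⟨hC, hK.mem, hK.size, hK.lev, ?_⟩, rfl, rfl, ?_, Keeps.refl, ?_⟩
    · intro y hy hyE
      exact hK.big y hy fun h => hyE (Finset.mem_insert_of_mem h)
    · rw [max_eq_left hge, Function.update_eq_self]
    · rw [if_neg (by omega)]
      simp
      omega

/-- The bound has no additive term: a repair is paid for entirely by the potential it releases. -/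
theorem settle_run {n L d u j : ℕ} {N : ℕ → Finset ℕ} (hp : Params n L w) (hN : Nbhds n d N)
    (hI : Inv n L N {u * n + j} ∅ s) (hu : u < n) (hj : j < L)
    (hviol : 8 * 2 ^ j ≤ s.arr 7 (u * n + j)) (h10 : s.reg 10 = u) (h11 : s.reg 11 = j)
    (hsp : 40 * s.arr 10 0 + 120 * d * (s.pot n L ∅ + 10 * L) ≤ 2 ^ w) :
    Run w settle s fun t s' => Inv n L N ∅ ∅ s' ∧ Keeps 10 [2, 5, 6, 7, 8, 10] s s' ∧
      t + 40 * s'.arr 10 0 + 120 * d * s'.pot n L ∅ ≤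
        40 * s.arr 10 0 + 120 * d * s.pot n L ∅ := by
  have hW := hp.lt_word
  have hWn := hp.word
  have hLn := hp.le
  have hd1 : 1 ≤ (N u).card := Finset.card_pos.mpr ⟨u, hN.self u hu⟩
  have hd2 := hN.card u
  have hcnt := hI.core.cnt u hu j hj
  obtain ⟨V, hV⟩ : ∃ V, V = (N u).filter fun v => s.arr 6 (s.arr 5 v) ≤ j := ⟨_, rfl⟩
  rw [← hV] at hcnt
  have hVc : 8 * 2 ^ j ≤ V.card := hcnt ▸ hviol
  have hVN : V ⊆ N u := hV ▸ Finset.filter_subset _ _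
  -- The violated bound gives `2 ^ (j + 3) ≤ V.card ≤ n < 2 ^ L`, so level `j + 2` exists.
  have hj2 : j + 3 < L := by
    have h1 : V.card ≤ n := by simpa using Finset.card_le_card (hVN.trans (hN.sub u))
    apply (Nat.pow_lt_pow_iff_right (show 1 < 2 by norm_num)).mp
    have := hp.lt_pow
    rw [pow_add]
    omega
  have hps := potential_singleton (L := L) (φ := s.arr 5) (lev := s.arr 6) (sz := s.arr 2) hu
  change s.pot n L ∅ = s.pot n L {u} + _ at hps
  have hps' := congrArg (120 * d * ·) hps
  simp only [mul_add] at hps' hsp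
  have hdL : 120 * d * (10 * (L - 1)) + 1200 * d = 120 * d * (10 * L) := by
    obtain ⟨l, hl⟩ : ∃ l, L = l + 1 := ⟨L - 1, by omega⟩
    rw [hl, Nat.add_sub_cancel]
    ring
  apply Run.seq
  refine (settle_raise_run hp hN hI hu (by omega) h10 h11 ?_).mono ?_
  · rw [mul_add]; omega
  rintro t1 s1 ⟨hI1, k5, k2, k6, hk1, ht1⟩
  rw [insert_empty_eq] at hI1
  obtain ⟨r, hr⟩ : ∃ r, r = if s.arr 6 u < j + 2 then s.arr 2 u else 0 := ⟨_, rfl⟩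
  rw [← hr] at ht1
  obtain ⟨l, hl⟩ : ∃ l, l = max (s.arr 6 u) (j + 2) := ⟨_, rfl⟩
  rw [← hl] at k6
  have hjl : j + 2 ≤ l := hl ▸ le_max_right _ _
  have hlu : s1.arr 6 u = l := by simp [k6]
  have hlL : l < L := hlu ▸ hI1.clusters.lev u hu
  have hN1 : N u ⊆ Finset.range n := hN.sub u
  -- `m` counts the vertices moved so far, each leaving 6 units over. A vertex of `V` may have its
  -- centre demoted before its turn, so for untreated ones only level at most `j` is kept.
  refine Run.forNbr (n := n) (v := u) (N := N u)
    (fun P T s' => Inv n L N {u * n + j} {u} s' ∧ Keeps 10 [2, 5, 6, 7, 8, 10] s1 s' ∧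
      s'.reg 10 = u ∧ s'.reg 11 = j ∧ s'.arr 6 u = l ∧ (∀ v ∈ P, j < s'.arr 6 (s'.arr 5 v)) ∧
      (∀ v ∈ V, s'.arr 5 v = u ∨ v ∉ P ∧ s'.arr 6 (s'.arr 5 v) ≤ j) ∧
      ∃ m, s'.arr 2 u = s1.arr 2 u + m ∧ (m = 0 → s'.arr 5 = s1.arr 5) ∧
        T + 40 * s'.arr 10 0 + 120 * d * s'.pot n L {u} + 120 * d * (6 * m) ≤
          40 * s1.arr 10 0 + 120 * d * s1.pot n L {u} + 2 + 36 * P.card)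
    (by norm_num) hu (by omega) (hN.sub u) (hI1.core.deg u hu) (hI1.core.adj u hu) ?_ ?_ ?_ ?_ ?_
  · rintro P T s' ⟨h1, h2, h3, -⟩
    exact ⟨h3, h1.core.n_eq, h2.2 3 (by decide), h2.2 4 (by decide)⟩
  · rintro P T s' r y hr ⟨h1, h2, h3, h4, h5⟩
    have hr' : 12 ≤ r := by omega
    exact ⟨h1.setReg (by omega), h2.setReg (by omega), by simp [h3]; omega, by simp [h4]; omega, h5⟩
  · refine ⟨hI1, Keeps.refl, by rw [hk1.1 10 (by norm_num), h10],
      by rw [hk1.1 11 (by norm_num), h11], hlu, by simp, ?_, 0, by simp, by simp, by simp; omega⟩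
    intro v hv
    rw [hV, Finset.mem_filter] at hv
    rw [k5, k6]
    by_cases h : s.arr 5 v = u
    · exact Or.inl h
    · exact Or.inr ⟨by simp, by rw [Function.update_of_ne h]; exact hv.2⟩
  · rintro P T s' y hP hy hyP ⟨h1, h2, h3, h4, h5, h6, h7, m, h8, h9, hT⟩ hr
    have hyn : y < n := by simpa using hN.sub u hy
    have hPc := Finset.card_lt_card (Finset.ssubset_iff_subset_ne.mpr
      ⟨hP, fun e => hyP (e ▸ hy)⟩)
    rw [Finset.card_insert_of_notMem hyP]
    refine Run.ite (by simp) ?_ ?_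
    · intro hc
      simp [hr, h3] at hc
      refine Run.skip ⟨rfl, h1, h2, h3, h4, h5, ?_, ?_, m, h8, h9, by simp; omega⟩
      · intro v hv
        rcases Finset.mem_insert.mp hv with rfl | hv
        · rw [hc, h5]; omega
        · exact h6 v hv
      · intro v hv
        rcases h7 v hv with h | ⟨h, h'⟩
        · exact Or.inl h
        · by_cases hvy : v = y
          · subst hvy; exact Or.inl hc
          · exact Or.inr ⟨by simp [hvy, h], h'⟩
    · intro hc
      simp [hr, h3] at hc
      refine Run.ite (by simp [h4, hp.ne_zero]; omega) ?_ ?_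
      · intro hle
        simp [hr, h4] at hle
        obtain ⟨a, ha⟩ : ∃ a, s'.arr 6 (s'.arr 5 y) = a := ⟨_, rfl⟩
        rw [ha] at hle
        have hδ : (a - l) + (l - a) = l - a := by omega
        -- Moving from `a ≤ j` to `l ≥ j + 2` frees `10 * (l - a)` units and spends `12 + (l - a)`;
        -- as `9 * (l - a) ≥ 18`, 6 are left. This is why `u` is raised two levels above `j`.
        have hgain : 120 * d * (10 * a) + 120 * d * 12 + 120 * d * (l - a) + 120 * d * 6 ≤
            120 * d * (10 * l) := by
          rw [← mul_add, ← mul_add, ← mul_add]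
          exact Nat.mul_le_mul_left _ (by omega)
        have hmono : 120 * d * (10 * l) ≤ 120 * d * (10 * (L - 1)) :=
          Nat.mul_le_mul_left _ (by omega)
        apply Run.seq
        refine Run.assign (by simp) ?_
        apply Run.seq
        refine Run.assign (by simp) ?_
        refine (move_run (v := y) (u := u) (E := {u}) (X := {u * n + j}) (d := d) hp hN
          h1.setReg.setReg
          hyn (hN.symm _ _ hy) hc (by simpa using hc) (by simp [hr]) (by simp [h3]) ?_).mono ?_
        · simp only [State.setReg_arr, State.pot, ha, h5, hδ, mul_add] at hT ⊢
          simp only [State.pot] at hsp hps' ht1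
          omega
        rintro t2 s2 ⟨c1, c2, c3, c4, c5, c6, c7⟩
        simp only [State.setReg_arr, State.pot, ha, h5, hδ, mul_add] at c2 c3 c4 c5 c7
        have c6' := c6.setReg_left.setReg_left
        have hlow : ∀ v, v ≠ y → s2.arr 5 v = s'.arr 5 v := fun v hv => by
          rw [c2, Function.update_of_ne hv]
        refine ⟨c6'.1 12 (by norm_num), c1, h2.trans c6', by rw [c6'.1 10 (by norm_num), h3],
          by rw [c6'.1 11 (by norm_num), h4], ?_, ?_, ?_, m + 1, by rw [c3, h8, add_assoc],
          by simp, ?_⟩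
        · rw [c4 u (Ne.symm hc), h5]
        · intro v hv
          by_cases hvy : v = y
          · subst hvy
            rw [c2, Function.update_self, c4 u (Ne.symm hc), h5]; omega
          · have hvP : v ∈ P := by simpa [hvy] using hv
            have := h6 v hvP
            rw [hlow v hvy, c4]
            · exact this
            -- Only the old centre of `y`, of level `a ≤ j`, can be demoted; a treated vertex has
            -- level above `j`, hence another centre.
            · intro e; rw [e, ha] at this; omega
        · intro v hv
          by_cases hvy : v = y
          · subst hvy; left; simp [c2]
          · rcases h7 v hv with h | ⟨h, h'⟩
            · left; rw [hlow v hvy, h]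
            · right
              refine ⟨by simp [hvy, h], ?_⟩
              rw [hlow v hvy]
              exact (c5 _).trans h'
        · simp only [State.pot, mul_add] at hT ⊢
          simp
          omega
      · intro hgt
        simp [hr, h4] at hgt
        refine Run.skip ⟨rfl, h1, h2, h3, h4, h5, ?_, ?_, m, h8, h9, by simp; omega⟩
        · intro v hv
          rcases Finset.mem_insert.mp hv with rfl | hv
          · exact hgt
          · exact h6 v hv
        · intro v hv
          rcases h7 v hv with h | ⟨h, h'⟩
          · exact Or.inl h
          · by_cases hvy : v = y
            · subst hvy; omega
            · exact Or.inr ⟨by simp [hvy, h], h'⟩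
  · rintro T s' ⟨h1, h2, h3, h4, h5, h6, h7, m, h8, h9, hT⟩
    have hVu : ∀ v ∈ V, s'.arr 5 v = u := fun v hv =>
      (h7 v hv).resolve_right fun h => h.1 (hVN hv)
    have hsize : 8 * 2 ^ j ≤ s'.arr 2 u := by
      rw [h1.clusters.size u hu]
      refine hVc.trans (Finset.card_le_card fun v hv => ?_)
      rw [Finset.mem_filter]
      exact ⟨hN1 (hVN hv), hVu v hv⟩
    rw [k2] at h8
    have hpj : 1 ≤ 2 ^ j := Nat.one_le_two_pow
    -- If `u` was raised to `j + 2`, its `8 * 2 ^ j = 2 * 2 ^ (j + 2)` members leave no slack, which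
    -- explains the constant 8. Otherwise its level is unchanged and its cluster has not shrunk.
    have hslack : 2 * 2 ^ s'.arr 6 u - s'.arr 2 u ≤ 2 * 2 ^ s.arr 6 u - s.arr 2 u := by
      rw [h5]
      rcases lt_or_ge (s.arr 6 u) (j + 2) with h | h
      · rw [hl, max_eq_right h.le, pow_add]
        omega
      · rw [hl, max_eq_left h]
        omega
    -- Some vertex was raised or moved, and its 6 spare units cover the two scans. Otherwise the
    -- cluster of `u` would be empty after a raise, or, without a raise, a vertex of `V` would have
    -- had the centre `u` of level at least `j + 2`.
    have hone : 1 ≤ m + r := by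
      by_contra hcon
      have hm : m = 0 := by omega
      have hr0 : r = 0 := by omega
      rw [hr] at hr0
      split_ifs at hr0 with h
      · omega
      · obtain ⟨v, hv⟩ : V.Nonempty := Finset.card_pos.mp (by omega)
        have := hVu v hv
        rw [h9 hm, k5] at this
        rw [hV, Finset.mem_filter, this] at hv
        omega
    have hbig : 2 ^ s'.arr 6 u ≤ s'.arr 2 u := by
      rw [h5]
      rcases lt_or_ge (s.arr 6 u) (j + 2) with h | h
      · rw [hl, max_eq_right h.le, pow_add]
        omega
      · rw [hl, max_eq_left h]
        have := (hI.clusters.big u hu (by simp)).resolve_left (by omega)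
        omega
    refine ⟨⟨⟨?_, h1.core.cnt⟩, h1.clusters.1, h1.clusters.2, h1.clusters.3, ?_⟩,
      (hk1.mono (l := [2, 5, 6, 7, 8, 10])).trans h2, ?_⟩
    · have hB := h1.core.toBase
      refine ⟨hB.1, hB.2, hB.3, hB.4, hB.5, ?_, hB.7⟩
      intro z hz k hk h _
      by_cases e : z * n + k = u * n + j
      · obtain ⟨rfl, rfl⟩ := idx_inj (by omega) (by omega) e
        -- Every vertex of `N u` now has level above `j`, so the popped counter is zero and its
        -- exemption can be dropped.
        exfalso
        rw [h1.core.cnt z hz k hk, Finset.filter_false_of_mem fun v hv => by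
          have := h6 v hv; omega] at h
        simp at h
      · exact h1.core.queue z hz k hk h (by simpa using e)
    · intro y hy _
      by_cases hyu : y = u
      · subst hyu; exact Or.inr hbig
      · exact h1.clusters.big y hy (by simpa using hyu)
    · have hps2 := potential_singleton (L := L) (φ := s'.arr 5) (lev := s'.arr 6)
        (sz := s'.arr 2) hu
      change s'.pot n L ∅ = s'.pot n L {u} + _ at hps2
      have hps2' := congrArg (120 * d * ·) hps2
      simp only [mul_add] at hps2'
      have hs1 := Nat.mul_le_mul_left (120 * d) (Nat.mul_le_mul_left 11 hslack)
      have hs2 := Nat.mul_le_mul_left (120 * d) (Nat.mul_le_mul_left 6 hone)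
      have hs3 : 120 * d * (6 * (m + r)) ≤ 120 * d * (6 * m) + 120 * d * (9 * r) := by
        rw [← mul_add]; exact Nat.mul_le_mul_left _ (by omega)
      omega


/-- Each pop releases 40 and `settle` never increases the total, so `40 * height + 120 * d *
potential` strictly decreases. This gives both termination and the time bound. The extra `10 * L` in
`hsp` is headroom for the stack inside `settle`. -/
theorem drain_run {n L d : ℕ} {N : ℕ → Finset ℕ} (hp : Params n L w) (hN : Nbhds n d N)
    (hI : Inv n L N ∅ ∅ s)
    (hsp : 40 * s.arr 10 0 + 120 * d * (s.pot n L ∅ + 10 * L) ≤ 2 ^ w) :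
    Run w drain s fun t s' => Inv n L N ∅ ∅ s' ∧ s'.arr 10 0 = 0 ∧
      Keeps 8 [2, 5, 6, 7, 8, 10] s s' ∧
      t + 120 * d * s'.pot n L ∅ ≤ 40 * s.arr 10 0 + 120 * d * s.pot n L ∅ + 3 := by
  have hW := hp.lt_word
  have hWn := hp.word
  have hLn := hp.le
  rw [mul_add] at hsp
  obtain ⟨m, hm⟩ : ∃ m, 40 * s.arr 10 0 + 120 * d * s.pot n L ∅ ≤ m := ⟨_, le_rfl⟩
  induction m using Nat.strong_induction_on generalizing s with
  | _ m ih =>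
  rcases Nat.eq_zero_or_pos (s.arr 10 0) with h0 | h0
  · refine Run.loopFalse (by simp) (by simp [h0]) ⟨hI, h0, Keeps.refl, ?_⟩
    simp
    omega
  · obtain ⟨z, hz, k, hk, hzk⟩ := hI.core.stack (s.arr 10 0 - 1) (by omega)
    have hkn : k < n := by omega
    have hix := idx_lt hz hkn
    have hmod : (z * n + k) % n = k := by
      rw [mul_comm, Nat.mul_add_mod, Nat.mod_eq_of_lt hkn]
    have hdiv : (z * n + k) / n = z := by
      rw [mul_comm, Nat.mul_add_div (by omega), Nat.div_eq_of_lt hkn, add_zero]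
    have hpow := hI.core.pow k hk
    have hpk := hp.pow_le' hk
    refine Run.loopTrue (by simp) (by simp; omega) ?_
    apply Run.seq
    refine Run.store (by simp) (by simp [hp.ne_zero]; omega) ?_
    obtain ⟨s1, hs1⟩ : ∃ s1, s1 = s.setArr 10 0 (s.arr 10 0 - 1) := ⟨_, rfl⟩
    simp only [Expr.val, BinOp.eval, ← hs1]
    have e10 : s1.arr 10 0 = s.arr 10 0 - 1 := by simp [hs1]
    have e8 : s1.arr 8 = s.arr 8 := by simp [hs1]
    have e3 : s1.reg 3 = n := by rw [hs1]; exact hI.core.n_eq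
    have epot : s1.pot n L ∅ = s.pot n L ∅ := by simp [hs1, State.pot]
    have eK : Keeps 8 [2, 5, 6, 7, 8, 10] s s1 := by rw [hs1]; exact Keeps.refl.setArr
    have e7 : s1.arr 7 = s.arr 7 := by simp [hs1]
    have e9 : s1.arr 9 = s.arr 9 := by simp [hs1]
    have hI1 : Inv n L N {z * n + k} ∅ s1 := by
      refine ⟨⟨⟨e3, by rw [hs1]; exact hI.core.L_eq, ?_, ?_, ?_, ?_, ?_⟩, ?_⟩, ?_, ?_, ?_, ?_⟩
      · rw [e9]; exact hI.core.pow
      · simpa [hs1] using hI.core.deg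
      · simpa [hs1] using hI.core.adj
      · intro z' hz' k' hk' h hX
        rw [e7] at h
        obtain ⟨p, hp1, hp2⟩ := hI.core.queue z' hz' k' hk' h (by simp)
        refine ⟨p, ?_, by rw [e8, hp2]⟩
        rw [e10]
        by_contra hcon
        have : p = s.arr 10 0 - 1 := by omega
        rw [this, hzk] at hp2
        exact hX (by simp [hp2])
      · intro p hp'
        rw [e8]
        exact hI.core.stack p (by omega)
      · simpa [hs1] using hI.core.cnt
      · simpa [hs1] using hI.clusters.mem
      · simpa [hs1] using hI.clusters.size
      · simpa [hs1] using hI.clusters.lev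
      · simpa [hs1] using hI.clusters.big
    apply Run.seq
    refine Run.assign (by simp) ?_
    simp only [Expr.val, e10, e8, hzk]
    refine Run.ite (by simp [e3, e9, hmod, hpow]; omega) ?_ ?_
    · intro hlt
      simp [e3, e9, e7, hmod, hpow] at hlt
      -- The entry is stale: its counter is below the bound, so forgetting it is harmless.
      have hI2 : Inv n L N ∅ ∅ (s1.setReg 8 (z * n + k)) := by
        refine ⟨⟨?_, hI1.core.cnt⟩, hI1.clusters.1, hI1.clusters.2, hI1.clusters.3, hI1.clusters.4⟩
        have hB : Base n L N {z * n + k} (s1.setReg 8 (z * n + k)) := hI1.core.toBase.setReg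
        refine ⟨hB.1, hB.2, hB.3, hB.4, hB.5, ?_, hB.7⟩
        intro z' hz' k' hk' h _
        by_cases e : z' * n + k' = z * n + k
        · obtain ⟨rfl, rfl⟩ := idx_inj (by omega) hkn e
          simp [e7] at h
          omega
        · exact hB.queue z' hz' k' hk' h (by simpa using e)
      apply Run.skip
      refine (ih (40 * (s1.arr 10 0) + 120 * d * s1.pot n L ∅) ?_ hI2 ?_ le_rfl).mono ?_
      · rw [e10, epot]; omega
      · show 40 * s1.arr 10 0 + (120 * d * s1.pot n L ∅ + _) ≤ _
        rw [e10, epot]; omega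
      · rintro t s' ⟨h1, h2, h3, h4⟩
        refine ⟨h1, h2, eK.trans h3.setReg_left, ?_⟩
        change _ ≤ 40 * s1.arr 10 0 + 120 * d * s1.pot n L ∅ + 3 at h4
        rw [e10, epot] at h4
        simp
        omega
    · intro hge
      simp [e3, e9, e7, hmod, hpow] at hge
      apply Run.seq
      refine Run.assign (by simp; omega) ?_
      apply Run.seq
      refine Run.assign (by simp; omega) ?_
      refine (settle_run (u := z) (j := k) (d := d) hp hN hI1.setReg.setReg.setReg hz hk
        (by simpa [e7] using hge) (by simp [e3, hdiv]) (by simp [e3, hmod]) ?_).mono ?_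
      · show 40 * s1.arr 10 0 + 120 * d * (s1.pot n L ∅ + _) ≤ _
        rw [mul_add, e10, epot]
        omega
      rintro t2 s2 ⟨c1, c2, c3⟩
      change _ ≤ 40 * s1.arr 10 0 + 120 * d * s1.pot n L ∅ at c3
      rw [e10, epot] at c3
      refine (ih (40 * (s2.arr 10 0) + 120 * d * s2.pot n L ∅) ?_ c1 ?_ le_rfl).mono ?_
      · omega
      · omega
      · rintro t s' ⟨h1, h2, h3, h4⟩
        have c2' := c2.mono (R := 8) (l := [2, 5, 6, 7, 8, 10])
        refine ⟨h1, h2, (eK.trans c2'.setReg_left.setReg_left.setReg_left).trans h3, ?_⟩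
        simp
        omega

/-! ### Inserting and deleting edges -/

/-- Append `r11` to the row of `r10`. -/
def addHalf : Cmd :=
  .seq (.store 3 (.op .add (.op .mul (%10) (%3)) (.get 4 (%10))) (%11)) <|
  .seq (.store 4 (%10) (.op .add (.get 4 (%10)) (#1))) <|
  .seq (.assign 12 (.get 6 (.get 5 (%11)))) <|
  forTo 12 (%4) (.seq (.assign 50 (.op .add (.op .mul (%10) (%3)) (%12)))
    (.seq (.assign 51 (%12)) bump))

/-- Remove `r11` from the row of `r10`. -/
def delHalf : Cmd :=
  .seq (.assign 12 (#0)) <|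
  .seq (.loop (.op .sub (#1) (.op .eq (.get 3 (.op .add (.op .mul (%10) (%3)) (%12))) (%11)))
    (.assign 12 (.op .add (%12) (#1)))) <|
  .seq (.store 4 (%10) (.op .sub (.get 4 (%10)) (#1))) <|
  .seq (.store 3 (.op .add (.op .mul (%10) (%3)) (%12))
    (.get 3 (.op .add (.op .mul (%10) (%3)) (.get 4 (%10))))) <|
  .seq (.assign 12 (.get 6 (.get 5 (%11)))) <|
  forTo 12 (%4) (.store 7 (.op .add (.op .mul (%10) (%3)) (%12))
    (.op .sub (.get 7 (.op .add (.op .mul (%10) (%3)) (%12))) (#1)))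

/-- Between the two halves of an insertion `N` is not symmetric, so only `N v ⊆ range n` is assumed.
The new neighbour counts exactly in the entries `k ≥ lv v` of row `u`; hence the cost is `O(L)`
whatever the degree. -/
theorem addHalf_run {n L u v : ℕ} {N : ℕ → Finset ℕ} {lv : ℕ → ℕ} {X : Finset ℕ}
    (hp : Params n L w) (hN : ∀ v, N v ⊆ Finset.range n) (hC : Core n L N lv X s) (hu : u < n)
    (hv : v < n) (hvu : v ∉ N u) (hlv : s.arr 6 (s.arr 5 v) = lv v) (hL : lv v < L)
    (h10 : s.reg 10 = u) (h11 : s.reg 11 = v) (hsp : 40 * s.arr 10 0 + 110 * L ≤ 2 ^ w) :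
    Run w addHalf s fun t s' => Core n L (Function.update N u (insert v (N u))) lv X s' ∧
      Keeps 10 [3, 4, 7, 8, 10] s s' ∧
      t + 40 * s'.arr 10 0 ≤ 40 * s.arr 10 0 + 110 * L := by
  have hW := hp.lt_word
  have hWn := hp.word
  have hLn := hp.le
  have hcard : (N u).card + 1 ≤ n := by
    rw [← Finset.card_insert_of_notMem hvu]
    simpa using Finset.card_le_card (Finset.insert_subset (by simpa using hv) (hN u))
  have hcn : ∀ z, (N z).card ≤ n := fun z => by simpa using Finset.card_le_card (hN z)
  have hdeg := hC.deg u hu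
  have hix := idx_lt hu (show (N u).card < n by omega)
  have hixL := idx_lt hu (show L - 1 < n by omega)
  apply Run.seq
  refine Run.store (by simp [h10, hC.n_eq, hdeg]; constructor <;> omega) (by simp) ?_
  apply Run.seq
  refine Run.store (by simp) (by simp [h10, hdeg, hp.ne_zero]; omega) ?_
  apply Run.seq
  refine Run.assign (by simp) ?_
  simp only [Expr.val, BinOp.eval, h10, h11, hC.n_eq, State.setArr_reg]
  obtain ⟨s1, hs1⟩ : ∃ s1, s1 = (((s.setArr 3 (u * n + s.arr 4 u) v).setArr 4 u
    ((s.setArr 3 (u * n + s.arr 4 u) v).arr 4 u + 1)).setReg 12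
      (((s.setArr 3 (u * n + s.arr 4 u) v).setArr 4 u
    ((s.setArr 3 (u * n + s.arr 4 u) v).arr 4 u + 1)).arr 6 (((s.setArr 3 (u * n + s.arr 4 u) v).setArr 4 u
    ((s.setArr 3 (u * n + s.arr 4 u) v).arr 4 u + 1)).arr 5 v))) := ⟨_, rfl⟩
  rw [← hs1]
  have eK : Keeps 10 [3, 4, 7, 8, 10] s s1 := by
    rw [hs1]; exact Keeps.refl.setArr.setArr.setReg
  have e12 : s1.reg 12 = lv v := by rw [hs1]; simp [hlv]
  have e10 : s1.reg 10 = u := by rw [hs1]; simp [h10]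
  have e3 : s1.arr 3 = Function.update (s.arr 3) (u * n + (N u).card) v := by simp [hs1, hdeg]
  have e4 : s1.arr 4 = Function.update (s.arr 4) u ((N u).card + 1) := by simp [hs1, hdeg]
  have e7 : s1.arr 7 = s.arr 7 := by simp [hs1]
  have e8 : s1.arr 8 = s.arr 8 := by simp [hs1]
  have e9 : s1.arr 9 = s.arr 9 := by simp [hs1]
  have e10' : s1.arr 10 = s.arr 10 := by simp [hs1]
  have hB1 : Base n L (Function.update N u (insert v (N u))) X s1 := by
    refine ⟨by rw [hs1]; simpa using hC.n_eq, by rw [hs1]; simpa using hC.L_eq, ?_, ?_, ?_, ?_, ?_⟩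
    · rw [e9]; exact hC.pow
    · intro z hz
      rw [e4]
      by_cases h : z = u
      · subst h; simp [Finset.card_insert_of_notMem hvu]
      · simpa [h] using hC.deg z hz
    · intro z hz
      rw [e3]
      by_cases h : z = u
      · subst h
        rw [Function.update_self, Finset.card_insert_of_notMem hvu, Finset.range_add_one,
          Finset.image_insert, Function.update_self]
        congr 1
        conv_rhs => rw [← hC.adj z hz]
        apply Finset.image_congr
        intro i hi
        simp at hi
        simp [hi.ne]
      · rw [Function.update_of_ne h]
        conv_rhs => rw [← hC.adj z hz]
        apply Finset.image_congr
        intro i hi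
        simp at hi
        beta_reduce
        rw [Function.update_of_ne]
        intro e
        have := hcn z
        exact h (idx_inj (by omega) (by omega) e).1
    · rw [e7, e8, e10']; exact hC.queue
    · rw [e8, e10']; exact hC.stack
  refine Run.forTo (lv v) L
    (fun k T s' => Base n L (Function.update N u (insert v (N u))) X s' ∧
      Keeps 10 [3, 4, 7, 8, 10] s s' ∧ s'.reg 10 = u ∧
      (∀ z < n, ∀ k' < L, s'.arr 7 (z * n + k') =
        s.arr 7 (z * n + k') + if z = u ∧ lv v ≤ k' ∧ k' < k then 1 else 0) ∧
      T + 40 * s'.arr 10 0 ≤ 40 * s.arr 10 0 + 80 * (k - lv v)) hL.le e12 ?_ (by omega) ?_ ?_ ?_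
  · refine ⟨hB1, eK, e10, ?_, by rw [e10']; omega⟩
    intro z hz k' hk'
    rw [e7, if_neg (by omega), add_zero]
  · rintro k T s' - - - ⟨h, -⟩
    simp [h.L_eq]
  · rintro k T s' hk1 hk2 hr ⟨h1, h2, h3, h4, h5⟩
    have hixk := idx_lt hu (show k < n by omega)
    have hcnt : s'.arr 7 (u * n + k) ≤ n := by
      rw [h4 u hu k hk2, hC.cnt u hu k hk2, if_neg (by omega)]
      exact (Finset.card_filter_le _ _).trans (hcn u)
    apply Run.seq
    refine Run.assign (by simp [hr, h1.n_eq, h3]; constructor <;> omega) ?_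
    apply Run.seq
    refine Run.assign (by simp) ?_
    refine (bump_run (z := u) (k := k) hp (h1.setReg.setReg) hu hk2 (by simp [hr, h1.n_eq, h3])
      (by simp [hr]) (by simp; omega) (by simpa using hcnt)).mono ?_
    rintro t s2 ⟨b1, b2, b3, b4⟩
    simp only [State.setReg_arr] at b2 b4
    have b3' := b3.setReg_left.setReg_left
    refine ⟨by rw [b3'.1 12 (by norm_num), hr], b1.setReg, (h2.trans b3').setReg, ?_, ?_, ?_⟩
    · simp [b3'.1 10 (by norm_num), h3]
    · intro z hz k' hk'
      simp only [State.setReg_arr, b2]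
      by_cases e : z * n + k' = u * n + k
      · obtain ⟨rfl, rfl⟩ := idx_inj (by omega) (by omega) e
        rw [Function.update_self, h4 z hz k' hk', if_neg (by omega), if_pos (by omega)]
      · rw [Function.update_of_ne e, h4 z hz k' hk']
        have : ¬ (z = u ∧ k' = k) := by rintro ⟨rfl, rfl⟩; exact e rfl
        congr 1
        apply if_congr _ rfl rfl
        constructor <;> intro h <;> refine ⟨h.1, h.2.1, ?_⟩
        · omega
        · have := h.1
          omega
    · simp
      omega
  · rintro T s' ⟨h1, h2, h3, h4, h5⟩ _
    refine ⟨⟨h1, ?_⟩, h2, by simp; omega⟩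
    intro z hz k hk
    rw [h4 z hz k hk, hC.cnt z hz k hk]
    by_cases h : z = u
    · subst h
      rw [Function.update_self, Finset.filter_insert]
      by_cases hle : lv v ≤ k
      · rw [if_pos hle, if_pos ⟨rfl, hle, hk⟩, Finset.card_insert_of_notMem (by simp [hvu])]
      · rw [if_neg hle, if_neg (by omega), add_zero]
    · rw [Function.update_of_ne h, if_neg (by omega), add_zero]

/-- The entry is found by a linear search, which costs the degree, and replaced by the last entry of
the row. Counters only decrease, so nothing is pushed. -/
theorem delHalf_run {n L d u v : ℕ} {N : ℕ → Finset ℕ} {lv : ℕ → ℕ} {X : Finset ℕ}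
    (hp : Params n L w) (hN : ∀ v, N v ⊆ Finset.range n) (hC : Core n L N lv X s) (hu : u < n)
    (hvu : v ∈ N u) (hd : (N u).card ≤ d) (hlv : s.arr 6 (s.arr 5 v) = lv v)
    (hL : lv v < L) (h10 : s.reg 10 = u) (h11 : s.reg 11 = v) :
    Run w delHalf s fun t s' => Core n L (Function.update N u ((N u).erase v)) lv X s' ∧
      Keeps 10 [3, 4, 7] s s' ∧ t ≤ 20 * d + 80 * L := by
  have hW := hp.lt_word
  have hWn := hp.word
  have hLn := hp.le
  have hcn : ∀ z, (N z).card ≤ n := fun z => by simpa using Finset.card_le_card (hN z)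
  have hdeg := hC.deg u hu
  have hinj : Set.InjOn (fun i => s.arr 3 (u * n + i)) (Finset.range (N u).card) := by
    apply Finset.card_image_iff.mp
    rw [hC.adj u hu, Finset.card_range]
  obtain ⟨i, hi, hiv⟩ : ∃ i < (N u).card, s.arr 3 (u * n + i) = v := by
    have := hvu
    rw [← hC.adj u hu] at this
    simpa using this
  have hcu := hcn u
  apply Run.seq
  refine Run.assign (by simp) ?_
  apply Run.seq
  have search : ∀ j k, k + j = i → Run w
      (.loop (.op .sub (#1) (.op .eq (.get 3 (.op .add (.op .mul (%10) (%3)) (%12))) (%11)))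
        (.assign 12 (.op .add (%12) (#1)))) (s.setReg 12 k)
      fun t s' => s' = s.setReg 12 i ∧ t ≤ 15 * j + 11 := by
    intro j
    induction j with
    | zero =>
      intro k hk
      have hixk := idx_lt hu (show k < n by omega)
      refine Run.loopFalse (by simp [hp.ne_zero, h10, hC.n_eq]; constructor <;> omega) ?_ ?_
      · simp [h10, h11, hC.n_eq, show k = i by omega, hiv]
      · simp [show k = i by omega]
    | succ j ih =>
      intro k hk
      have hixk := idx_lt hu (show k < n by omega)
      refine Run.loopTrue (by simp [hp.ne_zero, h10, hC.n_eq]; constructor <;> omega) ?_ ?_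
      · have : s.arr 3 (u * n + k) ≠ v := by
          intro e
          have := hinj (x₁ := k) (x₂ := i) (by simp; omega) (by simpa using hi) (e.trans hiv.symm)
          omega
        simp [h10, h11, hC.n_eq, this]
      · refine Run.assign (by simp [hp.ne_zero]; omega) ?_
        have : (s.setReg 12 k).setReg 12 ((%12).val (s.setReg 12 k) + 1) = s.setReg 12 (k + 1) := by
          simp [State.setReg]
        simp only [Expr.val, BinOp.eval] at this ⊢
        rw [this]
        refine (ih (k + 1) (by omega)).mono ?_
        rintro t s' ⟨h1, h2⟩
        refine ⟨h1, ?_⟩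
        simp
        omega
  refine (search i 0 (by omega)).mono ?_
  rintro t1 s1 ⟨hs1, ht1⟩
  rw [hs1]
  have hixc := idx_lt hu (show (N u).card - 1 < n by omega)
  have hixi := idx_lt hu (show i < n by omega)
  apply Run.seq
  refine Run.store (by simp) (by simp [h10, hdeg, hp.ne_zero]; omega) ?_
  apply Run.seq
  refine Run.store (by simp [h10, hC.n_eq]; constructor <;> omega)
    (by simp [h10, hC.n_eq, hdeg]; constructor <;> omega) ?_
  apply Run.seq
  refine Run.assign (by simp) ?_
  simp only [Expr.val, BinOp.eval]
  obtain ⟨s2, hs2⟩ : ∃ s2, s2 = ((((s.setReg 12 i).setArr 4 u ((N u).card - 1)).setArr 3 (u * n + i)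
    (s.arr 3 (u * n + ((N u).card - 1)))).setReg 12 (lv v)) := ⟨_, rfl⟩
  have hs2' : ∀ s', s' = s2 → Run w (forTo 12 (%4)
      (.store 7 (.op .add (.op .mul (%10) (%3)) (%12))
        (.op .sub (.get 7 (.op .add (.op .mul (%10) (%3)) (%12))) (#1)))) s'
      fun t s' => Core n L (Function.update N u ((N u).erase v)) lv X s' ∧
        Keeps 10 [3, 4, 7] s s' ∧ t ≤ 30 * L + 5 := by
    intro s' hs'
    rw [hs']
    have eK : Keeps 10 [3, 4, 7] s s2 := by
      rw [hs2]; exact Keeps.refl.setReg.setArr.setArr.setReg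
    have e12 : s2.reg 12 = lv v := by rw [hs2]; simp
    have e10 : s2.reg 10 = u := by rw [hs2]; simp [h10]
    have e3 : s2.arr 3 = Function.update (s.arr 3) (u * n + i)
      (s.arr 3 (u * n + ((N u).card - 1))) := by simp [hs2]
    have e4 : s2.arr 4 = Function.update (s.arr 4) u ((N u).card - 1) := by simp [hs2]
    have e7 : s2.arr 7 = s.arr 7 := by simp [hs2]
    have e8 : s2.arr 8 = s.arr 8 := by simp [hs2]
    have e9 : s2.arr 9 = s.arr 9 := by simp [hs2]
    have e10' : s2.arr 10 = s.arr 10 := by simp [hs2]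
    have hB2 : Base n L (Function.update N u ((N u).erase v)) X s2 := by
      refine ⟨by rw [hs2]; simpa using hC.n_eq, by rw [hs2]; simpa using hC.L_eq, ?_, ?_, ?_, ?_, ?_⟩
      · rw [e9]; exact hC.pow
      · intro z hz
        rw [e4]
        by_cases h : z = u
        · subst h; simp [Finset.card_erase_of_mem hvu]
        · simpa [h] using hC.deg z hz
      · intro z hz
        rw [e3]
        by_cases h : z = u
        · subst h
          rw [Function.update_self, Finset.card_erase_of_mem hvu]
          ext y
          rw [Finset.mem_erase]
          constructor
          · intro hy
            obtain ⟨k, hk, hky⟩ := Finset.mem_image.mp hy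
            simp at hk
            have hmem : ∀ k < (N z).card, s.arr 3 (z * n + k) ∈ N z := fun k hk => by
              rw [← hC.adj z hz]
              exact Finset.mem_image.mpr ⟨k, by simpa using hk, rfl⟩
            by_cases hki : k = i
            · subst hki
              rw [Function.update_self] at hky
              subst hky
              -- Cell `k = i` now holds the former last entry. As `i` is within the shortened row,
              -- that entry came from another index and differs from `v`.
              refine ⟨fun e => ?_, hmem _ (by omega)⟩
              have := hinj (x₁ := (N z).card - 1) (x₂ := k) (Finset.mem_coe.mpr (Finset.mem_range.mpr (by omega)))
                (by simpa using hi)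
                (e.trans hiv.symm)
              omega
            · rw [Function.update_of_ne (by omega)] at hky
              subst hky
              refine ⟨fun e => hki ?_, hmem _ (by omega)⟩
              exact hinj (by simp; omega) (by simpa using hi) (e.trans hiv.symm)
          · rintro ⟨hyv, hy⟩
            rw [← hC.adj z hz] at hy
            obtain ⟨k, hk, hky⟩ := Finset.mem_image.mp hy
            simp at hk
            have hki : k ≠ i := by rintro rfl; exact hyv (hky.symm.trans hiv)
            by_cases hkl : k = (N z).card - 1
            · exact Finset.mem_image.mpr ⟨i, by simp; omega, by
                rw [Function.update_self, ← hkl, hky]⟩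
            · exact Finset.mem_image.mpr ⟨k, by simp; omega, by
                rw [Function.update_of_ne (by omega), hky]⟩
        · rw [Function.update_of_ne h]
          conv_rhs => rw [← hC.adj z hz]
          apply Finset.image_congr
          intro k hk
          simp at hk
          beta_reduce
          rw [Function.update_of_ne]
          intro e
          have := hcn z
          exact h (idx_inj (by omega) (by omega) e).1
      · rw [e7, e8, e10']; exact hC.queue
      · rw [e8, e10']; exact hC.stack
    refine Run.forTo (lv v) L
      (fun k T s' => Base n L (Function.update N u ((N u).erase v)) X s' ∧
        Keeps 10 [3, 4, 7] s s' ∧ s'.reg 10 = u ∧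
        (∀ z < n, ∀ k' < L, s'.arr 7 (z * n + k') =
          s.arr 7 (z * n + k') - if z = u ∧ lv v ≤ k' ∧ k' < k then 1 else 0) ∧
        T ≤ 30 * (k - lv v)) hL.le e12 ?_ (by omega) ?_ ?_ ?_
    · refine ⟨hB2, eK, e10, ?_, by omega⟩
      intro z hz k' hk'
      rw [e7, if_neg (by omega), Nat.sub_zero]
    · rintro k T s' - - - ⟨h, -⟩
      simp [h.L_eq]
    · rintro k T s' hk1 hk2 hr ⟨h1, h2, h3, h4, h5⟩
      have hixk := idx_lt hu (show k < n by omega)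
      have hcnt : s'.arr 7 (u * n + k) ≤ n := by
        rw [h4 u hu k hk2, hC.cnt u hu k hk2, if_neg (by omega)]
        exact (Finset.card_filter_le _ _).trans (hcn u)
      have h4' : ∀ z < n, ∀ k' < L, Function.update (s'.arr 7) (u * n + k)
          (s'.arr 7 (u * n + k) - 1) (z * n + k') =
          s.arr 7 (z * n + k') - if z = u ∧ lv v ≤ k' ∧ k' < k + 1 then 1 else 0 := by
        intro z hz k' hk'
        by_cases e : z * n + k' = u * n + k
        · obtain ⟨rfl, rfl⟩ := idx_inj (by omega) (by omega) e
          rw [Function.update_self, h4 z hz k' hk', if_neg (by omega), if_pos (by omega)]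
          rfl
        · rw [Function.update_of_ne e, h4 z hz k' hk']
          have : ¬ (z = u ∧ k' = k) := by rintro ⟨rfl, rfl⟩; exact e rfl
          congr 1
          apply if_congr _ rfl rfl
          constructor <;> intro h <;> refine ⟨h.1, h.2.1, ?_⟩
          · omega
          · have := h.1
            omega
      refine Run.store (by simp [hr, h1.n_eq, h3]; constructor <;> omega)
        (by simp [hr, h1.n_eq, h3, hp.ne_zero]; refine ⟨⟨?_, ?_⟩, ?_⟩ <;> omega) ?_
      simp only [Expr.val, BinOp.eval, hr, h1.n_eq, h3]
      refine ⟨hr, ?_, h2.setArr.setReg, by simp [h3], by simpa using h4', ?_⟩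
      · refine ⟨by simpa using h1.n_eq, by simpa using h1.L_eq, ?_, ?_, ?_, ?_, ?_⟩
        · simpa using h1.pow
        · simpa using h1.deg
        · simpa using h1.adj
        · intro z hz k' hk' h hX
          simp at h ⊢
          refine h1.queue z hz k' hk' (h.trans ?_) hX
          simp only [Function.update_apply]
          split
          · simp [*]
          · exact le_rfl
        · simpa using h1.stack
      · simp
        omega
    · rintro T s' ⟨h1, h2, h3, h4, h5⟩ _
      refine ⟨⟨h1, ?_⟩, h2, by simp; omega⟩
      intro z hz k hk
      rw [h4 z hz k hk, hC.cnt z hz k hk]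
      by_cases h : z = u
      · subst h
        rw [Function.update_self, Finset.filter_erase]
        by_cases hle : lv v ≤ k
        · rw [if_pos ⟨rfl, hle, hk⟩, Finset.card_erase_of_mem (by simp [hvu, hle])]
        · rw [if_neg (by omega), Finset.erase_eq_of_notMem (by simp [hle]), Nat.sub_zero]
      · rw [Function.update_of_ne h, if_neg (by omega), Nat.sub_zero]
  refine (hs2' _ ?_).mono ?_
  · rw [hs2]
    simp [h10, h11, hC.n_eq, hdeg, hlv]
  · rintro t s' ⟨h1, h2, h3⟩
    refine ⟨h1, h2, ?_⟩
    have := hp.pos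
    have : 1 ≤ d := by omega
    simp
    omega


/-- Insert the edge between `r1` and `r2`. -/
def addEdge : Cmd :=
  .seq (.assign 10 (%1)) <| .seq (.assign 11 (%2)) <| .seq addHalf <|
  .seq (.assign 10 (%2)) <| .seq (.assign 11 (%1)) addHalf

/-- If the centre of the vertex `ra` is `rb`, move the vertex to its own cluster. -/
def evict (a b : ℕ) : Cmd :=
  .ite (.op .eq (.get 5 (%a)) (%b)) (.seq (.assign 15 (%a)) (.seq (.assign 16 (%a)) move)) .skip

/-- Delete the edge between `r1` and `r2`. -/
def delEdge : Cmd :=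
  .seq (evict 2 1) <| .seq (evict 1 2) <|
  .seq (.assign 10 (%1)) <| .seq (.assign 11 (%2)) <| .seq delHalf <|
  .seq (.assign 10 (%2)) <| .seq (.assign 11 (%1)) delHalf

/-- The program run at an update. -/
def updateCmd : Cmd := .seq (.ite (%0) addEdge delEdge) drain

/-- Closed neighbourhoods after the insertion of an edge. -/
def addNb (N : ℕ → Finset ℕ) (u v : ℕ) : ℕ → Finset ℕ :=
  Function.update (Function.update N u (insert v (N u))) v (insert u (N v))

/-- Closed neighbourhoods after the deletion of an edge. -/
def delNb (N : ℕ → Finset ℕ) (u v : ℕ) : ℕ → Finset ℕ :=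
  Function.update (Function.update N u ((N u).erase v)) v ((N v).erase u)

theorem mem_addNb {N : ℕ → Finset ℕ} {u v x y : ℕ} (huv : u ≠ v) :
    x ∈ addNb N u v y ↔ x ∈ N y ∨ (y = u ∧ x = v) ∨ (y = v ∧ x = u) := by
  unfold addNb
  by_cases h : y = v
  · subst h
    simp [huv.symm, or_comm]
  · by_cases h' : y = u
    · subst h'
      simp [huv, or_comm]
    · simp [h, h']

theorem mem_delNb {N : ℕ → Finset ℕ} {u v x y : ℕ} (huv : u ≠ v) :
    x ∈ delNb N u v y ↔ x ∈ N y ∧ ¬ ((y = u ∧ x = v) ∨ (y = v ∧ x = u)) := by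
  unfold delNb
  by_cases h : y = v
  · subst h
    simp [huv.symm, and_comm]
  · by_cases h' : y = u
    · subst h'
      simp [huv, and_comm]
    · simp [h, h']

/-- No centre, level or cluster changes, so the potential does not either; counters that reach their
bound are merely queued. -/
theorem addEdge_run {n L u v : ℕ} {N : ℕ → Finset ℕ} (hp : Params n L w)
    (hN : ∀ v, N v ⊆ Finset.range n) (hI : Inv n L N ∅ ∅ s) (hu : u < n) (hv : v < n)
    (huv : u ≠ v) (hvu : v ∉ N u) (huv' : u ∉ N v) (h1 : s.reg 1 = u) (h2 : s.reg 2 = v)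
    (hsp : 40 * s.arr 10 0 + 220 * L ≤ 2 ^ w) :
    Run w addEdge s fun t s' => Inv n L (addNb N u v) ∅ ∅ s' ∧ Keeps 10 [3, 4, 7, 8, 10] s s' ∧
      t + 40 * s'.arr 10 0 ≤ 40 * s.arr 10 0 + 230 * L := by
  obtain ⟨hC, hK⟩ := hI
  have hL := hp.pos
  have hlev : ∀ y < n, s.arr 6 (s.arr 5 y) < L := fun y hy =>
    hK.lev _ (by simpa using hN y (hK.mem y hy))
  apply Run.seq
  refine Run.assign (by simp) ?_
  apply Run.seq
  refine Run.assign (by simp) ?_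
  apply Run.seq
  refine (addHalf_run hp hN hC.setReg.setReg hu hv hvu rfl (hlev v hv) (by simp [h1]) (by simp [h2])
    (by simp; omega)).mono ?_
  rintro t1 s1 ⟨a1, a2, a3⟩
  have a2' := a2.setReg_left.setReg_left
  simp only [State.setReg_arr] at a3
  apply Run.seq
  refine Run.assign (by simp) ?_
  apply Run.seq
  refine Run.assign (by simp) ?_
  refine (addHalf_run hp ?_ a1.setReg.setReg hv hu ?_ ?_ (hlev u hu) ?_ ?_ ?_).mono ?_
  · intro y
    by_cases h : y = u
    · subst h
      simpa using Finset.insert_subset (by simpa using hv) (hN y)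
    · simpa [h] using hN y
  · simpa [huv.symm] using huv'
  · simp only [State.setReg_arr]
    rw [a2'.2 5 (by decide), a2'.2 6 (by decide)]
  · simp [a2'.1 2 (by norm_num), h2]
  · simp [a2'.1 1 (by norm_num), h1]
  · simp; omega
  rintro t2 s2 ⟨b1, b2, b3⟩
  simp only [State.setReg_arr] at b3
  have b2' := a2'.trans b2.setReg_left.setReg_left
  have e5 := b2'.2 5 (by decide)
  have e6 := b2'.2 6 (by decide)
  have e2 := b2'.2 2 (by decide)
  have hNN : Function.update (Function.update N u (insert v (N u))) v
      (insert u (Function.update N u (insert v (N u)) v)) = addNb N u v := by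
    simp [addNb, huv.symm]
  rw [hNN] at b1
  refine ⟨⟨?_, ?_, ?_, ?_, ?_⟩, b2', ?_⟩
  · rw [e5, e6]; exact b1
  · intro y hy
    rw [e5, mem_addNb huv]
    exact Or.inl (hK.mem y hy)
  · rw [e5, e2]; exact hK.size
  · rw [e6]; exact hK.lev
  · rw [e6, e2]; exact hK.big
  · simp
    omega

/-- A vertex may always be its own centre. It may lose up to `L` levels, so `23 = 10 + 12 + 1` units
per level cover the potential, the constant 12 of `move_run` and the level changes. -/
theorem evict_run {n L d u v a b : ℕ} {N : ℕ → Finset ℕ} (hp : Params n L w) (hN : Nbhds n d N)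
    (hI : Inv n L N ∅ ∅ s) (ha : a < 10) (hv : v < n) (huv : u ≠ v)
    (h1 : s.reg a = v) (h2 : s.reg b = u)
    (hsp : 40 * s.arr 10 0 + 120 * d * (s.pot n L ∅ + 23 * L) ≤ 2 ^ w) :
    Run w (evict a b) s fun t s' => Inv n L N ∅ ∅ s' ∧ Keeps 10 [2, 5, 6, 7, 8, 10] s s' ∧
      s'.arr 5 v ≠ u ∧ (∀ y ≠ v, s'.arr 5 y = s.arr 5 y) ∧
      t + 40 * s'.arr 10 0 + 120 * d * s'.pot n L ∅ ≤
        40 * s.arr 10 0 + 120 * d * (s.pot n L ∅ + 23 * L) + 10 := by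
  have hL := hp.pos
  refine Run.ite (by simp) ?_ ?_
  · intro hc
    simp [h1, h2] at hc
    have hun : u < n := by simpa [hc] using hN.sub v (hI.clusters.mem v hv)
    have l1 := hI.clusters.lev u hun
    have l2 := hI.clusters.lev v hv
    have hle : 10 * s.arr 6 u + 12 + ((s.arr 6 u - s.arr 6 v) + (s.arr 6 v - s.arr 6 u)) ≤
        23 * L := by omega
    have hle' := Nat.mul_le_mul_left (120 * d) hle
    simp only [mul_add] at hle' hsp
    have ha' : a ≠ 15 := by omega
    apply Run.seq
    refine Run.assign (by simp) ?_
    apply Run.seq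
    refine Run.assign (by simp) ?_
    refine (move_run (v := v) (u := v) (d := d) hp hN hI.setReg.setReg hv (hN.self v hv)
      (by simpa [hc] using huv) (by simp) (by simp [h1]) (by simp [h1, ha']) ?_).mono ?_
    · simp only [State.setReg_arr, State.pot, hc, mul_add] at hsp ⊢
      omega
    rintro t s' ⟨c1, c2, c3, c4, c5, c6, c7⟩
    simp only [State.setReg_arr, State.pot, hc, mul_add] at c2 c7
    refine ⟨c1, c6.setReg_left.setReg_left.mono, by simpa [c2] using huv.symm,
      fun y hy => by simp [c2, hy], ?_⟩
    simp only [State.pot, mul_add]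
    simp
    omega
  · intro hc
    simp [h1, h2] at hc
    refine Run.skip ⟨hI, Keeps.refl, hc, fun _ _ => rfl, ?_⟩
    rw [mul_add]
    simp
    omega

/-- Assignments running along the edge must go before it is deleted. Two evictions take `46 * L`
units; the other `4 * L` pay for the two row deletions. -/
theorem delEdge_run {n L d u v : ℕ} {N : ℕ → Finset ℕ} (hp : Params n L w) (hN : Nbhds n d N)
    (hI : Inv n L N ∅ ∅ s) (hu : u < n) (hv : v < n) (huv : u ≠ v) (hvu : v ∈ N u)
    (h1 : s.reg 1 = u) (h2 : s.reg 2 = v)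
    (hsp : 40 * s.arr 10 0 + 120 * d * (s.pot n L ∅ + 50 * L) ≤ 2 ^ w) :
    Run w delEdge s fun t s' => Inv n L (delNb N u v) ∅ ∅ s' ∧
      Keeps 10 [2, 3, 4, 5, 6, 7, 8, 10] s s' ∧
      t + 40 * s'.arr 10 0 + 120 * d * s'.pot n L ∅ ≤
        40 * s.arr 10 0 + 120 * d * (s.pot n L ∅ + 50 * L) := by
  have hL := hp.pos
  have hd : 1 ≤ d := (Finset.card_pos.mpr ⟨v, hN.self v hv⟩).trans_le (hN.card v)
  have hdL : 120 * d * (23 * L) + 120 * d * (23 * L) + 480 * (d * L) =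
      120 * d * (50 * L) := by ring
  have hd1 : d ≤ d * L := Nat.le_mul_of_pos_right _ hL
  have hL1 : L ≤ d * L := Nat.le_mul_of_pos_left _ hd
  simp only [mul_add] at hsp ⊢
  apply Run.seq
  refine (evict_run (u := u) (v := v) (d := d) hp hN hI (by norm_num) hv huv h2 h1
    (by rw [mul_add]; omega)).mono ?_
  rintro t1 s1 ⟨a1, a2, a3, a4, a5⟩
  rw [mul_add] at a5
  apply Run.seq
  refine (evict_run (u := v) (v := u) (d := d) hp hN a1 (by norm_num) hu huv.symm
    (by rw [a2.1 1 (by norm_num), h1]) (by rw [a2.1 2 (by norm_num), h2])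
    (by rw [mul_add]; omega)).mono ?_
  rintro t2 s2 ⟨b1, b2, b3, b4, b5⟩
  rw [mul_add] at b5
  -- The second eviction reassigns only `u`, so the outcome of the first persists.
  have b3' : s2.arr 5 v ≠ u := by rw [b4 v huv.symm]; exact a3
  have eK := a2.trans b2
  obtain ⟨hC, hK⟩ := b1
  have hlev : ∀ y < n, s2.arr 6 (s2.arr 5 y) < L := fun y hy =>
    hK.lev _ (by simpa using hN.sub y (hK.mem y hy))
  apply Run.seq
  refine Run.assign (by simp) ?_
  apply Run.seq
  refine Run.assign (by simp) ?_
  apply Run.seq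
  refine (delHalf_run (u := u) (v := v) hp hN.sub hC.setReg.setReg hu hvu (hN.card u) rfl
    (hlev v hv) (by simp [eK.1 1 (by norm_num), h1]) (by simp [eK.1 2 (by norm_num), h2])).mono ?_
  rintro t3 s3 ⟨c1, c2, c3⟩
  have c2' := c2.setReg_left.setReg_left
  apply Run.seq
  refine Run.assign (by simp) ?_
  apply Run.seq
  refine Run.assign (by simp) ?_
  refine (delHalf_run (u := v) (v := u) (d := d) hp ?_ c1.setReg.setReg hv ?_ ?_ ?_ (hlev u hu) ?_
    ?_).mono ?_
  · intro y
    by_cases h : y = u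
    · subst h
      simpa using (Finset.erase_subset _ _).trans (hN.sub y)
    · simpa [h] using hN.sub y
  · simpa [huv.symm] using hN.symm _ _ hvu
  · simpa [huv.symm] using hN.card v
  · simp only [State.setReg_arr]
    rw [c2'.2 5 (by decide), c2'.2 6 (by decide)]
  · simp [c2'.1 2 (by norm_num), eK.1 2 (by norm_num), h2]
  · simp [c2'.1 1 (by norm_num), eK.1 1 (by norm_num), h1]
  rintro t4 s4 ⟨d1, d2, d3⟩
  have d2' := c2'.trans d2.setReg_left.setReg_left
  have e5 := d2'.2 5 (by decide)
  have e6 := d2'.2 6 (by decide)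
  have e2 := d2'.2 2 (by decide)
  have e10 := d2'.2 10 (by decide)
  have hNN : Function.update (Function.update N u ((N u).erase v)) v
      ((Function.update N u ((N u).erase v) v).erase u) = delNb N u v := by
    simp [delNb, huv.symm]
  rw [hNN] at d1
  refine ⟨⟨?_, ?_, ?_, ?_, ?_⟩, (eK.mono (l := [2, 3, 4, 5, 6, 7, 8, 10])).trans d2', ?_⟩
  · rw [e5, e6]; exact d1
  · intro y hy
    rw [e5, mem_delNb huv]
    refine ⟨hK.mem y hy, ?_⟩
    rintro (⟨rfl, h⟩ | ⟨rfl, h⟩)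
    · exact b3 h
    · exact b3' h
  · rw [e5, e2]; exact hK.size
  · rw [e6]; exact hK.lev
  · rw [e6, e2]; exact hK.big
  · simp only [State.pot, e5, e6, e2, e10] at b5 a5 ⊢
    simp
    omega

/-- A crude bound, `10 * n * n + 11 * n * (2 * n)`, needed only to fit the computation into the word
length. -/
theorem Inv.pot_le {n L : ℕ} {N : ℕ → Finset ℕ} {X : Finset ℕ} (hp : Params n L w)
    (hI : Inv n L N X ∅ s) : s.pot n L ∅ ≤ 32 * (n * n) := by
  have h1 : ∑ v ∈ Finset.range n, (L - s.arr 6 (s.arr 5 v)) ≤ n * n := by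
    have := Finset.sum_le_card_nsmul (Finset.range n) (fun v => L - s.arr 6 (s.arr 5 v)) n
      fun v _ => (Nat.sub_le _ _).trans hp.le
    simpa using this
  have h2 : ∑ u ∈ Finset.range n \ ∅, (2 * 2 ^ s.arr 6 u - s.arr 2 u) ≤ n * (2 * n) := by
    rw [Finset.sdiff_empty]
    have := Finset.sum_le_card_nsmul (Finset.range n) (fun u => 2 * 2 ^ s.arr 6 u - s.arr 2 u)
      (2 * n) fun u hu => (Nat.sub_le _ _).trans
        (Nat.mul_le_mul_left 2 (hp.pow_le' (hI.clusters.lev u (by simpa using hu))))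
    simpa using this
  unfold State.pot potential
  nlinarith

/-- An update: `ins` tells whether an edge is inserted. -/
theorem updateCmd_run {n L d u v : ℕ} {N N' : ℕ → Finset ℕ} (hp : Params n L w)
    (hN : Nbhds n d N) (hN' : Nbhds n d N') (hW : 120 * d * (32 * (n * n) + 70 * L) ≤ 2 ^ w)
    (hI : Inv n L N ∅ ∅ s) (h0 : s.arr 10 0 = 0) (hu : u < n) (hv : v < n) (huv : u ≠ v)
    (h1 : s.reg 1 = u) (h2 : s.reg 2 = v)
    (hins : s.reg 0 ≠ 0 → v ∉ N u ∧ N' = addNb N u v)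
    (hdel : s.reg 0 = 0 → v ∈ N u ∧ N' = delNb N u v) :
    Run w updateCmd s fun t s' => Inv n L N' ∅ ∅ s' ∧ s'.arr 10 0 = 0 ∧
      t + 120 * d * s'.pot n L ∅ ≤ 120 * d * s.pot n L ∅ + 7200 * (d * L) := by
  have hL := hp.pos
  have hd : 1 ≤ d := (Finset.card_pos.mpr ⟨v, hN.self v hv⟩).trans_le (hN.card v)
  have hL1 : L ≤ d * L := Nat.le_mul_of_pos_left _ hd
  have hpot := Nat.mul_le_mul_left (120 * d) (hI.pot_le hp)
  have e1 : 120 * d * (70 * L) = 8400 * (d * L) := by ring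
  have e2 : 120 * d * (50 * L) = 6000 * (d * L) := by ring
  have e3 : 120 * d * (10 * L) = 1200 * (d * L) := by ring
  rw [mul_add, e1] at hW
  apply Run.seq
  have hmain : Run w (.ite (%0) addEdge delEdge) s fun t s' => Inv n L N' ∅ ∅ s' ∧
      t + 40 * s'.arr 10 0 + 120 * d * s'.pot n L ∅ ≤
        120 * d * s.pot n L ∅ + 6000 * (d * L) + 2 := by
    refine Run.ite (by simp) ?_ ?_
    · intro hc
      obtain ⟨hvu, rfl⟩ := hins hc
      refine (addEdge_run hp hN.sub hI hu hv huv hvu (fun h => hvu (hN.symm _ _ h)) h1 h2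
        (by omega)).mono ?_
      rintro t s' ⟨a1, a2, a3⟩
      refine ⟨a1, ?_⟩
      simp only [State.pot, a2.2 5 (by decide), a2.2 6 (by decide), a2.2 2 (by decide)] at hpot ⊢
      simp
      omega
    · intro hc
      obtain ⟨hvu, rfl⟩ := hdel hc
      refine (delEdge_run hp hN hI hu hv huv hvu h1 h2 (by rw [mul_add]; omega)).mono ?_
      rintro t s' ⟨a1, a2, a3⟩
      rw [mul_add] at a3
      refine ⟨a1, ?_⟩
      simp
      omega
  refine hmain.mono ?_
  rintro t1 s1 ⟨a1, a2⟩
  refine (drain_run hp hN' a1 ?_).mono ?_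
  · rw [mul_add]
    omega
  · rintro t2 s2 ⟨b1, b2, b3, b4⟩
    refine ⟨b1, b2, ?_⟩
    omega


/-! ### The initial graph -/

/-- Tabulate the powers of two and compute the number of levels. -/
def initPow : Cmd :=
  .seq (.assign 4 (#0)) <| .seq (.store 9 (#0) (#1)) <|
  .loop (.op .lt (.get 9 (%4)) (.op .add (%3) (#1)))
    (.seq (.store 9 (.op .add (%4) (#1)) (.op .mul (#2) (.get 9 (%4))))
      (.assign 4 (.op .add (%4) (#1))))

/-- Make every vertex a cluster of its own. -/
def initVertices : Cmd :=
  .seq (.assign 5 (#0)) <| forTo 5 (%3) <|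
    .seq (.store 3 (.op .mul (%5) (%3)) (%5)) <| .seq (.store 4 (%5) (#1)) <|
    .seq (.store 5 (%5) (%5)) <| .seq (.store 2 (%5) (#1)) <| .seq (.assign 7 (#0)) <|
    forTo 7 (%4) (.store 7 (.op .add (.op .mul (%5) (%3)) (%7)) (#1))

/-- Insert the edges given in arrays `0` and `1`. -/
def initEdges : Cmd :=
  .seq (.assign 5 (#0)) <| forTo 5 (%6) <|
    .seq (.assign 1 (.get 0 (%5))) <| .seq (.assign 2 (.get 1 (%5))) addEdge

/-- The program run on the initial graph. -/
def initCmd : Cmd :=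
  .seq (.assign 3 (%0)) <| .seq (.assign 6 (%1)) <| .seq initPow <| .seq initVertices <|
  .seq initEdges drain

/-- The loop stops at the first power of two exceeding `n`, which is `2 ^ L` by `Params`. -/
theorem initPow_run {n L : ℕ} (hp : Params n L w) (h3 : s.reg 3 = n) :
    Run w initPow s fun t s' => s'.reg 4 = L ∧ (∀ k < L, s'.arr 9 k = 2 ^ k) ∧
      s'.reg 3 = n ∧ s'.reg 6 = s.reg 6 ∧ (∀ a, a ≠ 9 → s'.arr a = s.arr a) ∧ t ≤ 40 * L := by
  have hW := hp.lt_word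
  have hLn := hp.le
  have hL := hp.pos
  apply Run.seq
  refine Run.assign (by simp) ?_
  apply Run.seq
  refine Run.store (by simp) (by simp [hp.ne_zero]) ?_
  suffices H : ∀ j k s', k + j = L → s'.reg 4 = k → (∀ i ≤ k, s'.arr 9 i = 2 ^ i) →
      s'.reg 3 = n → s'.reg 6 = s.reg 6 → (∀ a, a ≠ 9 → s'.arr a = s.arr a) →
      Run w (.loop (.op .lt (.get 9 (%4)) (.op .add (%3) (#1)))
        (.seq (.store 9 (.op .add (%4) (#1)) (.op .mul (#2) (.get 9 (%4))))
          (.assign 4 (.op .add (%4) (#1))))) s' fun t s' => s'.reg 4 = L ∧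
            (∀ k < L, s'.arr 9 k = 2 ^ k) ∧ s'.reg 3 = n ∧ s'.reg 6 = s.reg 6 ∧
            (∀ a, a ≠ 9 → s'.arr a = s.arr a) ∧ t ≤ 20 * j + 10 by
    refine (H L 0 _ (by omega) (by simp) (by simp) (by simpa using h3) (by simp) ?_).mono ?_
    · intro a ha
      simp [ha]
    · rintro t s' ⟨b1, b2, b3, b4, b5, b6⟩
      refine ⟨b1, b2, b3, b4, b5, ?_⟩
      simp
      omega
  intro j
  induction j with
  | zero =>
    intro k s' hk h4 h9 h3 h6 ha
    have hlt := hp.lt_pow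
    rw [show L = k by omega] at hlt
    refine Run.loopFalse (by simp [h3, hp.ne_zero]; omega) ?_
      ⟨by omega, fun i hi => h9 i (by omega), h3, h6, ha, by simp⟩
    simp [h3, h4, h9 k le_rfl]
    omega
  | succ j ih =>
    intro k s' hk h4 h9 h3 h6 ha
    have hle := hp.pow_le' (show k < L by omega)
    refine Run.loopTrue (by simp [h3, hp.ne_zero]; omega) ?_ ?_
    · simp [h3, h4, h9 k le_rfl]
      omega
    apply Run.seq
    refine Run.store (by simp [h4, hp.ne_zero]; omega) (by simp [h4, h9 k le_rfl]; omega) ?_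
    refine Run.assign (by simp [h4, hp.ne_zero]; omega) ?_
    refine (ih (k + 1) _ (by omega) (by simp [h4]) ?_ (by simpa using h3) (by simpa using h6)
      ?_).mono ?_
    · intro i hi
      simp [h4, h9 k le_rfl]
      rcases Nat.lt_or_eq_of_le hi with h | h
      · rw [Function.update_of_ne h.ne]
        exact h9 i (by omega)
      · rw [h, Function.update_self, pow_succ, mul_comm]
    · intro a h
      simp [h, ha a h]
    · rintro t s2 ⟨b1, b2, b3, b4, b5, b6⟩
      refine ⟨b1, b2, b3, b4, b5, ?_⟩
      simp
      omega

/-- Closed neighbourhoods in the graph without edges. -/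
def loneNb (n : ℕ) : ℕ → Finset ℕ := fun v => (Finset.range n).filter (· = v)

theorem loneNb_eq {n v : ℕ} (hv : v < n) : loneNb n v = {v} := by
  ext u
  simp only [loneNb, Finset.mem_filter, Finset.mem_range, Finset.mem_singleton]
  exact ⟨fun h => h.2, fun h => ⟨h ▸ hv, h⟩⟩

/-- Singleton clusters at level 0 have distance `L` and slack `2 * 1 - 1 = 1` each, so the potential
is `10 * n * L + 11 * n`. All counters are 1, below `8 * 2 ^ k`, so the empty stack is correct. -/
theorem initVertices_run {n L : ℕ} (hp : Params n L w) (h3 : s.reg 3 = n) (h4 : s.reg 4 = L)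
    (h9 : ∀ k < L, s.arr 9 k = 2 ^ k) (h10 : s.arr 10 0 = 0) (h6 : ∀ v, s.arr 6 v = 0) :
    Run w initVertices s fun t s' => Inv n L (loneNb n) ∅ ∅ s' ∧ s'.arr 10 0 = 0 ∧
      s'.reg 6 = s.reg 6 ∧ s'.arr 0 = s.arr 0 ∧ s'.arr 1 = s.arr 1 ∧
      s'.pot n L ∅ ≤ 21 * (n * L) ∧ t ≤ 60 * (n * L) := by
  have hW := hp.lt_word
  have hWn := hp.word
  have hLn := hp.le
  have hL := hp.pos
  have hnL : n ≤ n * L := Nat.le_mul_of_pos_right _ hL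
  apply Run.seq
  refine Run.assign (by simp) ?_
  refine Run.forTo 0 n (fun k T s' => s'.reg 3 = n ∧ s'.reg 4 = L ∧ s'.reg 6 = s.reg 6 ∧
    (∀ a ∈ [0, 1, 6, 8, 9, 10], s'.arr a = s.arr a) ∧ (∀ v < k, s'.arr 3 (v * n) = v) ∧
    (∀ v < k, s'.arr 4 v = 1) ∧ (∀ v < k, s'.arr 5 v = v) ∧ (∀ v < k, s'.arr 2 v = 1) ∧
    (∀ v < k, ∀ i < L, s'.arr 7 (v * n + i) = 1) ∧ T ≤ k * (15 * L + 35)) (by omega) (by simp)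
    ⟨by simpa using h3, by simpa using h4, by simp, by simp, by simp, by simp, by simp, by simp,
      by simp, by simp⟩ (by omega) ?_ ?_ ?_
  · rintro k T s' - - - ⟨h, -⟩
    simp [h]
  · rintro k T s' - hk hr ⟨a1, a2, a3, a4, a5, a6, a7, a8, a9, a10⟩
    have hix := idx_lt hk (show 0 < n by omega)
    have hixL := idx_lt hk (show L - 1 < n by omega)
    apply Run.seq
    refine Run.store (by simp [hr, a1]; omega) (by simp) ?_
    apply Run.seq
    refine Run.store (by simp) (by simp [hp.ne_zero]) ?_
    apply Run.seq
    refine Run.store (by simp) (by simp) ?_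
    apply Run.seq
    refine Run.store (by simp) (by simp [hp.ne_zero]) ?_
    apply Run.seq
    refine Run.assign (by simp) ?_
    simp only [Expr.val, BinOp.eval, State.setArr_reg, hr, a1]
    obtain ⟨s1, hs1⟩ : ∃ s1, s1 = ((((s'.setArr 3 (k * n) k).setArr 4 k 1).setArr 5 k k).setArr
      2 k 1).setReg 7 0 := ⟨_, rfl⟩
    rw [← hs1]
    have e7 : s1.arr 7 = s'.arr 7 := by simp [hs1]
    refine Run.forTo 0 L (fun i T s2 => (∀ r < 7, s2.reg r = s'.reg r) ∧
      (∀ a, a ≠ 7 → s2.arr a = s1.arr a) ∧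
      (∀ v < k, ∀ i < L, s2.arr 7 (v * n + i) = 1) ∧ (∀ j < i, s2.arr 7 (k * n + j) = 1) ∧
      T ≤ 15 * i) (by omega) (by simp [hs1])
      ⟨fun r hr => by simp [hs1, hr.ne], fun _ _ => rfl, by rw [e7]; exact a9, by simp, by simp⟩
      (by omega) ?_ ?_ ?_
    · rintro i T s2 - - - ⟨h, -⟩
      simp [h 4 (by norm_num), a2]
    · rintro i T s2 - hi hri ⟨b1, b2, b3, b4, b5⟩
      have hixi := idx_lt hk (show i < n by omega)
      have r5 : s2.reg 5 = k := by rw [b1 5 (by norm_num), hr]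
      have r3 : s2.reg 3 = n := by rw [b1 3 (by norm_num), a1]
      refine Run.store (by simp [hri, r5, r3]; constructor <;> omega) (by simp [hp.ne_zero]) ?_
      simp only [Expr.val, BinOp.eval, hri, r5, r3]
      refine ⟨hri, ?_, ?_, ?_, ?_, by simp; omega⟩
      · intro r hr
        simp [hr.ne, b1 r hr]
      · intro a ha
        simp [ha, b2 a ha]
      · intro v hv j hj
        simp only [State.setReg_arr, State.setArr_arr, if_true, Function.update_apply]
        split
        · rfl
        · exact b3 v hv j hj
      · intro j hj
        simp only [State.setReg_arr, State.setArr_arr, if_true, Function.update_apply]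
        split
        · rfl
        · exact b4 j (by omega)
    · rintro T2 s2 ⟨b1, b2, b3, b4, b5⟩ _
      have r5 : s2.reg 5 = k := by rw [b1 5 (by norm_num), hr]
      have upd : ∀ (a : ℕ) (f : ℕ → ℕ), s2.arr a = Function.update (s'.arr a) k (f k) →
          (∀ v < k, s'.arr a v = f v) → ∀ v < k + 1, s2.arr a v = f v := by
        intro a f h h' v hv
        rw [h]
        by_cases e : v = k
        · subst e; simp
        · rw [Function.update_of_ne e]
          exact h' v (by omega)
      refine ⟨r5, ?_, ?_, ?_, ?_, ?_, ?_, ?_, ?_, ?_, ?_⟩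
      · simp [b1 3 (by norm_num), a1]
      · simp [b1 4 (by norm_num), a2]
      · simp [b1 6 (by norm_num), a3]
      · intro a ha
        have ha7 : a ≠ 7 := by rintro rfl; simp at ha
        have h2 : a ≠ 2 := by rintro rfl; simp at ha
        have h3 : a ≠ 3 := by rintro rfl; simp at ha
        have h4 : a ≠ 4 := by rintro rfl; simp at ha
        have h5 : a ≠ 5 := by rintro rfl; simp at ha
        rw [State.setReg_arr, b2 a ha7, hs1]
        simp [h2, h3, h4, h5, a4 a ha]
      · intro v hv
        rw [State.setReg_arr, b2 3 (by norm_num), hs1]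
        simp
        by_cases e : v = k
        · subst e; simp
        · have : v * n + 0 ≠ k * n + 0 := fun h => e (idx_inj (by omega) (by omega) h).1
          rw [Function.update_of_ne (by omega)]
          exact a5 v (by omega)
      · exact upd 4 (fun _ => 1) (by rw [b2 4 (by norm_num), hs1]; simp) a6
      · exact upd 5 (fun v => v) (by rw [b2 5 (by norm_num), hs1]; simp) a7
      · exact upd 2 (fun _ => 1) (by rw [b2 2 (by norm_num), hs1]; simp) a8
      · intro v hv i hi
        by_cases e : v = k
        · subst e; exact b4 i hi
        · exact b3 v (by omega) i hi
      · rw [add_mul, one_mul]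
        simp
        omega
  · rintro T s' ⟨a1, a2, a3, a4, a5, a6, a7, a8, a9, a10⟩ _
    have e6 : ∀ v, s'.arr 6 v = 0 := by rw [a4 6 (by simp)]; exact h6
    have e10 : s'.arr 10 0 = 0 := by rw [a4 10 (by simp)]; exact h10
    refine ⟨⟨⟨⟨a1, a2, ?_, ?_, ?_, ?_, ?_⟩, ?_⟩, ?_, ?_, ?_, ?_⟩, e10, a3, a4 0 (by simp),
      a4 1 (by simp), ?_, ?_⟩
    · rw [a4 9 (by simp)]; exact h9
    · intro v hv
      rw [a6 v hv, loneNb_eq hv]; rfl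
    · intro v hv
      rw [loneNb_eq hv]
      simp [a5 v hv]
    · intro z hz k hk h
      rw [a9 z hz k hk] at h
      have : 1 ≤ 2 ^ k := Nat.one_le_two_pow
      omega
    · intro p hp
      omega
    · intro z hz k hk
      rw [a9 z hz k hk, loneNb_eq hz, Finset.filter_true_of_mem (by simp [e6])]
      rfl
    · intro v hv
      rw [a7 v hv, loneNb_eq hv]
      simp
    · intro u hu
      rw [a8 u hu, Finset.card_eq_one.mpr]
      refine ⟨u, ?_⟩
      ext v
      simp only [Finset.mem_filter, Finset.mem_range, Finset.mem_singleton]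
      constructor
      · rintro ⟨h, h'⟩
        rwa [a7 v h] at h'
      · rintro rfl
        exact ⟨hu, a7 v hu⟩
    · intro u hu
      rw [e6]; exact hL
    · intro u _ _
      exact Or.inl (e6 u)
    · have h1 : ∑ v ∈ Finset.range n, (L - s'.arr 6 (s'.arr 5 v)) = n * L := by
        simp [e6]
      have h2 : ∑ u ∈ Finset.range n \ ∅, (2 * 2 ^ s'.arr 6 u - s'.arr 2 u) = n := by
        rw [Finset.sdiff_empty, Finset.sum_congr rfl (g := fun _ => 1) (fun v hv => by
          rw [e6, a8 v (by simpa using hv)]; rfl)]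
        simp
      unfold State.pot potential
      rw [h1, h2]
      omega
    · have : n * (15 * L + 35) = 15 * (n * L) + 35 * n := by ring
      simp
      omega

/-- Closed neighbourhoods after the insertion of the first `k` edges of `p`. -/
def rows (n : ℕ) (p : ℕ → ℕ × ℕ) : ℕ → ℕ → Finset ℕ
  | 0 => loneNb n
  | k + 1 => addNb (rows n p k) (p k).1 (p k).2

theorem mem_rows {n k x y : ℕ} {p : ℕ → ℕ × ℕ} (hp : ∀ i < k, (p i).1 ≠ (p i).2) :
    x ∈ rows n p k y ↔ (x < n ∧ x = y) ∨ ∃ i < k, p i = (x, y) ∨ p i = (y, x) := by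
  induction k with
  | zero => simp only [rows, loneNb, Finset.mem_filter, Finset.mem_range, not_lt_zero, false_and,
      exists_const, or_false]
  | succ k ih =>
    rw [rows, mem_addNb (hp k (by omega)), ih fun i hi => hp i (by omega), or_assoc]
    apply or_congr_right
    constructor
    · rintro (⟨i, hi, h⟩ | ⟨rfl, rfl⟩ | ⟨rfl, rfl⟩)
      · exact ⟨i, by omega, h⟩
      · exact ⟨k, by omega, Or.inr rfl⟩
      · exact ⟨k, by omega, Or.inl rfl⟩
    · rintro ⟨i, hi, h⟩
      rcases Nat.lt_or_eq_of_le (Nat.lt_succ_iff.mp hi) with hi | rfl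
      · exact Or.inl ⟨i, hi, h⟩
      · rcases h with h | h <;> simp [h]

/-- Insertions leave the clusters alone, so the potential stays that of singletons while violations
accumulate on the stack, to be repaired by a single `drain`. -/
theorem initEdges_run {n L m : ℕ} {p : ℕ → ℕ × ℕ} (hp : Params n L w)
    (hI : Inv n L (loneNb n) ∅ ∅ s) (h10 : s.arr 10 0 = 0) (h6 : s.reg 6 = m)
    (ha0 : ∀ i < m, s.arr 0 i = (p i).1) (ha1 : ∀ i < m, s.arr 1 i = (p i).2)
    (hlt : ∀ i < m, (p i).1 < n ∧ (p i).2 < n) (hne : ∀ i < m, (p i).1 ≠ (p i).2)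
    (hnd : ∀ i < m, ∀ j < i, p j ≠ p i ∧ p j ≠ ((p i).2, (p i).1))
    (hsp : 500 * (m + 1) * L ≤ 2 ^ w) :
    Run w initEdges s fun t s' => Inv n L (rows n p m) ∅ ∅ s' ∧ s'.pot n L ∅ = s.pot n L ∅ ∧
      t + 40 * s'.arr 10 0 ≤ 250 * m * L + 6 := by
  have hL := hp.pos
  have hmW : m + 1 ≤ (m + 1) * L := Nat.le_mul_of_pos_right _ hL
  have hsp' : 500 * (m * L) + 500 * L ≤ 2 ^ w := by
    calc _ = 500 * (m + 1) * L := by ring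
      _ ≤ _ := hsp
  have hmm : m ≤ m * L := Nat.le_mul_of_pos_right _ hL
  apply Run.seq
  refine Run.assign (by simp) ?_
  refine Run.forTo 0 m (fun k T s' => Inv n L (rows n p k) ∅ ∅ s' ∧ s'.reg 6 = m ∧
    s'.arr 0 = s.arr 0 ∧ s'.arr 1 = s.arr 1 ∧ s'.pot n L ∅ = s.pot n L ∅ ∧
    T + 40 * s'.arr 10 0 ≤ 250 * (k * L)) (by omega) (by simp)
    ⟨hI.setReg, by simpa using h6, rfl, rfl, rfl, by simp [h10]⟩ (by omega) ?_ ?_ ?_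
  · rintro k T s' - - - ⟨-, h, -⟩
    simp [h]
  · rintro k T s' - hk hr ⟨b1, b2, b3, b4, b5, b6⟩
    obtain ⟨l1, l2⟩ := hlt k hk
    have hkm : (k + 1) * L ≤ m * L := Nat.mul_le_mul_right _ hk
    rw [add_mul, one_mul] at hkm
    have hmem : ∀ x y, x ∈ rows n p k y ↔ (x < n ∧ x = y) ∨ ∃ i < k, p i = (x, y) ∨ p i = (y, x) :=
      fun x y => mem_rows fun i hi => hne i (by omega)
    apply Run.seq
    refine Run.assign (by simp) ?_
    apply Run.seq
    refine Run.assign (by simp) ?_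
    refine (addEdge_run (u := (p k).1) (v := (p k).2) (N := rows n p k) hp ?_ ?_ l1 l2 (hne k hk)
      ?_ ?_ (by simp [hr, b3, ha0 k hk]) (by simp [hr, b4, ha1 k hk]) (by simp; omega)).mono ?_
    · intro y x hx
      rw [hmem] at hx
      rcases hx with h | ⟨i, hi, h | h⟩
      · simpa using h.1
      · have := hlt i (by omega)
        rw [h] at this
        simpa using this.1
      · have := hlt i (by omega)
        rw [h] at this
        simpa using this.2
    · exact ⟨b1.core.congr (by simp) (by simp) (by simp), b1.clusters.1, b1.clusters.2,
        b1.clusters.3, b1.clusters.4⟩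
    · rw [hmem]
      rintro (h | ⟨i, hi, h | h⟩)
      · exact hne k hk h.2.symm
      · exact (hnd k hk i hi).2 h
      · exact (hnd k hk i hi).1 h
    · rw [hmem]
      rintro (h | ⟨i, hi, h | h⟩)
      · exact hne k hk h.2
      · exact (hnd k hk i hi).1 h
      · exact (hnd k hk i hi).2 h
    rintro t s2 ⟨c1, c2, c3⟩
    simp only [State.setReg_arr] at c3
    refine ⟨?_, c1.setReg, ?_, ?_, ?_, ?_, ?_⟩
    · rw [c2.1 5 (by norm_num)]; simpa using hr
    · simp [c2.1 6 (by norm_num), b2]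
    · simp [c2.2 0 (by decide), b3]
    · simp [c2.2 1 (by decide), b4]
    · simp only [State.pot, State.setReg_arr, c2.2 5 (by decide), c2.2 6 (by decide),
        c2.2 2 (by decide)]
      exact b5
    · rw [add_mul, one_mul]
      simp
      omega
  · rintro T s' ⟨b1, b2, b3, b4, b5, b6⟩ _
    refine ⟨b1, b5, ?_⟩
    rw [mul_assoc]
    simp
    omega

/-- Of the 3000, the initial potential takes `2520 = 120 * 21`; building the tables and inserting
the edges, at most `n * d` of them, takes the rest. -/
theorem initCmd_run {n L m d : ℕ} {p : ℕ → ℕ × ℕ} (hp : Params n L w) (h0 : s.reg 0 = n)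
    (h1 : s.reg 1 = m) (ha : ∀ a, 2 ≤ a → ∀ i, s.arr a i = 0)
    (ha0 : ∀ i < m, s.arr 0 i = (p i).1) (ha1 : ∀ i < m, s.arr 1 i = (p i).2)
    (hlt : ∀ i < m, (p i).1 < n ∧ (p i).2 < n) (hne : ∀ i < m, (p i).1 ≠ (p i).2)
    (hnd : ∀ i < m, ∀ j < i, p j ≠ p i ∧ p j ≠ ((p i).2, (p i).1))
    (hN : Nbhds n d (rows n p m)) (hm : m ≤ n * d) (hd : 1 ≤ d)
    (hW : 5000 * (n * d * L) ≤ 2 ^ w) :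
    Run w initCmd s fun t s' => Inv n L (rows n p m) ∅ ∅ s' ∧ s'.arr 10 0 = 0 ∧
      t + 120 * d * s'.pot n L ∅ ≤ 3000 * (n * d * L) := by
  have hL := hp.pos
  have hLn := hp.le
  have hmL : m * L ≤ n * d * L := Nat.mul_le_mul_right _ hm
  have hnd1 : n ≤ n * d := Nat.le_mul_of_pos_right _ hd
  have hndL : n * L ≤ n * d * L := Nat.mul_le_mul_right _ hnd1
  have hLL : L ≤ n * L := Nat.le_mul_of_pos_left _ (by omega)
  have e1 : 120 * d * (21 * (n * L)) = 2520 * (n * d * L) := by ring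
  have e2 : 120 * d * (10 * L) ≤ 1200 * (n * d * L) := by
    calc 120 * d * (10 * L) = 1200 * (1 * d * L) := by ring
      _ ≤ _ := by gcongr; omega
  apply Run.seq
  refine Run.assign (by simp) ?_
  apply Run.seq
  refine Run.assign (by simp) ?_
  apply Run.seq
  refine (initPow_run hp (by simp [h0])).mono ?_
  rintro t1 s1 ⟨a1, a2, a3, a4, a5, a6⟩
  simp [h1] at a4 a5
  apply Run.seq
  refine (initVertices_run hp a3 a1 a2 (by rw [a5 10 (by norm_num)]; exact ha 10 (by norm_num) 0)
    (by rw [a5 6 (by norm_num)]; exact ha 6 (by norm_num))).mono ?_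
  rintro t2 s2 ⟨b1, b2, b3, b4, b5, b6, b7⟩
  rw [a4] at b3
  rw [a5 0 (by norm_num)] at b4
  rw [a5 1 (by norm_num)] at b5
  apply Run.seq
  refine (initEdges_run (p := p) (m := m) hp b1 b2 b3 (by rw [b4]; exact ha0)
    (by rw [b5]; exact ha1) hlt hne hnd ?_).mono ?_
  · have : 500 * (m + 1) * L = 500 * (m * L) + 500 * L := by ring
    omega
  rintro t3 s3 ⟨c1, c2, c3⟩
  rw [mul_assoc] at c3
  have hpot := Nat.mul_le_mul_left (120 * d) (c2.trans_le b6)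
  rw [e1] at hpot
  refine (drain_run hp hN c1 ?_).mono ?_
  · rw [mul_add]
    omega
  · rintro t4 s4 ⟨d1, d2, d3, d4⟩
    refine ⟨d1, d2, ?_⟩
    simp
    omega


/-! ### The approximation ratio -/

theorem card_centres_le {n L : ℕ} {N : ℕ → Finset ℕ} (hI : Inv n L N ∅ ∅ s) (h0 : s.arr 10 0 = 0) {O : Finset ℕ} (hO : O ⊆ Finset.range n)
    (hdom : ∀ v < n, ∃ o ∈ O, v ∈ N o) :
    ((Finset.range n).filter fun u => s.arr 2 u ≠ 0).card ≤ 8 * L * O.card := by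
  obtain ⟨hC, hK⟩ := hI
  rw [Finset.card_eq_sum_card_fiberwise (f := s.arr 6) (t := Finset.range L)]
  swap
  · intro u hu
    simp only [Finset.coe_filter, Finset.mem_range, Set.mem_ofPred_eq] at hu
    simpa using hK.lev u hu.1
  have hlevel : ∀ l ∈ Finset.range L,
      (((Finset.range n).filter fun u => s.arr 2 u ≠ 0).filter fun u => s.arr 6 u = l).card ≤
        8 * O.card := by
    intro l hl
    obtain ⟨D, hD⟩ : ∃ D, D = ((Finset.range n).filter fun u => s.arr 2 u ≠ 0).filter
      fun u => s.arr 6 u = l := ⟨_, rfl⟩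
    rw [← hD]
    have hDm : ∀ u, u ∈ D ↔ (u < n ∧ s.arr 2 u ≠ 0) ∧ s.arr 6 u = l := by
      intro u; simp [hD]
    -- For level 0 the bound `2 ^ 0 ≤ sz` is just nonemptiness of the cluster.
    have h1 : D.card * 2 ^ l ≤ ∑ u ∈ D, s.arr 2 u := by
      rw [← smul_eq_mul]
      apply Finset.card_nsmul_le_sum
      intro u hu
      obtain ⟨⟨a, b⟩, c⟩ := (hDm u).mp hu
      rcases hK.big u a (by simp) with h | h
      · rw [← c, h]
        omega
      · rwa [c] at h
    have h2 : ∑ u ∈ D, s.arr 2 u = ((Finset.range n).filter fun v => s.arr 5 v ∈ D).card := by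
      rw [Finset.card_eq_sum_card_fiberwise (f := s.arr 5) (t := D)]
      · apply Finset.sum_congr rfl
        intro u hu
        rw [hK.size u ((hDm u).mp hu).1.1]
        congr 1
        ext v
        simp only [Finset.mem_filter]
        exact ⟨fun h => ⟨⟨h.1, h.2 ▸ hu⟩, h.2⟩, fun h => ⟨h.1.1, h.2⟩⟩
      · intro v hv
        simpa using (Finset.mem_filter.mp (Finset.mem_coe.mp hv)).2
    -- All these vertices have level exactly `l`, so the counters of the dominating vertices at `l`
    -- include them.
    have h3 : ((Finset.range n).filter fun v => s.arr 5 v ∈ D) ⊆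
        O.biUnion fun o => (N o).filter fun v => s.arr 6 (s.arr 5 v) ≤ l := by
      intro v hv
      obtain ⟨a, b⟩ := Finset.mem_filter.mp hv
      obtain ⟨o, ho, hov⟩ := hdom v (by simpa using a)
      exact Finset.mem_biUnion.mpr ⟨o, ho, Finset.mem_filter.mpr ⟨hov, ((hDm _).mp b).2.le⟩⟩
    -- A counter at or above its bound would be on the stack, which is empty.
    have h4 := (Finset.card_le_card h3).trans (Finset.card_biUnion_le_card_mul O _ (8 * 2 ^ l) (by
      intro o ho
      have hon : o < n := by simpa using hO ho
      have hlL : l < L := by simpa using hl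
      rw [← hC.cnt o hon l hlL]
      by_contra hcon
      obtain ⟨p, hp, -⟩ := hC.queue o hon l hlL (by omega) (by simp)
      omega))
    have hpos : 0 < 2 ^ l := by positivity
    have : D.card * 2 ^ l ≤ (8 * O.card) * 2 ^ l := by
      calc D.card * 2 ^ l ≤ _ := h1.trans (h2.le.trans h4)
        _ = _ := by ring
    exact Nat.le_of_mul_le_mul_right this hpos
  refine (Finset.sum_le_card_nsmul _ _ _ hlevel).trans ?_
  rw [Finset.card_range, smul_eq_mul]
  exact le_of_eq (by ring)

/-! ### Graphs -/

open Classical in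
/-- The closed neighbourhoods of a graph. -/
noncomputable def clNb {n : ℕ} (G : SimpleGraph (Fin n)) (v : ℕ) : Finset ℕ :=
  (Finset.range n).filter fun u => u = v ∨ ∃ (hv : v < n) (hu : u < n), G.Adj ⟨v, hv⟩ ⟨u, hu⟩

theorem mem_clNb {n : ℕ} {G : SimpleGraph (Fin n)} {u v : ℕ} :
    u ∈ clNb G v ↔ u < n ∧ (u = v ∨ ∃ (hv : v < n) (hu : u < n), G.Adj ⟨v, hv⟩ ⟨u, hu⟩) := by
  simp [clNb]

theorem mem_clNb_fin {n : ℕ} {G : SimpleGraph (Fin n)} {u v : Fin n} :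
    (u : ℕ) ∈ clNb G v ↔ u = v ∨ G.Adj v u := by
  simp [mem_clNb, Fin.ext_iff]

open Classical in
theorem card_clNb_le {n : ℕ} (G : SimpleGraph (Fin n)) (v : ℕ) :
    (clNb G v).card ≤ G.maxDegree + 1 := by
  by_cases hv : v < n
  · have : clNb G v ⊆ (insert ⟨v, hv⟩ (G.neighborFinset ⟨v, hv⟩)).image Fin.val := by
      intro u hu
      obtain ⟨hun, h⟩ := mem_clNb.mp hu
      refine Finset.mem_image.mpr ⟨⟨u, hun⟩, ?_, rfl⟩
      rcases h with rfl | ⟨_, _, h⟩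
      · simp
      · simp [h]
    refine (Finset.card_le_card this).trans (Finset.card_image_le.trans
      ((Finset.card_insert_le _ _).trans ?_))
    simpa using G.degree_le_maxDegree ⟨v, hv⟩
  · rw [show clNb G v = ∅ from Finset.eq_empty_of_forall_notMem fun u hu => by
      obtain ⟨hun, rfl | ⟨h, -⟩⟩ := mem_clNb.mp hu <;> exact hv (by assumption)]
    simp

theorem nbhds_clNb {n d : ℕ} {G : SimpleGraph (Fin n)} (hd : ∀ v, (clNb G v).card ≤ d) :
    Nbhds n d (clNb G) where
  sub v u hu := by simpa using (mem_clNb.mp hu).1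
  self v hv := mem_clNb.mpr ⟨hv, Or.inl rfl⟩
  symm u v h := by
    obtain ⟨hu, rfl | ⟨hv, hu', h⟩⟩ := mem_clNb.mp h
    · exact mem_clNb.mpr ⟨hu, Or.inl rfl⟩
    · exact mem_clNb.mpr ⟨hv, Or.inr ⟨hu, hv, h.symm⟩⟩
  card := hd

theorem clNb_insert {n : ℕ} {G : SimpleGraph (Fin n)} {u v : Fin n} (huv : u ≠ v) :
    clNb (G ⊔ SimpleGraph.edge u v) = addNb (clNb G) u v := by
  funext y
  ext x
  have hne : (u : ℕ) ≠ v := fun h => huv (Fin.ext h)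
  rw [mem_addNb hne, mem_clNb, mem_clNb]
  constructor
  · rintro ⟨hx, rfl | ⟨hy, hx, h⟩⟩
    · exact Or.inl ⟨hx, Or.inl rfl⟩
    · rw [SimpleGraph.sup_adj, SimpleGraph.edge_adj] at h
      rcases h with h | ⟨⟨rfl, rfl⟩ | ⟨rfl, rfl⟩, -⟩
      · exact Or.inl ⟨hx, Or.inr ⟨hy, hx, h⟩⟩
      · exact Or.inr (Or.inl ⟨rfl, rfl⟩)
      · exact Or.inr (Or.inr ⟨rfl, rfl⟩)
  · rintro (⟨hx, rfl | ⟨hy, hx, h⟩⟩ | ⟨rfl, rfl⟩ | ⟨rfl, rfl⟩)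
    · exact ⟨hx, Or.inl rfl⟩
    · exact ⟨hx, Or.inr ⟨hy, hx, Or.inl h⟩⟩
    · refine ⟨v.2, Or.inr ⟨u.2, v.2, Or.inr ?_⟩⟩
      rw [SimpleGraph.edge_adj]
      exact ⟨Or.inl ⟨rfl, rfl⟩, huv⟩
    · refine ⟨u.2, Or.inr ⟨v.2, u.2, Or.inr ?_⟩⟩
      rw [SimpleGraph.edge_adj]
      exact ⟨Or.inr ⟨rfl, rfl⟩, huv.symm⟩

theorem clNb_delete {n : ℕ} {G : SimpleGraph (Fin n)} {u v : Fin n} (huv : u ≠ v) :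
    clNb (G.deleteEdges {s(u, v)}) = delNb (clNb G) u v := by
  funext y
  ext x
  have hne : (u : ℕ) ≠ v := fun h => huv (Fin.ext h)
  rw [mem_delNb hne, mem_clNb, mem_clNb]
  constructor
  · rintro ⟨hx, rfl | ⟨hy, hx, h⟩⟩
    · exact ⟨⟨hx, Or.inl rfl⟩, by rintro (⟨h, h'⟩ | ⟨h, h'⟩) <;> omega⟩
    · rw [SimpleGraph.deleteEdges_adj] at h
      refine ⟨⟨hx, Or.inr ⟨hy, hx, h.1⟩⟩, ?_⟩
      rintro (⟨rfl, rfl⟩ | ⟨rfl, rfl⟩)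
      · exact h.2 rfl
      · exact h.2 (by simp [Sym2.eq_swap])
  · rintro ⟨⟨hx, rfl | ⟨hy, hx, h⟩⟩, hn⟩
    · exact ⟨hx, Or.inl rfl⟩
    · refine ⟨hx, Or.inr ⟨hy, hx, ?_⟩⟩
      rw [SimpleGraph.deleteEdges_adj]
      refine ⟨h, fun hm => hn ?_⟩
      simp only [Set.mem_singleton_iff, Sym2.eq_iff, Fin.ext_iff] at hm
      exact hm

open Classical in
theorem IsEdgeList.length_le {n : ℕ} {G : SimpleGraph (Fin n)} {L : List (Fin n × Fin n)}
    (h : IsEdgeList G L) : L.length ≤ n * G.maxDegree := by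
  have h1 : (L.map fun p => s(p.1, p.2)).toFinset = G.edgeFinset := by
    ext z
    rw [List.mem_toFinset, h.2, SimpleGraph.mem_edgeFinset]
  have h2 := List.toFinset_card_of_nodup h.1
  rw [h1, List.length_map] at h2
  have h3 := G.sum_degrees_eq_twice_card_edges
  have h4 := Finset.sum_le_card_nsmul Finset.univ (fun v => G.degree v) G.maxDegree
    fun v _ => G.degree_le_maxDegree v
  rw [Finset.card_univ, Fintype.card_fin, smul_eq_mul] at h4
  omega

/-- The edges in a list, as pairs of numbers. -/
def edgeAt {n : ℕ} (L : List (Fin n × Fin n)) (i : ℕ) : ℕ × ℕ :=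
  if h : i < L.length then (((L[i]).1 : ℕ), ((L[i]).2 : ℕ)) else (0, 0)

theorem edgeAt_eq {n : ℕ} {L : List (Fin n × Fin n)} {i : ℕ} (h : i < L.length) :
    edgeAt L i = (((L[i]).1 : ℕ), ((L[i]).2 : ℕ)) := dif_pos h

theorem IsEdgeList.adj {n : ℕ} {G : SimpleGraph (Fin n)} {L : List (Fin n × Fin n)}
    (hL : IsEdgeList G L) {i : ℕ} (h : i < L.length) : G.Adj (L[i]).1 (L[i]).2 := by
  have := (hL.2 s((L[i]).1, (L[i]).2)).mp (List.mem_map.mpr ⟨L[i], List.getElem_mem h, rfl⟩)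
  simpa using this

theorem IsEdgeList.edgeAt_ne {n : ℕ} {G : SimpleGraph (Fin n)} {L : List (Fin n × Fin n)}
    (hL : IsEdgeList G L) {i : ℕ} (h : i < L.length) : (edgeAt L i).1 ≠ (edgeAt L i).2 := by
  rw [edgeAt_eq h]
  exact fun e => (hL.adj h).ne (Fin.ext e)

theorem IsEdgeList.edgeAt_distinct {n : ℕ} {G : SimpleGraph (Fin n)} {L : List (Fin n × Fin n)}
    (hL : IsEdgeList G L) {i j : ℕ} (h : i < L.length) (hj : j < i) :
    edgeAt L j ≠ edgeAt L i ∧ edgeAt L j ≠ ((edgeAt L i).2, (edgeAt L i).1) := by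
  have hjl : j < L.length := by omega
  have hne : s((L[j]).1, (L[j]).2) ≠ s((L[i]).1, (L[i]).2) := by
    intro e
    have := (hL.1.getElem_inj_iff (i := j) (j := i) (hi := by simpa using hjl)
      (hj := by simpa using h)).mp (by simpa using e)
    omega
  rw [edgeAt_eq h, edgeAt_eq hjl]
  constructor
  · intro e
    apply hne
    rw [Prod.mk.injEq, Fin.val_inj, Fin.val_inj] at e
    rw [e.1, e.2]
  · intro e
    apply hne
    rw [Prod.mk.injEq, Fin.val_inj, Fin.val_inj] at e
    rw [e.1, e.2, Sym2.eq_swap]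

theorem IsEdgeList.rows_eq {n : ℕ} {G : SimpleGraph (Fin n)} {L : List (Fin n × Fin n)}
    (hL : IsEdgeList G L) : rows n (edgeAt L) L.length = clNb G := by
  funext y
  ext x
  rw [mem_rows fun i hi => hL.edgeAt_ne hi, mem_clNb]
  constructor
  · rintro (h | ⟨i, hi, h⟩)
    · exact ⟨h.1, Or.inl h.2⟩
    · have hadj := hL.adj hi
      rw [edgeAt_eq hi, Prod.mk.injEq, Prod.mk.injEq] at h
      rcases h with ⟨rfl, rfl⟩ | ⟨rfl, rfl⟩
      · exact ⟨Fin.is_lt _, Or.inr ⟨Fin.is_lt _, Fin.is_lt _, hadj.symm⟩⟩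
      · exact ⟨Fin.is_lt _, Or.inr ⟨Fin.is_lt _, Fin.is_lt _, hadj⟩⟩
  · rintro ⟨hx, rfl | ⟨hy, hx, h⟩⟩
    · exact Or.inl ⟨hx, rfl⟩
    · have := (hL.2 s(⟨y, hy⟩, ⟨x, hx⟩)).mpr h
      obtain ⟨q, hq, he⟩ := List.mem_map.mp this
      obtain ⟨i, hi, rfl⟩ := List.getElem_of_mem hq
      refine Or.inr ⟨i, hi, ?_⟩
      rw [edgeAt_eq hi, Prod.mk.injEq, Prod.mk.injEq]
      rw [Sym2.eq_iff] at he
      rcases he with ⟨e1, e2⟩ | ⟨e1, e2⟩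
      · right; rw [e1, e2]; exact ⟨rfl, rfl⟩
      · left; rw [e1, e2]; exact ⟨rfl, rfl⟩

/-- The centre of `v` lies in the closed neighbourhood of `v`, and its cluster is nonempty because
it contains `v`. -/
theorem isDominating_output {n L : ℕ} {G : SimpleGraph (Fin n)}
    (hI : Inv n L (clNb G) ∅ ∅ s) : IsDominating G (s.output n) := by
  intro v
  obtain ⟨hun, h⟩ := mem_clNb.mp (hI.clusters.mem v v.2)
  have hpos : s.arr 2 (s.arr 5 v) ≠ 0 := by
    rw [hI.clusters.size _ hun]
    exact Finset.card_ne_zero_of_mem (Finset.mem_filter.mpr ⟨Finset.mem_range.mpr v.2, rfl⟩)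
  rcases h with h | ⟨_, _, h⟩
  · left
    rw [h] at hpos
    simpa [State.output] using hpos
  · right
    exact ⟨⟨_, hun⟩, by simpa [State.output] using hpos, h.symm⟩

theorem card_output_le {n L : ℕ} {G : SimpleGraph (Fin n)} (hI : Inv n L (clNb G) ∅ ∅ s)
    (h0 : s.arr 10 0 = 0) : (s.output n).card ≤ 8 * L * domNumber G := by
  obtain ⟨O, hO, hcard⟩ : ∃ D : Finset (Fin n), IsDominating G D ∧ D.card = domNumber G :=
    Nat.sInf_mem (s := {k | ∃ D : Finset (Fin n), IsDominating G D ∧ D.card = k})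
      ⟨_, Finset.univ, fun v => Or.inl (Finset.mem_univ v), rfl⟩
  have hinj := Fin.val_injective (n := n)
  have := card_centres_le (O := O.map ⟨Fin.val, hinj⟩) hI h0
    (fun u hu => by
      obtain ⟨x, -, rfl⟩ := Finset.mem_map.mp hu
      simp) ?_
  · rw [Finset.card_map, hcard] at this
    refine le_trans (le_of_eq ?_) this
    rw [← Finset.card_map ⟨Fin.val, hinj⟩]
    congr 1
    ext u
    simp only [State.output, Finset.mem_map, Finset.mem_filter, Finset.mem_univ, true_and,
      Function.Embedding.coeFn_mk, Finset.mem_range]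
    exact ⟨by rintro ⟨x, hx, rfl⟩; exact ⟨x.2, hx⟩, fun h => ⟨⟨u, h.1⟩, h.2, rfl⟩⟩
  · intro v hv
    rcases hO ⟨v, hv⟩ with h | ⟨u, hu, h⟩
    · exact ⟨v, Finset.mem_map.mpr ⟨_, h, rfl⟩, mem_clNb.mpr ⟨hv, Or.inl rfl⟩⟩
    · exact ⟨u, Finset.mem_map.mpr ⟨_, hu, rfl⟩, mem_clNb.mpr ⟨hv, Or.inr ⟨u.2, hv, h⟩⟩⟩

/-! ### The dynamic algorithm -/

/-- The dynamic algorithm for Minimum Dominating Set. -/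
def domAlg : DynAlg := ⟨initCmd, updateCmd⟩

theorem params_log {n : ℕ} (hn : 2 ≤ n) (hw : 2 ^ 16 * n ^ 4 ≤ 2 ^ w) :
    Params n (Nat.log 2 n + 1) w where
  pos := Nat.succ_pos _
  le := Nat.log_lt_self 2 (by omega)
  lt_pow := Nat.lt_pow_succ_log_self (by norm_num) n
  pow_le := Nat.pow_log_le_self 2 (by omega)
  word := by
    refine le_trans ?_ hw
    have h1 : 1 ≤ n ^ 2 := Nat.one_le_pow _ _ (by omega)
    have h2 : n ^ 2 ≤ n ^ 4 := Nat.pow_le_pow_right (by omega) (by norm_num)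
    nlinarith

open Classical in
theorem le_maxDegreeOver {n M t : ℕ} (G : ℕ → SimpleGraph (Fin n)) (ht : t ≤ M) :
    (G t).maxDegree ≤ maxDegreeOver M G :=
  Finset.le_sup (f := fun t => (G t).maxDegree) (by simpa using Nat.lt_succ_of_le ht)

open Classical in
theorem maxDegreeOver_lt {n M : ℕ} (hn : 0 < n) (G : ℕ → SimpleGraph (Fin n)) :
    maxDegreeOver M G < n := by
  have : Nonempty (Fin n) := ⟨⟨0, hn⟩⟩
  unfold maxDegreeOver
  rw [Finset.sup_lt_iff (by simpa using hn)]
  intro t _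
  simpa using (G t).maxDegree_lt_card_verts

-- The first update concerns an edge of `G 1` or of `G 0`. Positivity of `Δ` is what lets `d = Δ +
-- 1` be replaced by `2 * Δ`.
open Classical in
theorem maxDegreeOver_pos {n M : ℕ} {G : ℕ → SimpleGraph (Fin n)} {e : ℕ → EdgeUpdate n}
    (hG : IsDynamicGraph M G e) (hM : 0 < M) : 0 < maxDegreeOver M G := by
  have key : ∀ t ≤ M, ∀ u v, (G t).Adj u v → 0 < maxDegreeOver M G := by
    intro t ht u v h
    refine lt_of_lt_of_le ?_ ((G t).degree_le_maxDegree u |>.trans (le_maxDegreeOver G ht))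
    exact ((G t).degree_pos_iff_exists_adj u).mpr ⟨v, h⟩
  have h := hG 0 hM
  unfold EdgeUpdate.Transforms at h
  split_ifs at h with hi
  · refine key 1 hM (e 0).u (e 0).v ?_
    rw [zero_add] at h
    rw [h.2.2, SimpleGraph.sup_adj, SimpleGraph.edge_adj]
    exact Or.inr ⟨Or.inl ⟨rfl, rfl⟩, h.1⟩
  · exact key 0 (by omega) _ _ h.1

/-- The algorithm processes all updates; the last clause is the amortized bound on the time. -/
theorem domAlg_run {n M : ℕ} (hn : 2 ≤ n) (hw : 2 ^ 16 * n ^ 4 ≤ 2 ^ w)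
    {G : ℕ → SimpleGraph (Fin n)} {e : ℕ → EdgeUpdate n} (hG : IsDynamicGraph M G e)
    {E : List (Fin n × Fin n)} (hE : IsEdgeList (G 0) E) {d L : ℕ}
    (hd : d = maxDegreeOver M G + 1) (hL : L = Nat.log 2 n + 1) :
    ∃ (σ : ℕ → State) (τ : ℕ → ℕ), domAlg.IsRun w E M e σ τ ∧
      (∀ t ≤ M, Inv n L (clNb (G t)) ∅ ∅ (σ t) ∧ (σ t).arr 10 0 = 0) ∧
      ∑ i ∈ Finset.range (M + 1), τ i ≤ 3000 * (n * d * L) + M * (7200 * (d * L)) := by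
  have hp : Params n L w := hL ▸ params_log hn hw
  have hLn := hp.le
  have hdn : d ≤ n := hd ▸ maxDegreeOver_lt (by omega) G
  have h1w : 1 < 2 ^ w := by have := hp.lt_word; omega
  have hnb : ∀ t ≤ M, Nbhds n d (clNb (G t)) := fun t ht => nbhds_clNb fun v =>
    (card_clNb_le (G t) v).trans (by have := le_maxDegreeOver G ht; omega)
  -- As `d` and `L` are at most `n`, both word-size demands are cubic in `n` up to constants, well
  -- below `2 ^ 16 * n ^ 4`.
  have hW1 : 5000 * (n * d * L) ≤ 2 ^ w := by
    refine le_trans ?_ hw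
    calc 5000 * (n * d * L) ≤ 2 ^ 16 * (n * n * n * 1) := by
          have : n * d * L ≤ n * n * n := by gcongr
          omega
      _ ≤ 2 ^ 16 * (n * n * n * n) := by gcongr; omega
      _ = _ := by ring
  have hW2 : 120 * d * (32 * (n * n) + 70 * L) ≤ 2 ^ w := by
    refine le_trans ?_ hw
    have hnn : n ≤ n * n := Nat.le_mul_self n
    calc 120 * d * (32 * (n * n) + 70 * L) ≤ 120 * n * (102 * (n * n)) := by
          gcongr
          omega
      _ ≤ 2 ^ 16 * (n * n * n * 1) := by
          have : 120 * n * (102 * (n * n)) = 12240 * (n * n * n * 1) := by ring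
          omega
      _ ≤ 2 ^ 16 * (n * n * n * n) := by gcongr; omega
      _ = _ := by ring
  -- The potential is carried on the left so that successive updates telescope; it is dropped at the
  -- end.
  suffices H : ∀ m ≤ M, ∃ (σ : ℕ → State) (τ : ℕ → ℕ), domAlg.IsRun w E m e σ τ ∧
      (∀ t ≤ m, Inv n L (clNb (G t)) ∅ ∅ (σ t) ∧ (σ t).arr 10 0 = 0) ∧
      ∑ i ∈ Finset.range (m + 1), τ i + 120 * d * (σ m).pot n L ∅ ≤
        3000 * (n * d * L) + m * (7200 * (d * L)) by
    obtain ⟨σ, τ, h1, h2, h3⟩ := H M le_rfl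
    exact ⟨σ, τ, h1, h2, by omega⟩
  intro m
  induction m with
  | zero =>
    intro _
    have hlen : E.length ≤ n * d := hE.length_le.trans
      (Nat.mul_le_mul_left n (by have := le_maxDegreeOver G (Nat.zero_le M); omega))
    obtain ⟨t, s, he, h1, h2, h3⟩ := initCmd_run (s := initialState n E) (n := n) (L := L)
      (m := E.length) (d := d) (p := edgeAt E) hp (by simp [initialState]) (by simp [initialState])
      (fun a ha i => by simp [initialState, show a ≠ 0 by omega, show a ≠ 1 by omega])
      (fun i hi => by simp [initialState, hi, edgeAt_eq hi])
      (fun i hi => by simp [initialState, hi, edgeAt_eq hi])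
      (fun i hi => by rw [edgeAt_eq hi]; exact ⟨Fin.is_lt _, Fin.is_lt _⟩)
      (fun i hi => hE.edgeAt_ne hi) (fun i hi j hj => hE.edgeAt_distinct hi hj)
      (by rw [hE.rows_eq]; exact hnb 0 (Nat.zero_le _)) hlen (by omega) hW1 h1w
    rw [hE.rows_eq] at h1
    refine ⟨fun _ => s, fun _ => t, ⟨he, by simp⟩, ?_, by simpa using h3⟩
    intro t ht
    obtain rfl : t = 0 := by omega
    exact ⟨h1, h2⟩
  | succ m ih =>
    intro hm
    obtain ⟨σ, τ, ⟨r0, r1⟩, h2, h3⟩ := ih (by omega)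
    obtain ⟨hI, h0⟩ := h2 m le_rfl
    have htr := hG m (by omega)
    have huv : (e m).u ≠ (e m).v := by
      unfold EdgeUpdate.Transforms at htr
      split_ifs at htr
      · exact htr.1
      · exact htr.1.ne
    have hne : ((e m).u : ℕ) ≠ (e m).v := fun h => huv (Fin.ext h)
    have hreg0 : ((σ m).receive (e m)).reg 0 = if (e m).ins = true then 1 else 0 := by
      simp [State.receive]
    obtain ⟨t, s, he, a1, a2, a3⟩ := updateCmd_run (s := (σ m).receive (e m)) (n := n) (L := L)
      (d := d) (u := (e m).u) (v := (e m).v) (N := clNb (G m)) (N' := clNb (G (m + 1))) hp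
      (hnb m (by omega)) (hnb (m + 1) hm) hW2
      ⟨hI.core.congr (by simp [State.receive]) (by simp [State.receive])
        (by simp [State.receive]), hI.clusters.1, hI.clusters.2, hI.clusters.3, hI.clusters.4⟩
      h0 (Fin.is_lt _) (Fin.is_lt _) hne (by simp [State.receive]) (by simp [State.receive])
      (fun h => by
        rw [hreg0] at h
        have hi : (e m).ins = true := by by_contra hc; simp [hc] at h
        unfold EdgeUpdate.Transforms at htr
        rw [if_pos hi] at htr
        refine ⟨?_, by rw [htr.2.2, clNb_insert huv]⟩
        rw [mem_clNb_fin]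
        rintro (h | h)
        · exact huv h.symm
        · exact htr.2.1 h)
      (fun h => by
        rw [hreg0] at h
        have hi : ¬ (e m).ins = true := by intro hc; simp [hc] at h
        unfold EdgeUpdate.Transforms at htr
        rw [if_neg hi] at htr
        refine ⟨?_, by rw [htr.2, clNb_delete huv]⟩
        rw [mem_clNb_fin]
        exact Or.inr htr.1) h1w
    refine ⟨Function.update σ (m + 1) s, Function.update τ (m + 1) t, ⟨?_, ?_⟩, ?_, ?_⟩
    · simpa using r0
    · intro i hi
      rcases Nat.lt_or_eq_of_le (Nat.lt_succ_iff.mp hi) with hi | rfl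
      · have := r1 i hi
        rwa [Function.update_of_ne (by omega), Function.update_of_ne (by omega),
          Function.update_of_ne (by omega)]
      · rw [Function.update_of_ne (by omega), Function.update_self, Function.update_self]
        exact he
    · intro i hi
      rcases Nat.lt_or_eq_of_le hi with hi | rfl
      · rw [Function.update_of_ne (by omega)]
        exact h2 i (by omega)
      · rw [Function.update_self]
        exact ⟨a1, a2⟩
    · rw [Finset.sum_range_succ, Function.update_self, Function.update_self,
        Finset.sum_congr rfl (g := fun i => τ i) fun i hi => by
          rw [Function.update_of_ne (by have := Finset.mem_range.mp hi; omega)]]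
      change _ ≤ 120 * d * (σ m).pot n L ∅ + _ at a3
      rw [add_mul m 1, one_mul]
      omega

/-- Both `Nat.log 2 n` and `1` are at most `log n / log 2`, and `2 / log 2 < 3`. -/
theorem log_succ_le {n : ℕ} (hn : 2 ≤ n) : ((Nat.log 2 n + 1 : ℕ) : ℝ) ≤ 3 * Real.log n := by
  have h2 : (0.6931471803 : ℝ) < Real.log 2 := Real.log_two_gt_d9
  have h1 : (Nat.log 2 n : ℝ) * Real.log 2 ≤ Real.log n := by
    rw [← Real.log_pow]
    apply Real.log_le_log (by positivity)
    exact_mod_cast Nat.pow_log_le_self 2 (by omega)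
  have h3 : Real.log 2 ≤ Real.log n := Real.log_le_log (by norm_num) (by exact_mod_cast hn)
  have h4 : (0 : ℝ) ≤ Nat.log 2 n := Nat.cast_nonneg _
  push_cast
  nlinarith

end DynDS

/-! ### Assembling the real constants -/

theorem theorem1 :
    ∃ (A : DynDS.DynAlg) (K : ℕ) (α : ℝ), ∀ c : ℝ, 0 < c → ∃ C : ℝ,
      ∀ (n : ℕ), 2 ≤ n → ∀ (w : ℕ), n ^ K ≤ 2 ^ w →
      ∀ (M : ℕ), c * (n : ℝ) ≤ (M : ℝ) →
      ∀ (G : ℕ → SimpleGraph (Fin n)) (e : ℕ → DynDS.EdgeUpdate n), DynDS.IsDynamicGraph M G e →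
      ∀ (L : List (Fin n × Fin n)), DynDS.IsEdgeList (G 0) L →
      ∃ (σ : ℕ → DynDS.State) (τ : ℕ → ℕ), A.IsRun w L M e σ τ ∧
        (∀ t ≤ M, DynDS.IsDominating (G t) ((σ t).output n) ∧
          ((((σ t).output n).card : ℕ) : ℝ) ≤
            α * Real.log (n : ℝ) * (DynDS.domNumber (G t) : ℝ)) ∧
        ((∑ i ∈ Finset.range (M + 1), τ i : ℕ) : ℝ) ≤
          C * (M : ℝ) * ((DynDS.maxDegreeOver M G : ℝ) * Real.log (n : ℝ)) := by
  -- `20 = 16 + 4` because `2 ^ 16 ≤ n ^ 16`; `24 = 8 * 3` and `6 = 2 * 3`, from `L ≤ 3 * log n` and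
  -- `Δ + 1 ≤ 2 * Δ`. The term `3000 / c` spreads the initial cost over the updates by `n ≤ M / c`.
  refine ⟨DynDS.domAlg, 20, 24, fun c hc => ⟨(3000 / c + 7200) * 6, ?_⟩⟩
  intro n hn w hw M hM G e hG E hE
  have hw' : 2 ^ 16 * n ^ 4 ≤ 2 ^ w := by
    refine le_trans ?_ hw
    rw [show 20 = 16 + 4 by norm_num, pow_add]
    exact Nat.mul_le_mul_right _ (Nat.pow_le_pow_left hn 16)
  have hn' : (2 : ℝ) ≤ n := by exact_mod_cast hn
  have hMpos : 0 < M := by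
    have : (0 : ℝ) < M := lt_of_lt_of_le (by positivity) hM
    exact_mod_cast this
  have hlog := DynDS.log_succ_le hn
  obtain ⟨σ, τ, hrun, hinv, htime⟩ := DynDS.domAlg_run hn hw' hG hE rfl rfl
  refine ⟨σ, τ, hrun, fun t ht => ⟨DynDS.isDominating_output (hinv t ht).1, ?_⟩, ?_⟩
  · have h := DynDS.card_output_le (hinv t ht).1 (hinv t ht).2
    have h' : (((σ t).output n).card : ℝ) ≤
        8 * ((Nat.log 2 n + 1 : ℕ) : ℝ) * (DynDS.domNumber (G t) : ℝ) := by exact_mod_cast h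
    refine h'.trans ?_
    have h0 : (0 : ℝ) ≤ DynDS.domNumber (G t) := Nat.cast_nonneg _
    nlinarith
  · have hΔ := DynDS.maxDegreeOver_pos hG hMpos
    obtain ⟨Δ, hΔe⟩ : ∃ Δ, Δ = DynDS.maxDegreeOver M G := ⟨_, rfl⟩
    rw [← hΔe] at hΔ htime ⊢
    obtain ⟨l, hl⟩ : ∃ l, l = Nat.log 2 n + 1 := ⟨_, rfl⟩
    rw [← hl] at hlog htime
    have htime' : ((∑ i ∈ Finset.range (M + 1), τ i : ℕ) : ℝ) ≤
        3000 * (n * ((Δ : ℝ) + 1) * l) + M * (7200 * (((Δ : ℝ) + 1) * l)) := by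
      exact_mod_cast htime
    refine htime'.trans ?_
    have hΔ1 : (1 : ℝ) ≤ Δ := by exact_mod_cast hΔ
    have hnM : (n : ℝ) ≤ M / c := by rw [le_div_iff₀ hc]; linarith
    have hdl : ((Δ : ℝ) + 1) * l ≤ 6 * (Δ * Real.log n) := by
      have : ((Δ : ℝ) + 1) * l ≤ (2 * Δ) * (3 * Real.log n) := by
        gcongr
        linarith
      linarith
    calc 3000 * (n * ((Δ : ℝ) + 1) * l) + M * (7200 * (((Δ : ℝ) + 1) * l))
        = (3000 * n + 7200 * M) * (((Δ : ℝ) + 1) * l) := by ring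
      _ ≤ (3000 * (M / c) + 7200 * M) * (6 * (Δ * Real.log n)) := by gcongr
      _ = (3000 / c + 7200) * 6 * M * (Δ * Real.log n) := by ring
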